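/- Let $d\ge 3$, $0\le i\le k$, $0\le j\le l$ be integers, put $M=\min(k-i,l-j)$, $p=k-i-M$, $q=l-j-M$, $w=i+j+d-2$. Let $\Omega(n)$ be the unit sphere of $\mathbb C^n$ with its normalized invariant measure $dz$ and $\langle f,g\rangle=\int_{\Omega(n)}\overline{f}g\,dz$, and let $\mathrm{Harm}_n(k,l)$ be the space of restrictions to $\Omega(n)$ of the polynomials that are homogeneous of degree $k$ in $z_1,\dots,z_n$, homogeneous of degree $l$ in $\bar z_1,\dots,\bar z_n$, and annihilated by $\sum_r\partial^2/\partial z_r\partial\bar z_r$. Fix $e\in\Omega(d)$, let $H\cong U(d-1)$ be the stabilizer of $e$ in $U(d)$, and identify the orthogonal complement of $e$ with $\mathbb C^{d-1}$ by a linear isometry. Let $H_{d-1}^{k',l'}(i,j)$ be the part of $\mathrm{Harm}_d(k',l')$ that is isomorphic to $\mathrm{Harm}_{d-1}(i,j)$ as a representation of $H$ (the sum of the images of all $H$-equivariant linear maps $\mathrm{Harm}_{d-1}(i,j)\to\mathrm{Harm}_d(k',l')$), and put $S_a=H_{d-1}^{k-M+a,\,l-M+a}(i,j)$ for $0\le a\le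 M$; these are the $m_{k,l}^{i,j}=M+1$ copies of $\mathrm{Harm}_{d-1}(i,j)$ in $\mathrm{Hom}_d(k,l)$. Call $(e_{a,s})_{0\le a\le M,\,1\le s\le h}$ an admissible system if, for every $a$, $(e_{a,s})_s$ is an orthonormal basis of $S_a$ and is the image of $(e_{0,s})_s$ under some isomorphism $S_0\to S_a$ of representations of $H$. Its zonal matrix is $Z(x,y)=E(x)E(y)^*$ with $E(x)=(e_{a,s}(x))_{a,s}$. For $n\ge2$ let $$g_{i,j}^{n}(x)=\frac{m_{i,j}^{n}(n-2)!\,i!\,j!}{(n+i-2)!(n+j-2)!}\sum_{r=0}^{\min(i,j)}(-1)^r\frac{(n+i+j-r-2)!}{r!(i-r)!(j-r)!}x^{i-r}\bar x^{\,j-r},$$ $$m^n_{i,j}=\tbinom{n+i-1}{n-1}\tbinom{n+j-1}{n-1}-\tbinom{n+i-2}{n-1}\tbinom{n+j-2}{n-1}.$$ A system of disk polynomials is a sequence $P_a(u)=u^p\bar u^q f_a(|u|^2)$, $a=0,1,2,\dots$, with $f_a$ a real polynomial of degree exactly $a$, such that $\int_{|u|\le1}P_a\overline{P_b}(1-|u|^2)^{w}\,du=0$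 (Lebesgue measure on $\mathbb C$) for $a\ne b$. Theorem. Admissible systems and systems of disk polynomials exist. For every admissible system $(e_{a,s})$ and every system of disk polynomials $(P_a)$ there are $\lambda_0,\dots,\lambda_M\in\mathbb C$ with $$|\lambda_a|^2\cdot\frac{d-1}{\pi}\int_{|u|\le1}|P_a(u)|^2(1-|u|^2)^{w}\,du=1$$ such that $Z(x,y)=Y(e^*x,e^*y,x^*y)$ for all $x,y\in\Omega(d)$, where for $0\le a,b\le M$ $$Y(u,v,t)_{a,b}=\lambda_a\overline{\lambda_b}\,(1-|u|^2)^{\frac{i+j}2}(1-|v|^2)^{\frac{i+j}2}P_a(u)\,\overline{P_b(v)}\;\overline{g_{i,j}^{d-1}\!\left(\frac{t-\bar uv}{\sqrt{(1-|u|^2)(1-|v|^2)}}\right)} .$$ (If $|u|=1$ or $|v|=1$, the product of the two powers with $\overline{g^{d-1}_{i,j}}$ is read as $0$ if $i+j>0$ and as $1$ if $i=j=0$.) Moreover there is a constant invertible complex matrix $V$ such that, for all $u,v,t\in\mathbb C$ with $|u|,|v|\le1$, $$\bigl(V\,Y(u,v,t)\,V^*\bigr)_{a,b}=(1-|u|^2)^{\frac{i+j}2}(1-|v|^2)^{\frac{i+j}2}\,u^p\bar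 u^q\,\overline{v^p\bar v^q}\,(|u|^2)^a(|v|^2)^b\;\overline{g_{i,j}^{d-1}\!\left(\frac{t-\bar uv}{\sqrt{(1-|u|^2)(1-|v|^2)}}\right)} .$$ In particular, if $k-l=i-j$ then $p=q=0$ and the right-hand side depends on $u,v$, apart from the last factor, only through $|u|^2,|v|^2$. -/

import Mathlib

open MeasureTheory Polynomial

noncomputable section

namespace ComplexZonal

/-- The unit sphere `Ω(n)` of `ℂⁿ`. -/
abbrev Om (n : ℕ) : Type := Metric.sphere (0 : EuclideanSpace ℂ (Fin n)) 1

/-- The unitary group `U(n)`, as the group of linear isometries of `ℂⁿ`. -/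
abbrev U (n : ℕ) : Type := EuclideanSpace ℂ (Fin n) ≃ₗᵢ[ℂ] EuclideanSpace ℂ (Fin n)

/-- The action of `U(n)` on the sphere. -/
def rot {n : ℕ} (g : U n) (z : Om n) : Om n :=
  ⟨g z, by simp [g.norm_map, norm_eq_of_mem_sphere z]⟩

/-- The unitarily invariant probability measure on `Ω(n)`: normalized surface measure. -/
def sphereMeasure (n : ℕ) : Measure (Om n) :=
  ((volume : Measure (EuclideanSpace ℂ (Fin n))).toSphere Set.univ)⁻¹ •
    (volume : Measure (EuclideanSpace ℂ (Fin n))).toSphere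

/-- The inner product `⟨f, g⟩ = ∫ conj f · g` of functions on `Ω(n)`. -/
def ip {n : ℕ} (f g : Om n → ℂ) : ℂ :=
  ∫ z, (starRingEnd ℂ) (f z) * g z ∂(sphereMeasure n)

/-- Polynomials in `z₁, …, zₙ` (variables `Sum.inl`) and `z̄₁, …, z̄ₙ` (variables `Sum.inr`). -/
abbrev Poly (n : ℕ) : Type := MvPolynomial (Fin n ⊕ Fin n) ℂ

/-- Bihomogeneous polynomials, of degree `k` in the `zᵢ` and of degree `l` in the `z̄ᵢ`. -/
def homPoly (n k l : ℕ) : Submodule ℂ (Poly n) :=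
  MvPolynomial.weightedHomogeneousSubmodule ℂ
    (Sum.elim (fun _ => (1, 0)) (fun _ => (0, 1)) : Fin n ⊕ Fin n → ℕ × ℕ) (k, l)

/-- The Laplacian `∑ᵢ ∂² / ∂zᵢ ∂z̄ᵢ`. -/
def laplace (n : ℕ) : Poly n →ₗ[ℂ] Poly n :=
  ∑ i : Fin n, (MvPolynomial.pderiv (R := ℂ) (Sum.inl i : Fin n ⊕ Fin n)).toLinearMap ∘ₗ
    (MvPolynomial.pderiv (R := ℂ) (Sum.inr i : Fin n ⊕ Fin n)).toLinearMap

/-- The function on `Ω(n)` given by a polynomial in `z` and `z̄`. -/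
def toFun (n : ℕ) : Poly n →ₗ[ℂ] (Om n → ℂ) :=
  LinearMap.pi fun z : Om n =>
    (MvPolynomial.aeval (R := ℂ)
      (Sum.elim (fun i => (z : EuclideanSpace ℂ (Fin n)) i)
        (fun i => (starRingEnd ℂ) ((z : EuclideanSpace ℂ (Fin n)) i)))).toLinearMap

/-- `Harm_n(k, l)`: the harmonic bihomogeneous polynomials of bidegree `(k, l)`, as functions
on the sphere `Ω(n)`. -/
def harm (n k l : ℕ) : Submodule ℂ (Om n → ℂ) :=
  (homPoly n k l ⊓ LinearMap.ker (laplace n)).map (toFun n)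

section Stabilizer

variable {d : ℕ} (e : Om d)
  (ψ : EuclideanSpace ℂ (Fin (d - 1)) →ₗᵢ[ℂ] EuclideanSpace ℂ (Fin d))

/-- `T : Harm_{d-1}(i, j) → functions on Ω(d)` commutes with the actions of the stabilizer of `e`.
Here `ψ` identifies `ℂ^{d-1}` with the orthogonal complement of `e`, and an element `g` of the
stabilizer acts on `ℂ^{d-1}` by the unitary map `h` with `g ∘ ψ = ψ ∘ h`. -/
def StabEquivariant {i j : ℕ} (T : harm (d - 1) i j →ₗ[ℂ] (Om d → ℂ)) : Prop :=
  ∀ (g : U d) (h : U (d - 1)), g e = e → (∀ w, g (ψ w) = ψ (h w)) →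
    ∀ f f' : harm (d - 1) i j, (∀ w, (f' : Om (d - 1) → ℂ) w = (f : Om (d - 1) → ℂ) (rot h w)) →
      ∀ z, T f' z = T f (rot g z)

/-- `H_{d-1}^{k,l}(i, j)`: the part of `Harm_d(k, l)` that, under the stabilizer of `e`, is
isomorphic to `Harm_{d-1}(i, j)`, i.e. the sum of the images of all equivariant linear maps
from `Harm_{d-1}(i, j)` to `Harm_d(k, l)`. -/
def component (k l i j : ℕ) : Submodule ℂ (Om d → ℂ) :=
  ⨆ T ∈ {T : harm (d - 1) i j →ₗ[ℂ] (Om d → ℂ) |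
      StabEquivariant e ψ T ∧ LinearMap.range T ≤ harm d k l}, LinearMap.range T

/-- The number `min(k - i, l - j)`; there are `mult k l i j + 1` copies of `Harm_{d-1}(i, j)`
in `Hom_d(k, l)`. -/
def mult (k l i j : ℕ) : ℕ := min (k - i) (l - j)

/-- The copy `S_a` of `Harm_{d-1}(i, j)` in `Hom_d(k, l)`, for `0 ≤ a ≤ mult k l i j`. -/
def copy (k l i j a : ℕ) : Submodule ℂ (Om d → ℂ) :=
  component e ψ (k - mult k l i j + a) (l - mult k l i j + a) i j

/-- An admissible system of bases `b a 1, …, b a h` of `S_a`: all of them are orthonormal, and the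
basis of `S_a` is the image of the basis of `S_0` under an isomorphism `S_0 → S_a` of
representations of the stabilizer of `e`. -/
def IsZonalBasis (k l i j : ℕ) {h : ℕ}
    (b : Fin (mult k l i j + 1) → Fin h → Om d → ℂ) : Prop :=
  (∀ (a : Fin (mult k l i j + 1)) (r s : Fin h), ip (b a r) (b a s) = if r = s then 1 else 0) ∧
  (∀ a : Fin (mult k l i j + 1), Submodule.span ℂ (Set.range (b a)) = copy e ψ k l i j a) ∧
  ∀ a : Fin (mult k l i j + 1), ∃ Φ : copy e ψ k l i j 0 ≃ₗ[ℂ] copy e ψ k l i j a,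
    (∀ g : U d, g e = e → ∀ f f' : copy e ψ k l i j 0,
      (∀ z, (f' : Om d → ℂ) z = (f : Om d → ℂ) (rot g z)) →
        ∀ z, (Φ f' : Om d → ℂ) z = (Φ f : Om d → ℂ) (rot g z)) ∧
    ∀ (s : Fin h) (f : copy e ψ k l i j 0), (f : Om d → ℂ) = b 0 s → (Φ f : Om d → ℂ) = b a s

end Stabilizer

/-- The zonal matrix `Z(x, y) = E(x) E(y)^*`, where `E(x)` has the entries `b a s x`. -/
def zonalMatrix {d M h : ℕ} (b : Fin (M + 1) → Fin h → Om d → ℂ) (x y : Om d) :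
    Matrix (Fin (M + 1)) (Fin (M + 1)) ℂ :=
  Matrix.of (fun a s => b a s x) * (Matrix.of (fun a s => b a s y)).conjTranspose

/-- The dimension `m_{k,l}^n` of `Harm_n(k, l)`, for `n ≥ 2`. -/
def harmDim (n k l : ℕ) : ℤ :=
  ((n + k - 1).choose (n - 1) : ℤ) * ((n + l - 1).choose (n - 1) : ℤ) -
    ((n + k - 2).choose (n - 1) : ℤ) * ((n + l - 2).choose (n - 1) : ℤ)

/-- The Jacobi polynomial `g_{k,l}^n`, for `n ≥ 2`. -/
def jacobi (n k l : ℕ) (x : ℂ) : ℂ :=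
  ((harmDim n k l : ℂ) * ((n - 2).factorial : ℂ) * (k.factorial : ℂ) * (l.factorial : ℂ) /
      (((n + k - 2).factorial : ℂ) * ((n + l - 2).factorial : ℂ))) *
    ∑ r ∈ Finset.range (min k l + 1),
      (-1) ^ r * ((n + k + l - r - 2).factorial : ℂ) /
        ((r.factorial : ℂ) * ((k - r).factorial : ℂ) * ((l - r).factorial : ℂ)) *
        x ^ (k - r) * (starRingEnd ℂ x) ^ (l - r)

/-- The function `u^p ū^q f(|u|²)` on the disk. -/
def diskFun (p q : ℕ) (f : ℝ[X]) (u : ℂ) : ℂ :=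
  u ^ p * (starRingEnd ℂ u) ^ q * ((f.eval (‖u‖ ^ 2) : ℝ) : ℂ)

/-- The functions `P_a(u) = u^p ū^q f_a(|u|²)`, where `f_a` has degree `a`, are orthogonal on the
unit disk with respect to the weight `(1 - |u|²)^w`. -/
def IsDiskOrthogonal (w p q : ℕ) (f : ℕ → ℝ[X]) : Prop :=
  (∀ a, (f a).degree = a) ∧
  ∀ a b, a ≠ b →
    ∫ u in Metric.closedBall (0 : ℂ) 1,
      diskFun p q (f a) u * (starRingEnd ℂ) (diskFun p q (f b) u) *
        (((1 - ‖u‖ ^ 2) ^ w : ℝ) : ℂ) = 0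

/-- The factor common to all entries of the zonal matrix:
`(1-|u|²)^{(i+j)/2} (1-|v|²)^{(i+j)/2}` times the complex conjugate of
`g_{i,j}^{d-1}((t - ū v) / √((1-|u|²)(1-|v|²)))`. -/
def zonalFactor (d i j : ℕ) (u v t : ℂ) : ℂ :=
  (((1 - ‖u‖ ^ 2) ^ (((i + j : ℕ) : ℝ) / 2) : ℝ) : ℂ) *
    (((1 - ‖v‖ ^ 2) ^ (((i + j : ℕ) : ℝ) / 2) : ℝ) : ℂ) *
    (starRingEnd ℂ) (jacobi (d - 1) i j
      ((t - (starRingEnd ℂ) u * v) / (Real.sqrt ((1 - ‖u‖ ^ 2) * (1 - ‖v‖ ^ 2)) : ℂ)))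

/-- The matrix with entries `F_a(u) conj(F_b(v))` times `zonalFactor d i j u v t`. -/
def entryMatrix (d i j : ℕ) {M : ℕ} (F : Fin (M + 1) → ℂ → ℂ) (u v t : ℂ) :
    Matrix (Fin (M + 1)) (Fin (M + 1)) ℂ :=
  Matrix.of fun a b => F a u * (starRingEnd ℂ) (F b v) * zonalFactor d i j u v t

end ComplexZonal

end

noncomputable section

namespace ComplexZonal

open MvPolynomial (pderiv)

/-! Write a point of the sphere as `x = u e + x'` with `u = ⟨e, x⟩` and `x' ⟂ e`. The copy of
`Harm_{d-1}(i, j)` in bidegree `(p+i+a, q+j+a)` consists of the functions `P_a(u) h(x')` with `h`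
harmonic of bidegree `(i, j)` and `P_a` the `a`-th disk polynomial. Given this, the matrix follows:
the bases are `λ_a P_a(u) h_s(x')` with the same orthonormal `h_s` for every `a`, so an entry of `Z`
is `λ_a P_a(u)` times the conjugate of `λ_b P_b(v)` times `∑ h_s(x') conj (h_s(y'))`. The last sum
is the reproducing kernel of `Harm_{d-1}(i, j)`, which is the homogenized Jacobi polynomial.

Existence of the copies: `harmPoly` is an explicit harmonic polynomial restricting to `P_a(u) h(x')`
(`laplace_harmPoly`, `toFun_harmPoly`). Since harmonic polynomials of different total degree are
orthogonal on the sphere, its radial factors are orthogonal for the disk weight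
(`isDiskOrthogonal_radialPoly`). Orthogonality determines such a system up to scalars, so every
system of disk polynomials is of this kind (`exists_harmonic_toFun_eq_diskTensor`).

Uniqueness of the copies replaces Schur's lemma and branching rules. An equivariant `T`, restricted
to the points with fixed `u` and evaluated at one direction `w₀`, is a functional invariant under
the stabilizer of `w₀`, hence a multiple of evaluation at `w₀` (`exists_eq_smul_eval`). Thus `T F`
has the form `C(u) F(w)` along each slice. Expanding in powers of `u` and `ū` places it in the span
of the `P_b(u) h(x')` with `b ≤ a`, and orthogonality to lower degrees leaves only `b = a`
(`toFun_eq_smul_diskTensor`, `StabEquivariant.exists_eq_smul`).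

All sphere integrals are computed algebraically. `gauss` is a linear functional for which
multiplication by `z_r` is adjoint to `∂/∂z̄_r`; `sphInt_eq_gauss` identifies it, up to factorials,
with integration over the sphere. The kernel formula is `ip_zonalPoly` together with
`sum_evalAt_mul_conj` and `zonalFactor_eq`. The matrix `V` inverts the triangular matrix of
coefficients of the scaled disk polynomials. -/

/-- Points of `ℂⁿ`. -/
abbrev E (n : ℕ) : Type := EuclideanSpace ℂ (Fin n)

/-- The variable `z_r`. -/
abbrev Z {n : ℕ} (r : Fin n) : Poly n := MvPolynomial.X (Sum.inl r)

/-- The variable `z̄_r`. -/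
abbrev Zc {n : ℕ} (r : Fin n) : Poly n := MvPolynomial.X (Sum.inr r)

/-- Evaluation of a polynomial in `z, z̄` at a point of `ℂⁿ`. -/
def evalAt {n : ℕ} (z : E n) : Poly n →ₐ[ℂ] ℂ :=
  MvPolynomial.aeval (Sum.elim (fun i => z i) (fun i => (starRingEnd ℂ) (z i)))

theorem toFun_apply {n : ℕ} (P : Poly n) (z : Om n) :
    toFun n P z = evalAt (z : E n) P := rfl

@[simp] theorem evalAt_Z {n : ℕ} (z : E n) (r : Fin n) : evalAt z (Z r) = z r := by
  simp [evalAt]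

@[simp] theorem evalAt_Zc {n : ℕ} (z : E n) (r : Fin n) :
    evalAt z (Zc r) = (starRingEnd ℂ) (z r) := by
  simp [evalAt]

/-! ### Bihomogeneous polynomials and their values -/

section HomPoly

variable {n : ℕ} {k l k' l' : ℕ} {P Q : Poly n}

theorem one_mem_homPoly : (1 : Poly n) ∈ homPoly n 0 0 :=
  MvPolynomial.isWeightedHomogeneous_one ℂ _

theorem C_mem_homPoly (c : ℂ) : (MvPolynomial.C c : Poly n) ∈ homPoly n 0 0 :=
  MvPolynomial.isWeightedHomogeneous_C _ c

theorem Z_mem_homPoly (r : Fin n) : (Z r : Poly n) ∈ homPoly n 1 0 :=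
  MvPolynomial.isWeightedHomogeneous_X ℂ _ _

theorem Zc_mem_homPoly (r : Fin n) : (Zc r : Poly n) ∈ homPoly n 0 1 :=
  MvPolynomial.isWeightedHomogeneous_X ℂ _ _

theorem mul_mem_homPoly (hP : P ∈ homPoly n k l) (hQ : Q ∈ homPoly n k' l') :
    P * Q ∈ homPoly n (k + k') (l + l') :=
  MvPolynomial.IsWeightedHomogeneous.mul hP hQ

theorem pow_mem_homPoly (hP : P ∈ homPoly n k l) (m : ℕ) :
    P ^ m ∈ homPoly n (m * k) (m * l) := by
  have := MvPolynomial.IsWeightedHomogeneous.pow hP m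
  simpa [homPoly] using this

theorem homPoly_eq_zero (hP : P ∈ homPoly n k l) (hP' : P ∈ homPoly n k' l')
    (h : (k, l) ≠ (k', l')) : P = 0 := by
  by_contra h0
  exact h (MvPolynomial.IsWeightedHomogeneous.inj_right h0 hP hP')

/-- Induction principle for bihomogeneous polynomials. -/
theorem homPoly_le (S : ℕ → ℕ → Submodule ℂ (Poly n)) (h1 : 1 ∈ S 0 0)
    (hl : ∀ k l P r, P ∈ S k l → Z r * P ∈ S (k + 1) l)
    (hr : ∀ k l P r, P ∈ S k l → Zc r * P ∈ S k (l + 1)) (k l : ℕ) :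
    homPoly n k l ≤ S k l := by
  have key : ∀ (s : Fin n ⊕ Fin n →₀ ℕ) (a : ℂ),
      ∃ k l, MvPolynomial.monomial s a ∈ homPoly n k l ∧ MvPolynomial.monomial s a ∈ S k l := by
    refine MvPolynomial.induction_on_monomial ?_ ?_
    · intro a
      refine ⟨0, 0, C_mem_homPoly a, ?_⟩
      rw [← mul_one (MvPolynomial.C a), ← MvPolynomial.smul_eq_C_mul]
      exact (S 0 0).smul_mem _ h1
    · rintro p x ⟨k, l, h, h'⟩
      rw [mul_comm]
      rcases x with r | r
      · exact ⟨k + 1, l, by simpa [add_comm] using mul_mem_homPoly (Z_mem_homPoly r) h,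
          hl _ _ _ _ h'⟩
      · exact ⟨k, l + 1, by simpa [add_comm] using mul_mem_homPoly (Zc_mem_homPoly r) h,
          hr _ _ _ _ h'⟩
  intro P hP
  rw [MvPolynomial.as_sum P]
  refine Submodule.sum_mem _ fun s hs => ?_
  obtain ⟨k', l', h, h'⟩ := key s (P.coeff s)
  have hw := hP (MvPolynomial.mem_support_iff.1 hs)
  have h2 : MvPolynomial.monomial s (P.coeff s) ∈ homPoly n k l :=
    MvPolynomial.isWeightedHomogeneous_monomial _ _ _ hw
  -- The induction only produces some bidegree for the term; it is the right one unless the term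
  -- vanishes.
  by_cases hkl : (k, l) = (k', l')
  · cases hkl; exact h'
  · rw [homPoly_eq_zero h2 h hkl]; exact Submodule.zero_mem _

theorem pderiv_Z_mem (hP : P ∈ homPoly n (k + 1) l) (r : Fin n) :
    pderiv (Sum.inl r) P ∈ homPoly n k l :=
  MvPolynomial.IsWeightedHomogeneous.pderiv hP (by simp)

theorem pderiv_Zc_mem (hP : P ∈ homPoly n k (l + 1)) (r : Fin n) :
    pderiv (Sum.inr r) P ∈ homPoly n k l :=
  MvPolynomial.IsWeightedHomogeneous.pderiv hP (by simp)

/-- Euler's identity cuts out a submodule, and by the product rule a factor `z_r` raises the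
eigenvalue by one while `z̄_r` leaves it unchanged, so `homPoly_le` applies. -/
theorem euler_Z (hP : P ∈ homPoly n k l) :
    ∑ r, Z r * pderiv (Sum.inl r) P = (k : ℂ) • P := by
  let S : ℕ → ℕ → Submodule ℂ (Poly n) := fun k _ => LinearMap.ker
    ((∑ r : Fin n, LinearMap.mulLeft ℂ (Z r : Poly n) ∘ₗ
      (pderiv (R := ℂ) (Sum.inl r : Fin n ⊕ Fin n)).toLinearMap) - (k : ℂ) • LinearMap.id)
  have hS : ∀ k l P, P ∈ S k l ↔ ∑ r, Z r * pderiv (Sum.inl r) P = (k : ℂ) • P := by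
    intro k l P
    simp [S, LinearMap.sum_apply, sub_eq_zero]
  refine (hS k l P).1 (homPoly_le S ?_ ?_ ?_ k l hP)
  · refine (hS 0 0 _).2 ?_; simp
  · intro k l P r h
    replace h := (hS k l P).1 h
    refine (hS (k + 1) l _).2 ?_
    simp only [Derivation.leibniz, smul_eq_mul, mul_add, Finset.sum_add_distrib,
      MvPolynomial.pderiv_X]
    have : ∑ x : Fin n, Z x * (Z r * pderiv (Sum.inl x) P)
        = Z r * ∑ x : Fin n, Z x * pderiv (Sum.inl x) P := by
      rw [Finset.mul_sum]; exact Finset.sum_congr rfl fun x _ => by ring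
    rw [this, h]
    simp [Pi.single_apply, add_smul, mul_ite, add_comm]
  · intro k l P r h
    replace h := (hS k l P).1 h
    refine (hS k (l + 1) _).2 ?_
    simp only [Derivation.leibniz, smul_eq_mul, mul_add, Finset.sum_add_distrib,
      MvPolynomial.pderiv_X]
    have : ∑ x : Fin n, Z x * (Zc r * pderiv (Sum.inl x) P)
        = Zc r * ∑ x : Fin n, Z x * pderiv (Sum.inl x) P := by
      rw [Finset.mul_sum]; exact Finset.sum_congr rfl fun x _ => by ring
    rw [this, h]
    simp

theorem euler_Zc (hP : P ∈ homPoly n k l) :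
    ∑ r, Zc r * pderiv (Sum.inr r) P = (l : ℂ) • P := by
  let S : ℕ → ℕ → Submodule ℂ (Poly n) := fun _ l => LinearMap.ker
    ((∑ r : Fin n, LinearMap.mulLeft ℂ (Zc r : Poly n) ∘ₗ
      (pderiv (R := ℂ) (Sum.inr r : Fin n ⊕ Fin n)).toLinearMap) - (l : ℂ) • LinearMap.id)
  have hS : ∀ k l P, P ∈ S k l ↔ ∑ r, Zc r * pderiv (Sum.inr r) P = (l : ℂ) • P := by
    intro k l P
    simp [S, LinearMap.sum_apply, sub_eq_zero]
  refine (hS k l P).1 (homPoly_le S ?_ ?_ ?_ k l hP)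
  · refine (hS 0 0 _).2 ?_; simp
  · intro k l P r h
    replace h := (hS k l P).1 h
    refine (hS (k + 1) l _).2 ?_
    simp only [Derivation.leibniz, smul_eq_mul, mul_add, Finset.sum_add_distrib,
      MvPolynomial.pderiv_X]
    have : ∑ x : Fin n, Zc x * (Z r * pderiv (Sum.inr x) P)
        = Z r * ∑ x : Fin n, Zc x * pderiv (Sum.inr x) P := by
      rw [Finset.mul_sum]; exact Finset.sum_congr rfl fun x _ => by ring
    rw [this, h]
    simp
  · intro k l P r h
    replace h := (hS k l P).1 h
    refine (hS k (l + 1) _).2 ?_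
    simp only [Derivation.leibniz, smul_eq_mul, mul_add, Finset.sum_add_distrib,
      MvPolynomial.pderiv_X]
    have : ∑ x : Fin n, Zc x * (Zc r * pderiv (Sum.inr x) P)
        = Zc r * ∑ x : Fin n, Zc x * pderiv (Sum.inr x) P := by
      rw [Finset.mul_sum]; exact Finset.sum_congr rfl fun x _ => by ring
    rw [this, h]
    simp [Pi.single_apply, add_smul, mul_ite, add_comm]

theorem evalAt_smul (hP : P ∈ homPoly n k l) (c : ℂ) (z : E n) :
    evalAt (c • z) P = c ^ k * (starRingEnd ℂ) c ^ l * evalAt z P := by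
  let S : ℕ → ℕ → Submodule ℂ (Poly n) := fun k l => LinearMap.ker
    ((evalAt (c • z)).toLinearMap - (c ^ k * (starRingEnd ℂ) c ^ l) • (evalAt z).toLinearMap)
  have hS : ∀ k l P, P ∈ S k l ↔
      evalAt (c • z) P = c ^ k * (starRingEnd ℂ) c ^ l * evalAt z P := by
    intro k l P
    simp [S, sub_eq_zero]
  refine (hS k l P).1 (homPoly_le S ?_ ?_ ?_ k l hP)
  · refine (hS 0 0 _).2 ?_; simp
  · intro k l P r h
    replace h := (hS k l P).1 h
    refine (hS _ _ _).2 ?_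
    simp [h, -map_mul, map_mul (evalAt _)]
    ring
  · intro k l P r h
    replace h := (hS k l P).1 h
    refine (hS _ _ _).2 ?_
    simp [h, map_mul (evalAt _)]
    ring

/-- A bihomogeneous polynomial is determined by its restriction to the sphere. -/
theorem evalAt_eq_zero_of_sphere (hn : 0 < n) (hP : P ∈ homPoly n k l) (h : toFun n P = 0)
    (z : E n) : evalAt z P = 0 := by
  obtain ⟨y, hy⟩ : ∃ y : Om n, ∃ c : ℂ, z = c • (y : E n) := by
    by_cases hz : z = 0
    · have : (EuclideanSpace.single (⟨0, hn⟩ : Fin n) (1 : ℂ)) ∈ Metric.sphere (0 : E n) 1 := by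
        simp
      exact ⟨⟨_, this⟩, 0, by simp [hz]⟩
    · have h0 : ‖z‖ ≠ 0 := norm_ne_zero_iff.2 hz
      refine ⟨⟨((‖z‖⁻¹ : ℝ) : ℂ) • z, ?_⟩, (‖z‖ : ℂ), ?_⟩
      · simp [norm_smul, h0]
      · rw [smul_smul, ← Complex.ofReal_mul, mul_inv_cancel₀ h0]; simp
  obtain ⟨c, rfl⟩ := hy
  rw [evalAt_smul hP, ← toFun_apply, h]
  simp

end HomPoly

/-- A polynomial in `z, z̄` that vanishes at all points of `ℂⁿ` is zero. -/
theorem eq_zero_of_evalAt {n : ℕ} {P : Poly n} (h : ∀ z, evalAt z P = 0) : P = 0 := by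
  -- Substituting `x + iy` and `x - iy` for `z` and `z̄` gives a polynomial in independent variables
  -- that vanishes at all real points, hence is zero.
  let φ : Poly n →ₐ[ℂ] Poly n := MvPolynomial.aeval
    (Sum.elim (fun r => Z r + MvPolynomial.C Complex.I * Zc r)
      (fun r => Z r - MvPolynomial.C Complex.I * Zc r))
  have hφ : φ P = 0 := by
    refine MvPolynomial.funext_set (s := fun _ => Set.range ((↑) : ℝ → ℂ))
      (fun _ => Set.infinite_range_of_injective Complex.ofReal_injective) ?_
    intro x hx
    simp only [Set.mem_pi, Set.mem_univ, true_implies, Set.mem_range] at hx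
    choose y hy using hx
    have h1 : (MvPolynomial.aeval x).comp φ
        = evalAt (WithLp.toLp 2 fun r => (y (Sum.inl r) : ℂ) + Complex.I * y (Sum.inr r)) := by
      refine MvPolynomial.algHom_ext ?_
      rintro (r | r) <;> simp [φ, evalAt, ← hy, sub_eq_add_neg]
    have h2 := congrArg (fun f => f P) h1
    simp only [AlgHom.comp_apply, h] at h2
    simpa [MvPolynomial.aeval_eq_eval] using h2
  -- The inverse substitution `x = (z + z̄)/2`, `y = (z - z̄)/(2i)` shows that `φ` is injective.
  let χ : Poly n →ₐ[ℂ] Poly n := MvPolynomial.aeval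
    (Sum.elim (fun r => MvPolynomial.C (1 / 2) * (Z r + Zc r))
      (fun r => MvPolynomial.C (-Complex.I / 2) * (Z r - Zc r)))
  have h3 : χ.comp φ = AlgHom.id ℂ _ := by
    have e1 : (MvPolynomial.C Complex.I * MvPolynomial.C (-Complex.I / 2) : Poly n)
        = MvPolynomial.C (1 / 2) := by
      rw [← map_mul]; congr 1; ring_nf; simp; norm_num
    have e2 : (MvPolynomial.C (1 / 2) + MvPolynomial.C (1 / 2) : Poly n) = 1 := by
      rw [← map_add]; norm_num
    refine MvPolynomial.algHom_ext ?_
    rintro (r | r)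
    · simp only [φ, χ, AlgHom.comp_apply, MvPolynomial.aeval_X, Sum.elim_inl, Sum.elim_inr,
        map_add, map_mul, MvPolynomial.algHom_C, MvPolynomial.algebraMap_eq, AlgHom.id_apply,
        ← mul_assoc, e1]
      linear_combination Z r * e2
    · simp only [φ, χ, AlgHom.comp_apply, MvPolynomial.aeval_X, Sum.elim_inl, Sum.elim_inr,
        map_sub, map_mul, MvPolynomial.algHom_C, MvPolynomial.algebraMap_eq, AlgHom.id_apply,
        ← mul_assoc, e1]
      linear_combination Zc r * e2
  have h4 := congrArg (fun f => f P) h3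
  simp only [AlgHom.comp_apply, hφ, map_zero, AlgHom.id_apply] at h4
  exact h4.symm

/-! ### Conjugation -/

/-- The complex conjugate of a polynomial in `z, z̄`. -/
def cj {n : ℕ} (P : Poly n) : Poly n :=
  MvPolynomial.rename Sum.swap (MvPolynomial.map (starRingEnd ℂ) P)

theorem cj_add {n : ℕ} (P Q : Poly n) : cj (P + Q) = cj P + cj Q := by simp [cj]
theorem cj_mul {n : ℕ} (P Q : Poly n) : cj (P * Q) = cj P * cj Q := by simp [cj]
theorem cj_pow {n : ℕ} (P : Poly n) (m : ℕ) : cj (P ^ m) = cj P ^ m := by simp [cj]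
theorem cj_C {n : ℕ} (c : ℂ) :
    cj (MvPolynomial.C c : Poly n) = MvPolynomial.C ((starRingEnd ℂ) c) := by simp [cj]
theorem cj_Z {n : ℕ} (r : Fin n) : cj (Z r) = Zc r := by simp [cj]
theorem cj_Zc {n : ℕ} (r : Fin n) : cj (Zc r) = Z r := by simp [cj]
theorem cj_sum {n : ℕ} {ι : Type*} (s : Finset ι) (P : ι → Poly n) :
    cj (∑ x ∈ s, P x) = ∑ x ∈ s, cj (P x) := by simp [cj]

theorem evalAt_cj {n : ℕ} (z : E n) (P : Poly n) :
    evalAt z (cj P) = (starRingEnd ℂ) (evalAt z P) := by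
  induction P using MvPolynomial.induction_on with
  | C a => simp [cj_C, MvPolynomial.algHom_C]
  | add p q hp hq => simp [cj_add, hp, hq]
  | mul_X p x hp =>
    rcases x with r | r
    · simp [cj_mul, hp, cj_Z]
    · simp [cj_mul, hp, cj_Zc]

theorem cj_mem_homPoly {n k l : ℕ} {P : Poly n} (hP : P ∈ homPoly n k l) :
    cj P ∈ homPoly n l k := by
  -- Conjugation is only semilinear, but preimages of submodules are still submodules, so the
  -- induction over variables is available.
  let φ : Poly n →ₛₗ[starRingEnd ℂ] Poly n :=
    { toFun := cj
      map_add' := cj_add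
      map_smul' := fun c P => by
        rw [MvPolynomial.smul_eq_C_mul, cj_mul, cj_C, MvPolynomial.smul_eq_C_mul] }
  refine homPoly_le (fun k l => (homPoly n l k).comap φ) ?_ ?_ ?_ k l hP
  · simpa [φ, cj] using one_mem_homPoly
  · intro k l P r h
    have := mul_mem_homPoly (Zc_mem_homPoly r) h
    simpa [φ, cj_mul, cj_Z, add_comm] using this
  · intro k l P r h
    have := mul_mem_homPoly (Z_mem_homPoly r) h
    simpa [φ, cj_mul, cj_Zc, add_comm] using this

/-! ### Linear forms and linear substitutions -/

/-- The linear form `x ↦ ⟨v, x⟩`. -/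
def lin {n : ℕ} (v : E n) : Poly n :=
  ∑ s, MvPolynomial.C ((starRingEnd ℂ) (v s)) * Z s

/-- The conjugate-linear form `x ↦ conj ⟨v, x⟩`. -/
def linc {n : ℕ} (v : E n) : Poly n := ∑ s, MvPolynomial.C (v s) * Zc s

/-- The vector of the coordinates `⟨v r, x⟩`. -/
def coord {m n : ℕ} (v : Fin n → E m) (x : E m) : E n :=
  WithLp.toLp 2 fun r => inner ℂ (v r) x

/-- Substitution of the linear forms `⟨v r, x⟩` for the variables. -/
def pull {m n : ℕ} (v : Fin n → E m) : Poly n →ₐ[ℂ] Poly m :=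
  MvPolynomial.aeval (Sum.elim (fun r => lin (v r)) (fun r => linc (v r)))

/-- The polynomial `|z|²`. -/
def rho (n : ℕ) : Poly n := ∑ r, Z r * Zc r

/-- The derivation `∑ w̄_r ∂/∂z̄_r`. -/
def dirC {n : ℕ} (w : E n) : Derivation ℂ (Poly n) (Poly n) :=
  ∑ r, (starRingEnd ℂ) (w r) • pderiv (Sum.inr r)

/-- The derivation `∑ w_r ∂/∂z_r`. -/
def dir {n : ℕ} (w : E n) : Derivation ℂ (Poly n) (Poly n) :=
  ∑ r, w r • pderiv (Sum.inl r)

section Forms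

variable {m n : ℕ} {k l : ℕ}

theorem inner_eq_sum (v x : E n) : inner ℂ v x = ∑ s, (starRingEnd ℂ) (v s) * x s := by
  simp [PiLp.inner_apply, mul_comm]

@[simp] theorem evalAt_C (x : E n) (c : ℂ) : evalAt x (MvPolynomial.C c) = c := by
  simp [evalAt]

@[simp] theorem evalAt_lin (v x : E n) : evalAt x (lin v) = inner ℂ v x := by
  simp [lin, inner_eq_sum]

@[simp] theorem evalAt_linc (v x : E n) : evalAt x (linc v) = inner ℂ x v := by
  simp [linc, inner_eq_sum, mul_comm]

theorem evalAt_rho (x : E n) : evalAt x (rho n) = (‖x‖ : ℂ) ^ 2 := by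
  have h := inner_self_eq_norm_sq_to_K (𝕜 := ℂ) x
  rw [inner_eq_sum] at h
  simpa [rho, mul_comm] using h

theorem evalAt_pull (v : Fin n → E m) (P : Poly n) (x : E m) :
    evalAt x (pull v P) = evalAt (coord v x) P := by
  have : (evalAt x).comp (pull v) = evalAt (coord v x) := by
    refine MvPolynomial.algHom_ext ?_
    rintro (r | r)
    · simp [pull, evalAt_lin, coord]
    · simp [pull, evalAt_linc, coord]
  exact congrArg (fun f => f P) this

@[simp] theorem pull_Z (v : Fin n → E m) (r : Fin n) : pull v (Z r) = lin (v r) := by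
  simp [pull]

@[simp] theorem pull_Zc (v : Fin n → E m) (r : Fin n) : pull v (Zc r) = linc (v r) := by
  simp [pull]

theorem C_mul_mem_homPoly {P : Poly n} (hP : P ∈ homPoly n k l) (c : ℂ) :
    MvPolynomial.C c * P ∈ homPoly n k l := by
  rw [← MvPolynomial.smul_eq_C_mul]; exact Submodule.smul_mem _ _ hP

theorem lin_mem (v : E n) : lin v ∈ homPoly n 1 0 :=
  Submodule.sum_mem _ fun r _ => C_mul_mem_homPoly (Z_mem_homPoly r) _

theorem linc_mem (v : E n) : linc v ∈ homPoly n 0 1 :=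
  Submodule.sum_mem _ fun r _ => C_mul_mem_homPoly (Zc_mem_homPoly r) _

theorem rho_mem : rho n ∈ homPoly n 1 1 :=
  Submodule.sum_mem _ fun r _ => mul_mem_homPoly (Z_mem_homPoly r) (Zc_mem_homPoly r)

theorem rho_pow_mul_mem {P : Poly n} (hP : P ∈ homPoly n k l) (a : ℕ) :
    rho n ^ a * P ∈ homPoly n (k + a) (l + a) := by
  have := mul_mem_homPoly (pow_mem_homPoly (rho_mem (n := n)) a) hP
  simpa [add_comm] using this

theorem lin_pow_mul_linc_pow_mem (v : E n) (a b : ℕ) :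
    lin v ^ a * linc v ^ b ∈ homPoly n a b := by
  have := mul_mem_homPoly (pow_mem_homPoly (lin_mem v) a) (pow_mem_homPoly (linc_mem v) b)
  simpa using this

theorem pull_mem_homPoly (v : Fin n → E m) {P : Poly n} (hP : P ∈ homPoly n k l) :
    pull v P ∈ homPoly m k l := by
  refine homPoly_le (fun k l => (homPoly m k l).comap (pull v).toLinearMap) ?_ ?_ ?_ k l hP
  · simpa using one_mem_homPoly
  · intro k l P r h
    simpa [add_comm] using mul_mem_homPoly (lin_mem (v r)) h
  · intro k l P r h
    simpa [add_comm] using mul_mem_homPoly (linc_mem (v r)) h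

theorem cj_lin (v : E n) : cj (lin v) = linc v := by
  simp [lin, linc, cj_sum, cj_mul, cj_C, cj_Z]

theorem cj_linc (v : E n) : cj (linc v) = lin v := by
  simp [lin, linc, cj_sum, cj_mul, cj_C, cj_Zc]

/-! ### Derivatives -/

@[simp] theorem pderiv_inl_lin (v : E n) (r : Fin n) :
    pderiv (Sum.inl r) (lin v) = MvPolynomial.C ((starRingEnd ℂ) (v r)) := by
  simp [lin, MvPolynomial.pderiv_X, Pi.single_apply]

@[simp] theorem pderiv_inr_lin (v : E n) (r : Fin n) : pderiv (Sum.inr r) (lin v) = 0 := by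
  simp [lin, MvPolynomial.pderiv_X]

@[simp] theorem pderiv_inr_linc (v : E n) (r : Fin n) :
    pderiv (Sum.inr r) (linc v) = MvPolynomial.C (v r) := by
  simp [linc, MvPolynomial.pderiv_X, Pi.single_apply]

@[simp] theorem pderiv_inl_linc (v : E n) (r : Fin n) : pderiv (Sum.inl r) (linc v) = 0 := by
  simp [linc, MvPolynomial.pderiv_X]

@[simp] theorem pderiv_inl_rho (r : Fin n) : pderiv (Sum.inl r) (rho n) = Zc r := by
  simp [rho, MvPolynomial.pderiv_X, Pi.single_apply]

@[simp] theorem pderiv_inr_rho (r : Fin n) : pderiv (Sum.inr r) (rho n) = Z r := by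
  simp [rho, MvPolynomial.pderiv_X, Pi.single_apply]

theorem dirC_apply (w : E n) (P : Poly n) :
    dirC w P = ∑ r, (starRingEnd ℂ) (w r) • pderiv (Sum.inr r) P := by
  have := fun f : Fin n → Derivation ℂ (Poly n) (Poly n) => congrFun (map_sum
    (Derivation.coeFnAddMonoidHom (R := ℂ) (A := Poly n) (M := Poly n)) f (Finset.univ : Finset (Fin n))) P
  refine (this (fun r => (starRingEnd ℂ) (w r) • pderiv (Sum.inr r))).trans ?_
  simp [Finset.sum_apply]

theorem dir_apply (w : E n) (P : Poly n) :
    dir w P = ∑ r, w r • pderiv (Sum.inl r) P := by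
  have := fun f : Fin n → Derivation ℂ (Poly n) (Poly n) => congrFun (map_sum
    (Derivation.coeFnAddMonoidHom (R := ℂ) (A := Poly n) (M := Poly n)) f (Finset.univ : Finset (Fin n))) P
  refine (this (fun r => w r • pderiv (Sum.inl r))).trans ?_
  simp [Finset.sum_apply]

@[simp] theorem dirC_lin (w v : E n) : dirC w (lin v) = 0 := by simp [dirC_apply]

@[simp] theorem dir_linc (w v : E n) : dir w (linc v) = 0 := by simp [dir_apply]

@[simp] theorem dirC_linc (w v : E n) : dirC w (linc v) = MvPolynomial.C (inner ℂ w v) := by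
  simp [dirC_apply, inner_eq_sum, MvPolynomial.smul_eq_C_mul]

@[simp] theorem dir_lin (w v : E n) : dir w (lin v) = MvPolynomial.C (inner ℂ v w) := by
  simp [dir_apply, inner_eq_sum, MvPolynomial.smul_eq_C_mul, mul_comm]

theorem dirC_mem (w : E n) {P : Poly n} (hP : P ∈ homPoly n k (l + 1)) :
    dirC w P ∈ homPoly n k l := by
  rw [dirC_apply]
  exact Submodule.sum_mem _ fun r _ => Submodule.smul_mem _ _ (pderiv_Zc_mem hP r)

theorem dir_mem (w : E n) {P : Poly n} (hP : P ∈ homPoly n (k + 1) l) :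
    dir w P ∈ homPoly n k l := by
  rw [dir_apply]
  exact Submodule.sum_mem _ fun r _ => Submodule.smul_mem _ _ (pderiv_Z_mem hP r)

/-- The chain rule for a derivation and a substitution. -/
theorem derivation_algHom (δ : Derivation ℂ (Poly m) (Poly m)) (φ : Poly n →ₐ[ℂ] Poly m)
    (P : Poly n) : δ (φ P) = ∑ r, φ (pderiv (Sum.inl r) P) * δ (φ (Z r)) +
      ∑ r, φ (pderiv (Sum.inr r) P) * δ (φ (Zc r)) := by
  rw [← Fintype.sum_sum_type (fun x => φ (pderiv x P) * δ (φ (MvPolynomial.X x)))]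
  induction P using MvPolynomial.induction_on with
  | C a => simp [MvPolynomial.algHom_C]
  | add p q hp hq => simp only [map_add, hp, hq, add_mul, Finset.sum_add_distrib]
  | mul_X p x hp =>
    simp only [map_mul, Derivation.leibniz, smul_eq_mul, map_add, hp, add_mul,
      Finset.sum_add_distrib, MvPolynomial.pderiv_X, Pi.single_apply]
    congr 1
    · simp [apply_ite, ite_mul]
    · rw [Finset.mul_sum]
      exact Finset.sum_congr rfl fun y _ => by ring

theorem pderiv_inl_pull (v : Fin n → E m) (P : Poly n) (s : Fin m) :
    pderiv (Sum.inl s) (pull v P) =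
      ∑ r, MvPolynomial.C ((starRingEnd ℂ) (v r s)) * pull v (pderiv (Sum.inl r) P) := by
  rw [derivation_algHom]; simp [mul_comm]

theorem pderiv_inr_pull (v : Fin n → E m) (P : Poly n) (s : Fin m) :
    pderiv (Sum.inr s) (pull v P) =
      ∑ r, MvPolynomial.C (v r s) * pull v (pderiv (Sum.inr r) P) := by
  rw [derivation_algHom]; simp [mul_comm]

theorem dirC_pull (v : Fin n → E m) (w : E m) (P : Poly n) :
    dirC w (pull v P) = ∑ r, inner ℂ w (v r) • pull v (pderiv (Sum.inr r) P) := by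
  rw [derivation_algHom]; simp [MvPolynomial.smul_eq_C_mul, mul_comm]

theorem dir_pull (v : Fin n → E m) (w : E m) (P : Poly n) :
    dir w (pull v P) = ∑ r, inner ℂ (v r) w • pull v (pderiv (Sum.inl r) P) := by
  rw [derivation_algHom]; simp [MvPolynomial.smul_eq_C_mul, mul_comm]

/-! ### The Laplacian of products and of linear substitutions -/

theorem laplace_apply (P : Poly n) :
    laplace n P = ∑ r, pderiv (Sum.inl r) (pderiv (Sum.inr r) P) := by
  simp [laplace, LinearMap.sum_apply]

/-- The commutator of two derivations is a derivation, and this one kills every variable. -/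
theorem pderiv_comm (x y : Fin n ⊕ Fin n) (P : Poly n) :
    pderiv x (pderiv y P) = pderiv y (pderiv x P) := by
  have h : ⁅pderiv (R := ℂ) x, pderiv (R := ℂ) y⁆ = 0 := by
    refine MvPolynomial.derivation_ext fun z => ?_
    simp only [Derivation.commutator_apply, MvPolynomial.pderiv_X, Pi.single_apply, apply_ite]
    simp
  have := congrArg (fun D => D P) h
  simpa [Derivation.commutator_apply, sub_eq_zero] using this

theorem laplace_pderiv (x : Fin n ⊕ Fin n) (P : Poly n) :
    laplace n (pderiv x P) = pderiv x (laplace n P) := by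
  simp only [laplace_apply, map_sum]
  refine Finset.sum_congr rfl fun r _ => ?_
  rw [pderiv_comm (Sum.inr r), pderiv_comm (Sum.inl r) x]

theorem laplace_dir (w : E n) (P : Poly n) : laplace n (dir w P) = dir w (laplace n P) := by
  simp only [dir_apply, map_sum, map_smul, laplace_pderiv]

theorem laplace_dirC (w : E n) (P : Poly n) : laplace n (dirC w P) = dirC w (laplace n P) := by
  simp only [dirC_apply, map_sum, map_smul, laplace_pderiv]

theorem laplace_mul (P Q : Poly n) : laplace n (P * Q) = laplace n P * Q + P * laplace n Q +
    ∑ r, (pderiv (Sum.inl r) P * pderiv (Sum.inr r) Q +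
      pderiv (Sum.inr r) P * pderiv (Sum.inl r) Q) := by
  simp only [laplace_apply, Finset.sum_mul, Finset.mul_sum, ← Finset.sum_add_distrib]
  refine Finset.sum_congr rfl fun r _ => ?_
  simp only [Derivation.leibniz, smul_eq_mul, map_add]
  ring

theorem laplace_mem {P : Poly n} (hP : P ∈ homPoly n (k + 1) (l + 1)) :
    laplace n P ∈ homPoly n k l := by
  rw [laplace_apply]
  exact Submodule.sum_mem _ fun r _ => pderiv_Z_mem (pderiv_Zc_mem hP r) r

/-- The second weight of every monomial is zero, so no `z̄` variable occurs. This handles the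
boundary cases of inductions in which a degree would drop below zero. -/
theorem pderiv_inr_eq_zero {P : Poly n} (hP : P ∈ homPoly n k 0) (r : Fin n) :
    pderiv (Sum.inr r) P = 0 := by
  refine MvPolynomial.pderiv_eq_zero_of_notMem_vars fun hr => ?_
  obtain ⟨s, hs, hr⟩ := (MvPolynomial.mem_vars_iff_mem_support _).1 hr
  have hw := congrArg Prod.snd (hP (MvPolynomial.mem_support_iff.1 hs))
  rw [Finsupp.weight_apply, Finsupp.sum_fintype _ _ (by simp)] at hw
  simp [Prod.snd_sum] at hw
  exact (Finsupp.mem_support_iff.1 hr) (hw r)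

theorem pderiv_inl_eq_zero {P : Poly n} (hP : P ∈ homPoly n 0 l) (r : Fin n) :
    pderiv (Sum.inl r) P = 0 := by
  refine MvPolynomial.pderiv_eq_zero_of_notMem_vars fun hr => ?_
  obtain ⟨s, hs, hr⟩ := (MvPolynomial.mem_vars_iff_mem_support _).1 hr
  have hw := congrArg Prod.fst (hP (MvPolynomial.mem_support_iff.1 hs))
  rw [Finsupp.weight_apply, Finsupp.sum_fintype _ _ (by simp)] at hw
  simp [Prod.fst_sum] at hw
  exact (Finsupp.mem_support_iff.1 hr) (hw r)

theorem eq_C_of_mem_homPoly {P : Poly n} (hP : P ∈ homPoly n 0 0) :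
    ∃ c, P = MvPolynomial.C c := by
  refine ⟨P.coeff 0, MvPolynomial.ext _ _ fun s => ?_⟩
  rw [MvPolynomial.coeff_C]
  split_ifs with h
  · rw [h]
  · by_contra h0
    have hw := hP h0
    rw [Finsupp.weight_apply, Finsupp.sum_fintype _ _ (by simp)] at hw
    have h1 := congrArg Prod.fst hw
    have h2 := congrArg Prod.snd hw
    simp [Prod.fst_sum] at h1
    simp [Prod.snd_sum] at h2
    exact h (Finsupp.ext fun x => by rcases x with r | r <;> simp [h1, h2]).symm

/-- The chain rule brings in the Gram matrix of `v`, which is the identity. The system need not be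
complete: the result serves both for unitary substitutions and for projection to the complement of
`e`. -/
theorem laplace_pull {v : Fin n → E m} (hv : Orthonormal ℂ v) (P : Poly n) :
    laplace m (pull v P) = pull v (laplace n P) := by
  rw [laplace_apply, laplace_apply]
  simp only [pderiv_inr_pull, map_sum, Derivation.leibniz, smul_eq_mul, MvPolynomial.pderiv_C,
    mul_zero, add_zero, pderiv_inl_pull, Finset.mul_sum]
  rw [Finset.sum_comm]
  refine Finset.sum_congr rfl fun r _ => ?_
  rw [Finset.sum_comm]
  have : ∀ r' : Fin n, ∑ s, MvPolynomial.C (v r s) * (MvPolynomial.C ((starRingEnd ℂ) (v r' s)) *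
      pull v (pderiv (Sum.inl r') (pderiv (Sum.inr r) P))) =
      MvPolynomial.C (inner ℂ (v r') (v r)) *
        pull v (pderiv (Sum.inl r') (pderiv (Sum.inr r) P)) := by
    intro r'
    rw [inner_eq_sum, map_sum, Finset.sum_mul]
    refine Finset.sum_congr rfl fun s _ => ?_
    rw [map_mul]; ring
  simp only [this, orthonormal_iff_ite.1 hv]
  simp [apply_ite]

theorem pderiv_inl_lin_pow (e : E n) (a b : ℕ) (r : Fin n) :
    pderiv (Sum.inl r) (lin e ^ a * linc e ^ b) =
      MvPolynomial.C ((starRingEnd ℂ) (e r)) * ((a : Poly n) * lin e ^ (a - 1) * linc e ^ b) := by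
  simp [Derivation.leibniz, Derivation.leibniz_pow]
  ring

theorem pderiv_inr_lin_pow (e : E n) (a b : ℕ) (r : Fin n) :
    pderiv (Sum.inr r) (lin e ^ a * linc e ^ b) =
      MvPolynomial.C (e r) * ((b : Poly n) * lin e ^ a * linc e ^ (b - 1)) := by
  simp [Derivation.leibniz, Derivation.leibniz_pow]
  ring

theorem laplace_lin_pow (e : E n) (a b : ℕ) :
    laplace n (lin e ^ a * linc e ^ b) = MvPolynomial.C ((a * b : ℂ) * inner ℂ e e) *
      (lin e ^ (a - 1) * linc e ^ (b - 1)) := by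
  have : ∀ r : Fin n, pderiv (Sum.inl r) ((b : Poly n) * lin e ^ a * linc e ^ (b - 1)) =
    MvPolynomial.C ((starRingEnd ℂ) (e r)) *
      ((a * b : Poly n) * (lin e ^ (a - 1) * linc e ^ (b - 1))) := by
    intro r
    rw [mul_assoc, Derivation.leibniz, pderiv_inl_lin_pow]
    simp
    ring
  rw [laplace_apply]
  simp only [pderiv_inr_lin_pow]
  simp only [Derivation.leibniz, this]
  simp only [MvPolynomial.pderiv_C, smul_eq_mul, mul_zero, add_zero, inner_eq_sum, map_mul,
    map_sum, map_natCast, Finset.mul_sum, Finset.sum_mul]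
  exact Finset.sum_congr rfl fun r _ => by ring

/-- The mixed terms are derivatives of `pull v P` in the direction `e`, which vanish because `e` is
orthogonal to all `v r`. -/
theorem laplace_lin_pow_mul_pull {e : E m} {v : Fin n → E m} (he : ‖e‖ = 1)
    (hv : Orthonormal ℂ v) (hev : ∀ r, inner ℂ e (v r) = 0) (a b : ℕ) (P : Poly n) :
    laplace m (lin e ^ a * linc e ^ b * pull v P) =
      (a * b : ℂ) • (lin e ^ (a - 1) * linc e ^ (b - 1) * pull v P) +
        lin e ^ a * linc e ^ b * pull v (laplace n P) := by
  have hve : ∀ r, inner ℂ (v r) e = 0 := fun r => inner_eq_zero_symm.1 (hev r)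
  have h1 : dirC e (pull v P) = 0 := by rw [dirC_pull]; simp [hev]
  have h2 : dir e (pull v P) = 0 := by rw [dir_pull]; simp [hve]
  have hc : ∑ r, (pderiv (Sum.inl r) (lin e ^ a * linc e ^ b) * pderiv (Sum.inr r) (pull v P) +
      pderiv (Sum.inr r) (lin e ^ a * linc e ^ b) * pderiv (Sum.inl r) (pull v P)) =
      ((a : Poly m) * lin e ^ (a - 1) * linc e ^ b) * dirC e (pull v P) +
      ((b : Poly m) * lin e ^ a * linc e ^ (b - 1)) * dir e (pull v P) := by
    rw [dirC_apply, dir_apply, Finset.mul_sum, Finset.mul_sum, ← Finset.sum_add_distrib]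
    refine Finset.sum_congr rfl fun r _ => ?_
    rw [pderiv_inl_lin_pow, pderiv_inr_lin_pow, MvPolynomial.smul_eq_C_mul,
      MvPolynomial.smul_eq_C_mul]
    ring
  rw [laplace_mul, hc, h1, h2, laplace_lin_pow, laplace_pull hv,
    inner_self_eq_norm_sq_to_K (𝕜 := ℂ), he, MvPolynomial.smul_eq_C_mul]
  simp
  ring

/-- The mixed terms are the two Euler operators, contributing `k + l`; the Laplacian of `rho n`
contributes `n`. -/
theorem laplace_rho_mul {P : Poly n} (hP : P ∈ homPoly n k l) :
    laplace n (rho n * P) = ((n + k + l : ℕ) : ℂ) • P + rho n * laplace n P := by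
  have h0 : laplace n (rho n) = (n : Poly n) := by
    simp [laplace_apply]
  have hc : ∑ r, (pderiv (Sum.inl r) (rho n) * pderiv (Sum.inr r) P +
      pderiv (Sum.inr r) (rho n) * pderiv (Sum.inl r) P) = (l : ℂ) • P + (k : ℂ) • P := by
    rw [← euler_Z hP, ← euler_Zc hP, ← Finset.sum_add_distrib]
    simp
  rw [laplace_mul, hc, h0]
  simp [MvPolynomial.smul_eq_C_mul]
  ring

/-- Iterates `laplace_rho_mul`. The truncated exponent at `a = 0` is harmless because its
coefficient contains the factor `a`. -/
theorem laplace_rho_pow_mul {P : Poly n} (hP : P ∈ homPoly n k l) (a : ℕ) :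
    laplace n (rho n ^ a * P) =
      ((a : ℂ) * (a + n + k + l - 1)) • (rho n ^ (a - 1) * P) + rho n ^ a * laplace n P := by
  induction a with
  | zero => simp
  | succ a ih =>
    rw [pow_succ', mul_assoc, laplace_rho_mul (rho_pow_mul_mem hP a), ih]
    rcases a with _ | a
    · simp
      congr 1
      ring
    · simp only [MvPolynomial.smul_eq_C_mul, Nat.add_sub_cancel]
      push_cast
      simp only [map_mul, map_add, map_sub, map_one, map_natCast]
      ring

end Forms

/-! ### The Gaussian functional -/

/-- The Gaussian expectation of a polynomial in `z, z̄`. -/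
def gauss (n : ℕ) : Poly n →ₗ[ℂ] ℂ :=
  (MvPolynomial.basisMonomials (Fin n ⊕ Fin n) ℂ).constr ℂ fun s =>
    ∏ r, if s (Sum.inl r) = s (Sum.inr r) then ((s (Sum.inl r)).factorial : ℂ) else 0

section Gauss

variable {m n : ℕ} {k l : ℕ}

theorem gauss_monomial (s : Fin n ⊕ Fin n →₀ ℕ) (c : ℂ) : gauss n (MvPolynomial.monomial s c) =
    c * ∏ r, if s (Sum.inl r) = s (Sum.inr r) then ((s (Sum.inl r)).factorial : ℂ) else 0 := by
  have h : MvPolynomial.monomial s c = c • MvPolynomial.basisMonomials (Fin n ⊕ Fin n) ℂ s := by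
    simp [MvPolynomial.smul_monomial]
  rw [h, map_smul, gauss, Module.Basis.constr_basis, smul_eq_mul]

@[simp] theorem gauss_C (c : ℂ) : gauss n (MvPolynomial.C c) = c := by
  rw [MvPolynomial.C_apply, gauss_monomial]; simp

theorem gauss_C_mul (c : ℂ) (P : Poly n) : gauss n (MvPolynomial.C c * P) = c * gauss n P := by
  rw [← MvPolynomial.smul_eq_C_mul, map_smul, smul_eq_mul]

/-- Gaussian integration by parts; on monomials it is the recursion of the factorial. This identity
and its conjugate drive all later evaluations of `gauss`. -/
theorem gauss_Z_mul (r : Fin n) (P : Poly n) :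
    gauss n (Z r * P) = gauss n (pderiv (Sum.inr r) P) := by
  induction P using MvPolynomial.induction_on' with
  | add p q hp hq => simp [mul_add, hp, hq]
  | monomial s c =>
    change gauss n (MvPolynomial.monomial (Finsupp.single (Sum.inl r) 1) 1 *
      MvPolynomial.monomial s c) = _
    rw [mul_comm, MvPolynomial.monomial_mul, mul_one, MvPolynomial.pderiv_monomial, gauss_monomial,
      gauss_monomial, mul_assoc]
    congr 1
    rw [← Finset.mul_prod_erase _ _ (Finset.mem_univ r),
      ← Finset.mul_prod_erase _ _ (Finset.mem_univ r), ← mul_assoc]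
    congr 1
    · rcases h : s (Sum.inr r) with _ | b
      · simp [h]
      · by_cases h' : s (Sum.inl r) = b
        · simp [h, h', Nat.factorial_succ]
        · simp [h, h']
    · refine Finset.prod_congr rfl fun x hx => ?_
      have hx' : r ≠ x := (Finset.ne_of_mem_erase hx).symm
      simp [hx']

theorem gauss_Zc_mul (r : Fin n) (P : Poly n) :
    gauss n (Zc r * P) = gauss n (pderiv (Sum.inl r) P) := by
  induction P using MvPolynomial.induction_on' with
  | add p q hp hq => simp [mul_add, hp, hq]
  | monomial s c =>
    change gauss n (MvPolynomial.monomial (Finsupp.single (Sum.inr r) 1) 1 *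
      MvPolynomial.monomial s c) = _
    rw [mul_comm, MvPolynomial.monomial_mul, mul_one, MvPolynomial.pderiv_monomial, gauss_monomial,
      gauss_monomial, mul_assoc]
    congr 1
    rw [← Finset.mul_prod_erase _ _ (Finset.mem_univ r),
      ← Finset.mul_prod_erase _ _ (Finset.mem_univ r), ← mul_assoc]
    congr 1
    · rcases h : s (Sum.inl r) with _ | b
      · simp [h]
      · by_cases h' : b = s (Sum.inr r)
        · simp [h, ← h', Nat.factorial_succ]
        · simp [h, h']
    · refine Finset.prod_congr rfl fun x hx => ?_
      have hx' : r ≠ x := (Finset.ne_of_mem_erase hx).symm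
      simp [hx']

theorem gauss_lin_mul (w : E n) (P : Poly n) : gauss n (lin w * P) = gauss n (dirC w P) := by
  simp [lin, dirC_apply, Finset.sum_mul, mul_assoc, gauss_C_mul, gauss_Z_mul]

theorem gauss_linc_mul (w : E n) (P : Poly n) : gauss n (linc w * P) = gauss n (dir w P) := by
  simp [linc, dir_apply, Finset.sum_mul, mul_assoc, gauss_C_mul, gauss_Zc_mul]

/-- Euler's identity turns `k P` into a sum of terms `z_r ∂P/∂z_r`, and integration by parts turns
each of them into a summand of the Laplacian. -/
theorem gauss_laplace_left {P : Poly n} (hP : P ∈ homPoly n k l) :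
    gauss n (laplace n P) = k * gauss n P := by
  rw [← smul_eq_mul, ← map_smul, ← euler_Z hP, map_sum, laplace_apply, map_sum]
  exact Finset.sum_congr rfl fun r _ => by rw [gauss_Z_mul, pderiv_comm]

theorem gauss_laplace_right {P : Poly n} (hP : P ∈ homPoly n k l) :
    gauss n (laplace n P) = l * gauss n P := by
  rw [← smul_eq_mul, ← map_smul, ← euler_Zc hP, map_sum, laplace_apply, map_sum]
  exact Finset.sum_congr rfl fun r _ => by rw [gauss_Zc_mul]

/-- The Laplacian has expectation both `k` and `l` times that of `P`. -/
theorem gauss_eq_zero_of_ne {P : Poly n} (hP : P ∈ homPoly n k l) (h : k ≠ l) :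
    gauss n P = 0 := by
  have h1 := (gauss_laplace_left hP).symm.trans (gauss_laplace_right hP)
  by_contra h0
  exact h (by exact_mod_cast mul_right_cancel₀ h0 h1)

theorem gauss_eq_zero_of_harmonic {P : Poly n} (hP : P ∈ homPoly n k l) (hΔ : laplace n P = 0)
    (h : 0 < k + l) : gauss n P = 0 := by
  have h1 := gauss_laplace_left hP
  have h2 := gauss_laplace_right hP
  rw [hΔ, map_zero, eq_comm, mul_eq_zero] at h1 h2
  rcases h1 with h1 | h1
  · rcases h2 with h2 | h2
    · norm_cast at h1 h2; omega
    · exact h2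
  · exact h1

/-- A harmonic polynomial is orthogonal to all polynomials of lower degree. -/
theorem gauss_mul_harmonic (N : ℕ) : ∀ (a b : ℕ), a + b = N → ∀ q ∈ homPoly n a b,
    ∀ (k l : ℕ), ∀ p ∈ homPoly n k l, laplace n p = 0 → N < k + l → gauss n (q * p) = 0 := by
  induction N using Nat.strong_induction_on with
  | _ N ih =>
  intro a b hab q hq k l p hp hΔ hN
  rcases a with _ | a
  · rcases b with _ | b
    · obtain ⟨c, rfl⟩ := eq_C_of_mem_homPoly hq
      rw [gauss_C_mul, gauss_eq_zero_of_harmonic hp hΔ (by omega), mul_zero]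
    · have h0 : ((b + 1 : ℕ) : ℂ) ≠ 0 := Nat.cast_ne_zero.2 (by omega)
      refine (mul_eq_zero.1 (?_ : ((b + 1 : ℕ) : ℂ) * gauss n (q * p) = 0)).resolve_left h0
      rw [← smul_eq_mul, ← map_smul, ← smul_mul_assoc, ← euler_Zc hq, Finset.sum_mul, map_sum]
      refine Finset.sum_eq_zero fun r _ => ?_
      rw [mul_assoc, gauss_Zc_mul, Derivation.leibniz, map_add, smul_eq_mul, smul_eq_mul,
        pderiv_inl_eq_zero (pderiv_Zc_mem hq r), mul_zero, map_zero, add_zero]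
      rcases k with _ | k
      · rw [pderiv_inl_eq_zero hp, mul_zero, map_zero]
      · exact ih b (by omega) 0 b (by omega) _ (pderiv_Zc_mem hq r) k l _ (pderiv_Z_mem hp r)
          (by rw [laplace_pderiv, hΔ, map_zero]) (by omega)
  -- Euler's identity extracts a factor `z_r` from `q`. Integration by parts then differentiates
  -- either `p`, which stays harmonic and loses one degree like `q`, or `q` a second time; both
  -- cases fall under the induction hypothesis.
  · have h0 : ((a + 1 : ℕ) : ℂ) ≠ 0 := Nat.cast_ne_zero.2 (by omega)
    refine (mul_eq_zero.1 (?_ : ((a + 1 : ℕ) : ℂ) * gauss n (q * p) = 0)).resolve_left h0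
    rw [← smul_eq_mul, ← map_smul, ← smul_mul_assoc, ← euler_Z hq, Finset.sum_mul, map_sum]
    refine Finset.sum_eq_zero fun r _ => ?_
    rw [mul_assoc, gauss_Z_mul, Derivation.leibniz, map_add, smul_eq_mul, smul_eq_mul]
    have h1 : gauss n (pderiv (Sum.inl r) q * pderiv (Sum.inr r) p) = 0 := by
      rcases l with _ | l
      · rw [pderiv_inr_eq_zero hp, mul_zero, map_zero]
      · exact ih (a + b) (by omega) a b rfl _ (pderiv_Z_mem hq r) k l _ (pderiv_Zc_mem hp r)
          (by rw [laplace_pderiv, hΔ, map_zero]) (by omega)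
    have h2 : gauss n (p * pderiv (Sum.inr r) (pderiv (Sum.inl r) q)) = 0 := by
      rcases b with _ | b
      · rw [pderiv_inr_eq_zero (pderiv_Z_mem hq r), mul_zero, map_zero]
      · rw [mul_comm]
        exact ih (a + b) (by omega) a b rfl _ (pderiv_Zc_mem (pderiv_Z_mem hq r) r) k l _ hp hΔ
          (by omega)
    rw [h1, h2, add_zero]

/-- The Gaussian functional is compatible with marginals: in bidegree `(k, k)` with `k > 0` it is
determined by its value on the Laplacian, which commutes with `pull v`, and in unequal bidegrees it
vanishes. -/
theorem gauss_pull {v : Fin n → E m} (hv : Orthonormal ℂ v) (N : ℕ) : ∀ k l, k + l = N →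
    ∀ P ∈ homPoly n k l, gauss m (pull v P) = gauss n P := by
  induction N using Nat.strong_induction_on with
  | _ N ih =>
  intro k l hkl P hP
  by_cases hk : k = l
  · subst hk
    rcases k with _ | k
    · obtain ⟨c, rfl⟩ := eq_C_of_mem_homPoly hP
      simp [MvPolynomial.algHom_C]
    · have h0 : ((k + 1 : ℕ) : ℂ) ≠ 0 := Nat.cast_ne_zero.2 (by omega)
      refine mul_left_cancel₀ h0 ?_
      rw [← gauss_laplace_left hP, ← gauss_laplace_left (pull_mem_homPoly v hP), laplace_pull hv]
      exact ih (k + k) (by omega) k k rfl _ (laplace_mem hP)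
  · rw [gauss_eq_zero_of_ne hP hk, gauss_eq_zero_of_ne (pull_mem_homPoly v hP) hk]

/-- The coordinate along `e` is independent of those along `v`, with `2a`-th absolute moment `a!`;
algebraically, integrate by parts along `e`. -/
theorem gauss_lin_pow_mul_pull {e : E m} {v : Fin n → E m} (he : ‖e‖ = 1)
    (hev : ∀ r, inner ℂ e (v r) = 0) (a : ℕ) (P : Poly n) :
    gauss m (lin e ^ a * linc e ^ a * pull v P) = a.factorial * gauss m (pull v P) := by
  have h1 : dirC e (pull v P) = 0 := by rw [dirC_pull]; simp [hev]
  induction a with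
  | zero => simp
  | succ a ih =>
    have h2 : dirC e (lin e ^ a * linc e ^ (a + 1) * pull v P) =
        ((a + 1 : ℕ) : ℂ) • (lin e ^ a * linc e ^ a * pull v P) := by
      simp only [Derivation.leibniz, Derivation.leibniz_pow, h1, dirC_lin, dirC_linc,
        inner_self_eq_norm_sq_to_K (𝕜 := ℂ), he, MvPolynomial.smul_eq_C_mul]
      simp
      ring
    rw [show lin e ^ (a + 1) * linc e ^ (a + 1) * pull v P =
      lin e * (lin e ^ a * linc e ^ (a + 1) * pull v P) by ring, gauss_lin_mul, h2, map_smul, ih,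
      Nat.factorial_succ]
    push_cast
    simp
    ring

/-- The leading term of the reproducing property. -/
theorem gauss_linc_pow_mul_harmonic (w : E n) (k l : ℕ) : ∀ P ∈ homPoly n k l, laplace n P = 0 →
    gauss n (linc w ^ k * lin w ^ l * P) = k.factorial * l.factorial * evalAt w P := by
  induction k with
  | zero =>
    induction l with
    | zero =>
      intro P hP _
      obtain ⟨c, rfl⟩ := eq_C_of_mem_homPoly hP
      simp
    | succ l ih =>
      intro P hP hΔ
      have h1 : evalAt w (dirC w P) = (l + 1 : ℕ) * evalAt w P := by
        have := congrArg (evalAt w) (euler_Zc hP)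
        simpa [dirC_apply] using this
      have h2 : dirC w (lin w ^ l * P) = lin w ^ l * dirC w P := by
        simp [Derivation.leibniz, Derivation.leibniz_pow]
      rw [pow_zero, one_mul, pow_succ', mul_assoc, gauss_lin_mul, h2]
      have h3 := ih _ (dirC_mem w hP) (by rw [laplace_dirC, hΔ, map_zero])
      rw [pow_zero, one_mul] at h3
      rw [h3, h1, Nat.factorial_succ]
      push_cast
      ring
  | succ k ih =>
    intro P hP hΔ
    have h1 : evalAt w (dir w P) = (k + 1 : ℕ) * evalAt w P := by
      have := congrArg (evalAt w) (euler_Z hP)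
      simpa [dir_apply] using this
    have h2 : dir w (linc w ^ k * lin w ^ l * P) = linc w ^ k * lin w ^ l * dir w P +
        MvPolynomial.C (l * inner ℂ w w) * ((lin w ^ (l - 1) * linc w ^ k) * P) := by
      simp [Derivation.leibniz, Derivation.leibniz_pow]
      ring
    -- When the derivative hits `lin w ^ l`, the remaining factor has lower total degree than the
    -- harmonic `P`, so the term contributes nothing; for `l = 0` its coefficient is zero.
    have h4 : (MvPolynomial.C (l * inner ℂ w w) : Poly n) = 0 ∨
        gauss n ((lin w ^ (l - 1) * linc w ^ k) * P) = 0 := by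
      rcases l with _ | l
      · left; simp
      · right
        exact gauss_mul_harmonic _ _ _ rfl _ (lin_pow_mul_linc_pow_mem w _ _) _ _ _ hP hΔ
          (by simp; omega)
    have h5 : gauss n (MvPolynomial.C (l * inner ℂ w w) * ((lin w ^ (l - 1) * linc w ^ k) * P))
        = 0 := by
      rcases h4 with h | h
      · rw [h, zero_mul, map_zero]
      · rw [gauss_C_mul, h, mul_zero]
    rw [show linc w ^ (k + 1) * lin w ^ l * P = linc w * (linc w ^ k * lin w ^ l * P) by ring,
      gauss_linc_mul, h2, map_add, h5, add_zero, ih _ (dir_mem w hP)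
        (by rw [laplace_dir, hΔ, map_zero]), h1, Nat.factorial_succ]
    push_cast
    ring

end Gauss

/-! ### Zonal polynomials -/

/-- The constant factor of `jacobi`. -/
def jacobiConst (n k l : ℕ) : ℂ :=
  (harmDim n k l : ℂ) * ((n - 2).factorial : ℂ) * (k.factorial : ℂ) * (l.factorial : ℂ) /
      (((n + k - 2).factorial : ℂ) * ((n + l - 2).factorial : ℂ))

/-- The coefficients of `jacobi`. -/
def jacobiCoeff (n k l r : ℕ) : ℂ :=
  (-1) ^ r * ((n + k + l - r - 2).factorial : ℂ) /
        ((r.factorial : ℂ) * ((k - r).factorial : ℂ) * ((l - r).factorial : ℂ))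

theorem jacobi_eq (n k l : ℕ) (x : ℂ) : jacobi n k l x = jacobiConst n k l *
    ∑ r ∈ Finset.range (min k l + 1),
      jacobiCoeff n k l r * x ^ (k - r) * (starRingEnd ℂ x) ^ (l - r) := rfl

theorem conj_jacobiConst (n k l : ℕ) :
    (starRingEnd ℂ) (jacobiConst n k l) = jacobiConst n k l := by
  simp [jacobiConst]

theorem conj_jacobiCoeff (n k l r : ℕ) :
    (starRingEnd ℂ) (jacobiCoeff n k l r) = jacobiCoeff n k l r := by
  simp [jacobiCoeff]

/-- This recursion is exactly the condition for neighbouring terms to cancel in `laplace_zonalPoly`.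
-/
theorem jacobiCoeff_succ {n k l r : ℕ} (hn : 2 ≤ n) (hk : r < k) (hl : r < l) :
    jacobiCoeff n k l (r + 1) * ((r + 1 : ℂ) * (n + k + l - r - 2)) =
      -(jacobiCoeff n k l r * (((k - r : ℕ) : ℂ) * ((l - r : ℕ) : ℂ))) := by
  obtain ⟨k, rfl⟩ : ∃ c, k = r + 1 + c := ⟨k - (r + 1), by omega⟩
  obtain ⟨l, rfl⟩ : ∃ c, l = r + 1 + c := ⟨l - (r + 1), by omega⟩
  obtain ⟨n, rfl⟩ : ∃ c, n = c + 2 := ⟨n - 2, by omega⟩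
  have e1 : r + 1 + k - r = k + 1 := by omega
  have e2 : r + 1 + l - r = l + 1 := by omega
  have e3 : r + 1 + k - (r + 1) = k := by omega
  have e4 : r + 1 + l - (r + 1) = l := by omega
  have e5 : n + 2 + (r + 1 + k) + (r + 1 + l) - r - 2 = (n + r + k + l + 1) + 1 := by omega
  have e6 : n + 2 + (r + 1 + k) + (r + 1 + l) - (r + 1) - 2 = n + r + k + l + 1 := by omega
  simp only [jacobiCoeff, e1, e2, e3, e4, e5, e6]
  rw [Nat.factorial_succ (n + r + k + l + 1), Nat.factorial_succ r, Nat.factorial_succ k,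
    Nat.factorial_succ l, pow_succ]
  have h1 : (k : ℂ) + 1 ≠ 0 := by exact_mod_cast Nat.succ_ne_zero k
  have h2 : (l : ℂ) + 1 ≠ 0 := by exact_mod_cast Nat.succ_ne_zero l
  have h3 : (r : ℂ) + 1 ≠ 0 := by exact_mod_cast Nat.succ_ne_zero r
  have h4 := fun a : ℕ => (Nat.cast_ne_zero (R := ℂ)).2 a.factorial_ne_zero
  have h5 := h4 k
  have h6 := h4 l
  have h7 := h4 r
  push_cast
  field_simp
  ring

/-- The reproducing kernel of the harmonic polynomials of bidegree `(k, l)`. -/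
def zonalPoly (n k l : ℕ) (w : E n) : Poly n :=
  jacobiConst n k l • ∑ r ∈ Finset.range (min k l + 1),
    (jacobiCoeff n k l r * ((‖w‖ : ℂ) ^ 2) ^ r) •
      (rho n ^ r * (lin w ^ (k - r) * linc w ^ (l - r)))

section Zonal

variable {n : ℕ} (k l : ℕ) (w : E n)

theorem zonalPoly_mem : zonalPoly n k l w ∈ homPoly n k l := by
  refine Submodule.smul_mem _ _ (Submodule.sum_mem _ fun r hr => Submodule.smul_mem _ _ ?_)
  have h := rho_pow_mul_mem (lin_pow_mul_linc_pow_mem w (k - r) (l - r)) r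
  rw [Finset.mem_range] at hr
  rwa [Nat.sub_add_cancel (by omega), Nat.sub_add_cancel (by omega)] at h

/-- Each summand contributes one term with `rho n ^ (r - 1)` and one with `rho n ^ r`. Adjacent
contributions cancel by `jacobiCoeff_succ`; the last one vanishes since `k - r` or `l - r` is zero
at `r = min k l`. -/
theorem laplace_zonalPoly (hn : 2 ≤ n) : laplace n (zonalPoly n k l w) = 0 := by
  have key : ∑ r ∈ Finset.range (min k l + 1),
      laplace n ((jacobiCoeff n k l r * ((‖w‖ : ℂ) ^ 2) ^ r) •
      (rho n ^ r * (lin w ^ (k - r) * linc w ^ (l - r)))) = 0 := by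
    have h : ∀ r ∈ Finset.range (min k l + 1),
        laplace n ((jacobiCoeff n k l r * ((‖w‖ : ℂ) ^ 2) ^ r) •
          (rho n ^ r * (lin w ^ (k - r) * linc w ^ (l - r)))) =
        (jacobiCoeff n k l r * ((‖w‖ : ℂ) ^ 2) ^ r * (r * (n + k + l - r - 1))) •
          (rho n ^ (r - 1) * (lin w ^ (k - r) * linc w ^ (l - r))) +
        (jacobiCoeff n k l r * ((‖w‖ : ℂ) ^ 2) ^ r *
          (((k - r : ℕ) : ℂ) * ((l - r : ℕ) : ℂ) * (‖w‖ : ℂ) ^ 2)) •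
          (rho n ^ r * (lin w ^ (k - r - 1) * linc w ^ (l - r - 1))) := by
      intro r hr
      rw [Finset.mem_range] at hr
      rw [map_smul, laplace_rho_pow_mul (lin_pow_mul_linc_pow_mem w _ _), laplace_lin_pow,
        Nat.cast_sub (show r ≤ k by omega), Nat.cast_sub (show r ≤ l by omega),
        inner_self_eq_norm_sq_to_K (𝕜 := ℂ), smul_add, smul_smul]
      congr 1
      · congr 1
        ring
      · rw [← MvPolynomial.smul_eq_C_mul, mul_smul_comm, smul_smul]
        rfl
    rw [Finset.sum_congr rfl h, Finset.sum_add_distrib, Finset.sum_range_succ',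
      Finset.sum_range_succ]
    have hz : ((k - min k l : ℕ) : ℂ) * ((l - min k l : ℕ) : ℂ) = 0 := by
      rcases le_total k l with h | h <;> simp [h]
    rw [hz]
    simp only [Nat.cast_zero, zero_mul, mul_zero, zero_smul, add_zero]
    rw [← Finset.sum_add_distrib]
    refine Finset.sum_eq_zero fun r hr => ?_
    rw [Finset.mem_range] at hr
    have hc := jacobiCoeff_succ hn (show r < k by omega) (show r < l by omega)
    rw [Nat.add_sub_cancel, ← Nat.sub_sub, ← Nat.sub_sub, ← add_smul]
    convert zero_smul ℂ _
    push_cast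
    rw [pow_succ]
    linear_combination ((‖w‖ : ℂ) ^ 2) ^ r * (‖w‖ : ℂ) ^ 2 * hc
  rw [zonalPoly, map_smul, map_sum, key, smul_zero]

theorem evalAt_zonalPoly (x : E n) : evalAt x (zonalPoly n k l w) = jacobiConst n k l *
    ∑ r ∈ Finset.range (min k l + 1), jacobiCoeff n k l r * ((‖w‖ : ℂ) * ‖x‖) ^ (2 * r) *
      (inner ℂ w x ^ (k - r) * inner ℂ x w ^ (l - r)) := by
  simp only [zonalPoly, map_smul, map_sum, map_mul, map_pow, evalAt_rho, evalAt_lin, evalAt_linc,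
    smul_eq_mul]
  congr 1
  refine Finset.sum_congr rfl fun r _ => ?_
  ring

end Zonal

/-! ### Integration over the sphere -/

theorem integral_complex_monomial_gaussian (a b : ℕ) :
    ∫ z : ℂ, z ^ a * (starRingEnd ℂ) z ^ b * (Real.exp (-‖z‖ ^ 2) : ℂ) =
      (Real.pi : ℂ) * if a = b then (a.factorial : ℂ) else 0 := by
  split_ifs with h
  · subst h
    have h1 := Complex.integral_rpow_mul_exp_neg_rpow (p := 2) (q := 2 * a) (by norm_num)
      (by have : (0 : ℝ) ≤ a := Nat.cast_nonneg a
          linarith)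
    have h2 : ∀ z : ℂ, z ^ a * (starRingEnd ℂ) z ^ a * (Real.exp (-‖z‖ ^ 2) : ℂ) =
        ((‖z‖ ^ (2 * a : ℝ) * Real.exp (-‖z‖ ^ (2 : ℝ)) : ℝ) : ℂ) := by
      intro z
      rw [← mul_pow, Complex.mul_conj, Complex.normSq_eq_norm_sq]
      have e1 : ‖z‖ ^ (2 * a : ℝ) = (‖z‖ ^ 2) ^ a := by
        rw [← pow_mul, ← Real.rpow_natCast]; push_cast; rfl
      rw [e1, Real.rpow_two]
      push_cast
      ring
    simp only [h2]
    rw [integral_complex_ofReal, h1, show (2 * (a : ℝ) + 2) / 2 = a + 1 by ring,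
      Real.Gamma_nat_eq_factorial]
    push_cast
    ring
  · rw [mul_zero]
    set F : ℂ → ℂ := fun z => z ^ a * (starRingEnd ℂ) z ^ b * (Real.exp (-‖z‖ ^ 2) : ℂ) with hF
    -- Rotation by the angle `π / (a - b)` preserves the measure and changes the sign of the
    -- integrand, so the integral is zero.
    obtain ⟨c, hc⟩ : ∃ c : Circle, (c : ℂ) ^ a * (starRingEnd ℂ) (c : ℂ) ^ b = -1 := by
      have hab : ((a : ℂ) - b) ≠ 0 := sub_ne_zero.2 (by exact_mod_cast h)
      refine ⟨Circle.exp (Real.pi / (a - b)), ?_⟩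
      rw [Circle.coe_exp, ← Complex.exp_conj, ← Complex.exp_nat_mul, ← Complex.exp_nat_mul,
        ← Complex.exp_add, ← Complex.exp_pi_mul_I]
      congr 1
      simp only [map_mul, Complex.conj_ofReal, Complex.conj_I]
      push_cast
      field_simp
      ring
    have h1 := (LinearIsometryEquiv.measurePreserving
      (rotation c)).integral_comp
      ((rotation c).toHomeomorph.measurableEmbedding) F
    have h2 : ∀ z : ℂ, F (rotation c z) = -F z := by
      intro z
      simp only [hF, rotation_apply, map_mul, mul_pow, norm_mul, Circle.norm_coe, one_mul]
      linear_combination (z ^ a * (starRingEnd ℂ) z ^ b * (Real.exp (-‖z‖ ^ 2) : ℂ)) * hc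
    have h3 : ∫ z, F (rotation c z) = ∫ z, F z := h1
    simp only [h2, integral_neg] at h3
    exact self_eq_neg.1 h3.symm

theorem finrank_real_E (n : ℕ) : Module.finrank ℝ (E n) = 2 * n := by
  rw [← Module.finrank_mul_finrank ℝ ℂ (E n)]
  simp

/-- Homogeneity separates direction from radius. The radial integrand is `r ^ (2n - 1 + a + b)`
times the Gaussian, which yields the Gamma value. -/
theorem integral_gaussian_polar {n : ℕ} (hn : 0 < n) {a b : ℕ} {P : Poly n}
    (hP : P ∈ homPoly n a b) :
    ∫ z : E n, evalAt z P * (Real.exp (-‖z‖ ^ 2) : ℂ) =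
      (∫ z, toFun n P z ∂(volume : Measure (E n)).toSphere) *
        ((Real.Gamma (n + (a + b : ℕ) / 2) / 2 : ℝ) : ℂ) := by
  have : Nontrivial (E n) := by
    have : Nonempty (Fin n) := ⟨⟨0, hn⟩⟩
    infer_instance
  let μ : Measure (E n) := volume
  let f : E n → ℂ := fun z => evalAt z P * (Real.exp (-‖z‖ ^ 2) : ℂ)
  let g : Set.Ioi (0 : ℝ) → ℂ := fun r => ((r.1 ^ (a + b) * Real.exp (-r.1 ^ 2) : ℝ) : ℂ)
  have hf : ∀ z : ({0}ᶜ : Set (E n)), f z =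
      toFun n P (homeomorphUnitSphereProd (E n) z).1 *
        g (homeomorphUnitSphereProd (E n) z).2 := by
    intro z
    have h0 : ‖(z : E n)‖ ≠ 0 := norm_ne_zero_iff.2 z.2
    have h1 : (z : E n) = (‖(z : E n)‖ : ℂ) •
        ((homeomorphUnitSphereProd (E n) z).1 : E n) := by
      rw [homeomorphUnitSphereProd_apply_fst_coe, ← Complex.coe_smul, smul_smul]
      rw [← Complex.ofReal_mul, mul_inv_cancel₀ h0]
      simp
    have h2 := evalAt_smul hP (‖(z : E n)‖ : ℂ) ((homeomorphUnitSphereProd (E n) z).1 : E n)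
    rw [← h1] at h2
    simp only [f, g, h2, toFun_apply, homeomorphUnitSphereProd_apply_snd_coe]
    rw [Complex.conj_ofReal]
    push_cast
    ring
  have hr : ∫ r, g r ∂Measure.volumeIoiPow (Module.finrank ℝ (E n) - 1) =
      ((Real.Gamma (n + (a + b : ℕ) / 2) / 2 : ℝ) : ℂ) := by
    simp only [Measure.volumeIoiPow, ENNReal.ofReal]
    rw [integral_withDensity_eq_integral_smul
      ((measurable_subtype_coe.pow_const _).real_toNNReal),
      integral_subtype_comap measurableSet_Ioi fun r : ℝ =>
        Real.toNNReal (r ^ (Module.finrank ℝ (E n) - 1)) •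
          (((r ^ (a + b) * Real.exp (-r ^ 2) : ℝ)) : ℂ)]
    have h3 : ∀ r ∈ Set.Ioi (0 : ℝ), Real.toNNReal (r ^ (Module.finrank ℝ (E n) - 1)) •
        (((r ^ (a + b) * Real.exp (-r ^ 2) : ℝ)) : ℂ) =
        ((r ^ ((2 * n - 1 + (a + b) : ℕ) : ℝ) * Real.exp (-r ^ (2 : ℝ)) : ℝ) : ℂ) := by
      intro r hr
      rw [NNReal.smul_def, Real.coe_toNNReal _ (pow_nonneg (le_of_lt hr) _), finrank_real_E,
        Real.rpow_natCast, Real.rpow_two, pow_add, Complex.real_smul]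
      push_cast
      ring
    rw [setIntegral_congr_fun measurableSet_Ioi h3, integral_complex_ofReal,
      integral_rpow_mul_exp_neg_rpow (by norm_num)
        (by have : (0 : ℝ) ≤ ((2 * n - 1 + (a + b) : ℕ) : ℝ) := Nat.cast_nonneg _
            linarith)]
    congr 1
    have h4 : (((2 * n - 1 + (a + b) : ℕ) : ℝ) + 1) / 2 = n + (a + b : ℕ) / 2 := by
      have : ((2 * n - 1 + (a + b) + 1 : ℕ) : ℝ) = ((2 * n + (a + b) : ℕ) : ℝ) := by
        congr 1; omega
      push_cast at this ⊢
      rw [this]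
      ring
    rw [h4]
    ring
  calc ∫ z : E n, evalAt z P * (Real.exp (-‖z‖ ^ 2) : ℂ)
      = ∫ z : ({0}ᶜ : Set (E n)), f z ∂(μ.comap (↑)) := by
        rw [integral_subtype_comap (measurableSet_singleton _).compl f,
          restrict_compl_singleton]
    _ = ∫ x, toFun n P x.1 * g x.2
          ∂μ.toSphere.prod (.volumeIoiPow (Module.finrank ℝ (E n) - 1)) := by
        simp only [hf]
        exact μ.measurePreserving_homeomorphUnitSphereProd.integral_comp
          (Homeomorph.measurableEmbedding _)
          (fun x => toFun n P x.1 * g x.2)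
    _ = _ := by rw [integral_prod_mul, hr]

theorem evalAt_monomial {n : ℕ} (z : E n) (s : Fin n ⊕ Fin n →₀ ℕ) :
    evalAt z (MvPolynomial.monomial s 1) =
      ∏ r, z r ^ s (Sum.inl r) * (starRingEnd ℂ) (z r) ^ s (Sum.inr r) := by
  rw [evalAt, MvPolynomial.aeval_monomial, Finsupp.prod_fintype _ _ (by simp),
    Fintype.prod_sum_type, Finset.prod_mul_distrib]
  simp

/-- The Gaussian factors over the coordinates. The constant comparing the volume of `E n` with the
product volume is obtained from uniqueness of Haar measure and left undetermined: it cancels when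
the sphere is normalized. -/
theorem exists_integral_gaussian (n : ℕ) : ∃ c : ℂ, ∀ s : Fin n ⊕ Fin n →₀ ℕ,
    ∫ z : E n, evalAt z (MvPolynomial.monomial s 1) * (Real.exp (-‖z‖ ^ 2) : ℂ) =
      c * gauss n (MvPolynomial.monomial s 1) := by
  let L : E n ≃L[ℝ] (Fin n → ℂ) :=
    PiLp.continuousLinearEquiv 2 ℝ (fun _ : Fin n => ℂ)
  let ν : Measure (Fin n → ℂ) := (volume : Measure (E n)).map L
  have : ν.IsAddHaarMeasure := L.isAddHaarMeasure_map volume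
  obtain ⟨κ, hν⟩ : ∃ κ : NNReal, ν = κ • volume :=
    ⟨_, Measure.isAddLeftInvariant_eq_smul ν volume⟩
  refine ⟨(κ : ℝ) * (Real.pi : ℂ) ^ n, fun s => ?_⟩
  let F : (Fin n → ℂ) → ℂ := fun y => ∏ r, y r ^ s (Sum.inl r) *
    (starRingEnd ℂ) (y r) ^ s (Sum.inr r) * (Real.exp (-‖y r‖ ^ 2) : ℂ)
  have h1 : ∀ z : E n, evalAt z (MvPolynomial.monomial s 1) * (Real.exp (-‖z‖ ^ 2) : ℂ) =
      F (L z) := by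
    intro z
    have hL : ∀ r, L z r = z r := fun r => rfl
    simp only [F, Finset.prod_mul_distrib, hL]
    rw [evalAt_monomial, Finset.prod_mul_distrib, EuclideanSpace.norm_sq_eq,
      ← Finset.sum_neg_distrib, Real.exp_sum]
    push_cast
    rfl
  have h2 : ∫ z : E n, F (L z) = ∫ y, F y ∂ν :=
    (integral_map_equiv (L.toHomeomorph.toMeasurableEquiv) F).symm
  have h3 : ∫ y, F y = ∏ r, ((Real.pi : ℂ) * if s (Sum.inl r) = s (Sum.inr r) then
      ((s (Sum.inl r)).factorial : ℂ) else 0) := by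
    have := integral_fintype_prod_volume_eq_prod (ι := Fin n) (𝕜 := ℂ) (E := fun _ => ℂ)
      (fun r z => z ^ s (Sum.inl r) *
        (starRingEnd ℂ) z ^ s (Sum.inr r) * (Real.exp (-‖z‖ ^ 2) : ℂ))
    simp only [integral_complex_monomial_gaussian] at this
    exact this
  simp only [h1]
  rw [h2, hν, integral_smul_nnreal_measure, h3, gauss_monomial, Finset.prod_mul_distrib]
  simp [NNReal.smul_def]
  ring

theorem continuous_evalAt {n : ℕ} (P : Poly n) : Continuous fun z : E n => evalAt z P := by
  induction P using MvPolynomial.induction_on with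
  | C a => simpa using continuous_const
  | add p q hp hq => simp only [map_add]; exact hp.add hq
  | mul_X p x hp =>
    rcases x with r | r
    · simp only [map_mul, evalAt_Z]; fun_prop
    · simp only [map_mul, evalAt_Zc]
      exact hp.mul (Complex.continuous_conj.comp (by fun_prop))

theorem continuous_toFun {n : ℕ} (P : Poly n) : Continuous (toFun n P) :=
  (continuous_evalAt P).comp continuous_subtype_val

instance (n : ℕ) : IsFiniteMeasure (sphereMeasure n) := by
  by_cases h : (volume : Measure (E n)).toSphere Set.univ = 0
  · have : sphereMeasure n = 0 := by
      rw [sphereMeasure, Measure.measure_univ_eq_zero.1 h, smul_zero]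
    rw [this]; infer_instance
  · exact Measure.smul_finite _ (ENNReal.inv_ne_top.2 h)

theorem integrable_sphere {n : ℕ} {f : Om n → ℂ} (hf : Continuous f) :
    Integrable f (sphereMeasure n) :=
  hf.integrable_of_hasCompactSupport (HasCompactSupport.of_compactSpace f)

/-- Integration of polynomials over the sphere. -/
def sphInt (n : ℕ) : Poly n →ₗ[ℂ] ℂ where
  toFun P := ∫ z, toFun n P z ∂sphereMeasure n
  map_add' P Q := by
    simp only [map_add, Pi.add_apply]
    exact integral_add (integrable_sphere (continuous_toFun P))
      (integrable_sphere (continuous_toFun Q))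
  map_smul' c P := by
    simp only [map_smul, Pi.smul_apply, RingHom.id_apply]
    exact integral_smul c _

theorem sphInt_apply {n : ℕ} (P : Poly n) : sphInt n P = ∫ z, toFun n P z ∂sphereMeasure n := rfl

/-- Integrals over the sphere in terms of the Gaussian functional. -/
theorem sphInt_eq_gauss {n : ℕ} (hn : 0 < n) {a b : ℕ} {P : Poly n} (hP : P ∈ homPoly n a b) :
    sphInt n P = ((n - 1).factorial : ℂ) / ((n - 1 + a).factorial : ℂ) * gauss n P := by
  have : Nontrivial (E n) := by
    have : Nonempty (Fin n) := ⟨⟨0, hn⟩⟩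
    infer_instance
  obtain ⟨c, hc⟩ := exists_integral_gaussian n
  let σ := (volume : Measure (E n)).toSphere
  have hσ : σ ≠ 0 := Measure.toSphere_ne_zero _
  have hσ0 : σ.real Set.univ ≠ 0 := by
    rw [measureReal_def, ENNReal.toReal_ne_zero]
    exact ⟨fun h => hσ (Measure.measure_univ_eq_zero.1 h), measure_ne_top _ _⟩
  have hS : ∀ P : Poly n, sphInt n P = ((σ.real Set.univ : ℝ) : ℂ)⁻¹ * ∫ z, toFun n P z ∂σ := by
    intro P
    rw [sphInt_apply, sphereMeasure, integral_smul_measure, ENNReal.toReal_inv, Complex.real_smul,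
      Complex.ofReal_inv]
    rfl
  have hG : ∀ m : ℕ, Real.Gamma (n + (m + m : ℕ) / 2) = (n - 1 + m).factorial := by
    intro m
    rw [← Real.Gamma_nat_eq_factorial]
    congr 1
    push_cast [Nat.cast_sub (show 1 ≤ n from hn)]
    ring
  -- The constant polynomial `1` fixes the unknown constant in terms of the surface area.
  have h1 : ((σ.real Set.univ : ℝ) : ℂ) * ((n - 1).factorial : ℂ) = 2 * c := by
    have := integral_gaussian_polar hn (one_mem_homPoly (n := n))
    have h2 := hc 0
    have e1 : (MvPolynomial.monomial (0 : Fin n ⊕ Fin n →₀ ℕ)) (1 : ℂ) = 1 := rfl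
    have e2 : ∫ z, toFun n (1 : Poly n) z ∂σ = ((σ.real Set.univ : ℝ) : ℂ) := by
      simp [toFun_apply]
    have e3 : gauss n (1 : Poly n) = 1 := by
      have := gauss_C (n := n) 1
      simpa using this
    rw [e1, this, e2, hG 0, e3] at h2
    push_cast at h2
    rw [add_zero] at h2
    linear_combination 2 * h2
  have h0 : ∀ m : ℕ, ((m.factorial : ℕ) : ℂ) ≠ 0 := fun m => Nat.cast_ne_zero.2 m.factorial_ne_zero
  have key : ∀ s : Fin n ⊕ Fin n →₀ ℕ, MvPolynomial.monomial s 1 ∈ homPoly n a b →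
      sphInt n (MvPolynomial.monomial s 1) =
        ((n - 1).factorial : ℂ) / ((n - 1 + a).factorial : ℂ) *
          gauss n (MvPolynomial.monomial s 1) := by
    intro s hs
    have h2 := hc s
    rw [integral_gaussian_polar hn hs] at h2
    by_cases hab : a = b
    · subst hab
      rw [hG] at h2
      have h3 : ((σ.real Set.univ : ℝ) : ℂ) ≠ 0 := by exact_mod_cast hσ0
      rw [hS, inv_mul_eq_iff_eq_mul₀ h3]
      have h4 := h0 (n - 1 + a)
      push_cast at h2
      field_simp
      linear_combination 2 * h2 - gauss n (MvPolynomial.monomial s 1) * h1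
    · rw [gauss_eq_zero_of_ne hs hab, mul_zero] at h2 ⊢
      have h3 : Real.Gamma (n + (a + b : ℕ) / 2) / 2 ≠ 0 := by
        have : 0 < Real.Gamma (n + (a + b : ℕ) / 2) := Real.Gamma_pos_of_pos (by positivity)
        positivity
      rw [hS, (mul_eq_zero.1 h2).resolve_right (by exact_mod_cast h3), mul_zero]
  rw [MvPolynomial.as_sum P, map_sum, map_sum, Finset.mul_sum]
  refine Finset.sum_congr rfl fun s hs => ?_
  have h2 : MvPolynomial.monomial s 1 ∈ homPoly n a b :=
    MvPolynomial.isWeightedHomogeneous_monomial _ _ _ (hP (MvPolynomial.mem_support_iff.1 hs))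
  have h3 : MvPolynomial.monomial s (P.coeff s) = P.coeff s • MvPolynomial.monomial s (1 : ℂ) := by
    simp [MvPolynomial.smul_monomial]
  rw [h3, map_smul, map_smul, key s h2, smul_eq_mul, smul_eq_mul]
  ring

theorem ip_toFun {n : ℕ} (P Q : Poly n) : ip (toFun n P) (toFun n Q) = sphInt n (cj P * Q) := by
  simp only [ip, sphInt_apply, toFun_apply, map_mul, evalAt_cj]

/-! ### Moments of the weight on the disk -/

theorem integral_disk_radial (f : ℝ → ℝ) :
    ∫ u in Metric.closedBall (0 : ℂ) 1, f ‖u‖ = 2 * Real.pi * ∫ r in (0 : ℝ)..1, r * f r := by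
  have h1 : ∫ u in Metric.closedBall (0 : ℂ) 1, f ‖u‖ =
      ∫ u : ℂ, (Set.Iic (1 : ℝ)).indicator f ‖u‖ := by
    rw [← integral_indicator Metric.isClosed_closedBall.measurableSet]
    congr 1
    ext u
    simp [Set.indicator, Metric.mem_closedBall]
  rw [h1, integral_fun_norm_addHaar, Complex.finrank_real_complex, intervalIntegral.integral_of_le
    zero_le_one]
  have h2 : ∫ y in Set.Ioi (0 : ℝ), y ^ (2 - 1) • (Set.Iic (1 : ℝ)).indicator f y =
      ∫ r in Set.Ioc (0 : ℝ) 1, r * f r := by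
    rw [← integral_indicator measurableSet_Ioi, ← integral_indicator measurableSet_Ioc]
    congr 1
    ext r
    by_cases h : r ∈ Set.Ioi (0 : ℝ) <;> by_cases h' : r ∈ Set.Iic (1 : ℝ)
    · have h3 : r ∈ Set.Ioc (0 : ℝ) 1 := ⟨h, h'⟩
      simp [Set.indicator_of_mem, h, h', h3, -Set.mem_Ioi, -Set.mem_Iic, -Set.mem_Ioc]
    · have h3 : r ∉ Set.Ioc (0 : ℝ) 1 := fun h3 => h' h3.2
      simp [h, h', h3, -Set.mem_Ioi, -Set.mem_Iic, -Set.mem_Ioc]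
    · have h3 : r ∉ Set.Ioc (0 : ℝ) 1 := fun h3 => h h3.1
      simp [h, h3, -Set.mem_Ioi, -Set.mem_Iic, -Set.mem_Ioc]
    · have h3 : r ∉ Set.Ioc (0 : ℝ) 1 := fun h3 => h h3.1
      simp [h, h3, -Set.mem_Ioi, -Set.mem_Iic, -Set.mem_Ioc]
  rw [h2, measureReal_def, Complex.volume_ball]
  simp [mul_assoc]

/-- Induction on `w`: integrating the derivative of `r ^ (2m+2) (1 - r²) ^ (w+1)`, which vanishes at
both ends, gives the recursion. -/
theorem integral_beta (m w : ℕ) : ∫ r in (0 : ℝ)..1, r ^ (2 * m + 1) * (1 - r ^ 2) ^ w =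
    (m.factorial * w.factorial : ℝ) / (2 * (m + w + 1).factorial) := by
  induction w with
  | zero =>
    simp only [pow_zero, mul_one, integral_pow, Nat.factorial_succ, Nat.factorial_zero, add_zero]
    have := (Nat.cast_ne_zero (R := ℝ)).2 m.factorial_ne_zero
    push_cast
    field_simp
    norm_num
    ring
  | succ w ih =>
    have hi : ∀ a b : ℕ, IntervalIntegrable (fun r : ℝ => r ^ a * (1 - r ^ 2) ^ b) volume 0 1 :=
      fun a b => (by fun_prop : Continuous fun r : ℝ => r ^ a * (1 - r ^ 2) ^ b).intervalIntegrable
        _ _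
    have h1 : ∫ r in (0 : ℝ)..1, ((2 * m + 2) * (r ^ (2 * m + 1) * (1 - r ^ 2) ^ (w + 1)) -
        2 * (w + 1) * (r ^ (2 * m + 1 + 2) * (1 - r ^ 2) ^ w)) = 0 := by
      have hd : ∀ r ∈ Set.uIcc (0 : ℝ) 1, HasDerivAt
          (fun r : ℝ => r ^ (2 * m + 2) * (1 - r ^ 2) ^ (w + 1))
          ((2 * m + 2) * (r ^ (2 * m + 1) * (1 - r ^ 2) ^ (w + 1)) -
            2 * (w + 1) * (r ^ (2 * m + 1 + 2) * (1 - r ^ 2) ^ w)) r := by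
        intro r _
        have := (hasDerivAt_pow (2 * m + 2) r).mul
          (((hasDerivAt_pow 2 r).const_sub 1).pow (w + 1))
        refine HasDerivAt.congr_deriv this ?_
        simp only [Pi.pow_apply]
        rw [show 2 * m + 2 - 1 = 2 * m + 1 by omega, Nat.add_sub_cancel]
        push_cast
        ring
      rw [intervalIntegral.integral_eq_sub_of_hasDerivAt hd]
      · simp
      · exact ((hi _ _).const_mul _).sub ((hi _ _).const_mul _)
    rw [intervalIntegral.integral_sub ((hi _ _).const_mul _) ((hi _ _).const_mul _),
      intervalIntegral.integral_const_mul, intervalIntegral.integral_const_mul] at h1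
    have h2 : ∫ r in (0 : ℝ)..1, r ^ (2 * m + 1) * (1 - r ^ 2) ^ (w + 1) =
        (∫ r in (0 : ℝ)..1, r ^ (2 * m + 1) * (1 - r ^ 2) ^ w) -
          ∫ r in (0 : ℝ)..1, r ^ (2 * m + 1 + 2) * (1 - r ^ 2) ^ w := by
      rw [← intervalIntegral.integral_sub (hi _ _) (hi _ _)]
      congr 1
      ext r
      ring
    rw [ih] at h2
    have h3 : (m + w + 2 : ℝ) * ∫ r in (0 : ℝ)..1, r ^ (2 * m + 1) * (1 - r ^ 2) ^ (w + 1) =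
        (w + 1) * ((m.factorial * w.factorial : ℝ) / (2 * (m + w + 1).factorial)) := by
      linear_combination (1 / 2 : ℝ) * h1 + (w + 1 : ℝ) * h2
    have h4 : (m + w + 2 : ℝ) ≠ 0 := by positivity
    have h5 := (Nat.cast_ne_zero (R := ℝ)).2 (m + w + 1).factorial_ne_zero
    rw [← mul_right_inj' h4, h3, ← add_assoc, Nat.factorial_succ (m + w + 1),
      Nat.factorial_succ w]
    push_cast
    field_simp
    ring

theorem integral_disk_moment (m w : ℕ) :
    ∫ u in Metric.closedBall (0 : ℂ) 1, (‖u‖ ^ 2) ^ m * (1 - ‖u‖ ^ 2) ^ w =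
      Real.pi * (m.factorial * w.factorial) / (m + w + 1).factorial := by
  rw [integral_disk_radial (fun r => (r ^ 2) ^ m * (1 - r ^ 2) ^ w)]
  have : ∀ r : ℝ, r * ((r ^ 2) ^ m * (1 - r ^ 2) ^ w) =
      r ^ (2 * m + 1) * (1 - r ^ 2) ^ w := by intro r; ring
  simp only [this, integral_beta]
  have h5 := (Nat.cast_ne_zero (R := ℝ)).2 (m + w + 1).factorial_ne_zero
  field_simp

/-! ### Orthogonal decompositions `ℂ^d = ℂ e ⊕ ℂⁿ` -/

/-- A unit vector `e` and an orthonormal basis `v` of its orthogonal complement. -/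
structure IsFrame {d n : ℕ} (e : E d) (v : Fin n → E d) : Prop where
  norm_eq : ‖e‖ = 1
  orthonormal : Orthonormal ℂ v
  inner_eq : ∀ r, inner ℂ e (v r) = 0
  dim_eq : d = n + 1

/-- The vector with coordinates `w` in the system `v`. -/
def emb {d n : ℕ} (v : Fin n → E d) (w : E n) : E d := ∑ r, w r • v r

namespace IsFrame

variable {d n : ℕ} {e : E d} {v : Fin n → E d}

theorem inner_self (h : IsFrame e v) : inner ℂ e e = (1 : ℂ) := by
  rw [inner_self_eq_norm_sq_to_K (𝕜 := ℂ), h.norm_eq]; simp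

theorem inner_eq' (h : IsFrame e v) (r : Fin n) : inner ℂ (v r) e = (0 : ℂ) :=
  inner_eq_zero_symm.1 (h.inner_eq r)

theorem exists_basis (h : IsFrame e v) : ∃ b : OrthonormalBasis (Option (Fin n)) ℂ (E d),
    b none = e ∧ ∀ r, b (some r) = v r := by
  let f : Option (Fin n) → E d := fun o => o.elim e v
  have hf : Orthonormal ℂ f := by
    rw [orthonormal_iff_ite]
    rintro (_ | r) (_ | s)
    · simpa [f] using h.inner_self
    · simpa [f] using h.inner_eq s
    · simpa [f] using h.inner_eq' r
    · have := orthonormal_iff_ite.1 h.orthonormal r s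
      simpa [f] using this
  obtain ⟨b, hb⟩ := Orthonormal.exists_orthonormalBasis_extension_of_card_eq (𝕜 := ℂ)
    (ι := Option (Fin n)) (v := f) (s := Set.univ) (by simp [h.dim_eq])
    (hf.comp _ Subtype.val_injective)
  exact ⟨b, hb none trivial, fun r => hb (some r) trivial⟩

theorem eq_add (h : IsFrame e v) (x : E d) :
    x = inner ℂ e x • e + emb v (coord v x) := by
  obtain ⟨b, h0, h1⟩ := h.exists_basis
  conv_lhs => rw [← b.sum_repr' x]
  simp [Fintype.sum_option, h0, h1, emb, coord]

theorem inner_eq_add (h : IsFrame e v) (x y : E d) : inner ℂ x y =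
    (starRingEnd ℂ) (inner ℂ e x) * inner ℂ e y + inner ℂ (coord v x) (coord v y) := by
  obtain ⟨b, h0, h1⟩ := h.exists_basis
  rw [← b.sum_inner_mul_inner x y, inner_eq_sum (coord v x), Fintype.sum_option, h0]
  simp [h1, coord]

theorem norm_sq_eq (h : IsFrame e v) (x : E d) :
    ‖x‖ ^ 2 = ‖(inner ℂ e x : ℂ)‖ ^ 2 + ‖coord v x‖ ^ 2 := by
  have := h.inner_eq_add x x
  rw [inner_self_eq_norm_sq_to_K (𝕜 := ℂ), inner_self_eq_norm_sq_to_K (𝕜 := ℂ),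
    Complex.conj_mul'] at this
  apply Complex.ofReal_injective
  push_cast
  exact this

theorem inner_add_emb (h : IsFrame e v) (c : ℂ) (w : E n) :
    inner ℂ e (c • e + emb v w) = c := by
  rw [inner_add_right, inner_smul_right, h.inner_self, emb, inner_sum]
  simp [inner_smul_right, h.inner_eq]

theorem coord_add_emb (h : IsFrame e v) (c : ℂ) (w : E n) :
    coord v (c • e + emb v w) = w := by
  ext r
  simp only [coord, emb, inner_add_right, inner_smul_right, inner_sum, h.inner_eq',
    orthonormal_iff_ite.1 h.orthonormal]
  simp

theorem norm_coord_sq (h : IsFrame e v) (x : Om d) :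
    ‖coord v (x : E d)‖ ^ 2 = 1 - ‖(inner ℂ e (x : E d) : ℂ)‖ ^ 2 := by
  have := h.norm_sq_eq x
  rw [norm_eq_of_mem_sphere x] at this
  linarith

end IsFrame

/-! ### The weight on the disk -/

theorem integrableOn_disk {F : Type*} [NormedAddCommGroup F] {f : ℂ → F} (hf : Continuous f) :
    IntegrableOn f (Metric.closedBall (0 : ℂ) 1) :=
  hf.continuousOn.integrableOn_compact (isCompact_closedBall 0 1)

/-- Integration of radial polynomials over the disk with the weight `(1 - |u|²)^w`. -/
def diskInt (w : ℕ) : ℝ[X] →ₗ[ℝ] ℝ where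
  toFun f := ∫ u in Metric.closedBall (0 : ℂ) 1, f.eval (‖u‖ ^ 2) * (1 - ‖u‖ ^ 2) ^ w
  map_add' f g := by
    simp only [eval_add, add_mul]
    exact integral_add (integrableOn_disk (by fun_prop)) (integrableOn_disk (by fun_prop))
  map_smul' c f := by
    simp only [eval_smul, smul_eq_mul, mul_assoc, RingHom.id_apply]
    exact integral_const_mul c _

theorem diskInt_apply (w : ℕ) (f : ℝ[X]) :
    diskInt w f = ∫ u in Metric.closedBall (0 : ℂ) 1, f.eval (‖u‖ ^ 2) * (1 - ‖u‖ ^ 2) ^ w := rfl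

theorem diskInt_X_pow (w m : ℕ) :
    diskInt w (X ^ m) = Real.pi * (m.factorial * w.factorial) / (m + w + 1).factorial := by
  rw [diskInt_apply, ← integral_disk_moment]
  simp

theorem diskFun_mul_conj (p q : ℕ) (f g : ℝ[X]) (u : ℂ) :
    diskFun p q f u * (starRingEnd ℂ) (diskFun p q g u) =
      (((X ^ (p + q) * (f * g)).eval (‖u‖ ^ 2) : ℝ) : ℂ) := by
  simp only [diskFun, map_mul, map_pow, Complex.conj_conj, Complex.conj_ofReal, eval_mul, eval_pow,
    eval_X]
  have h : u * (starRingEnd ℂ) u = (‖u‖ : ℂ) ^ 2 := Complex.mul_conj' u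
  push_cast
  rw [← h]
  ring

theorem integral_diskFun_mul (w p q : ℕ) (f g : ℝ[X]) :
    ∫ u in Metric.closedBall (0 : ℂ) 1, diskFun p q f u * (starRingEnd ℂ) (diskFun p q g u) *
        (((1 - ‖u‖ ^ 2) ^ w : ℝ) : ℂ) = (diskInt w (X ^ (p + q) * (f * g)) : ℂ) := by
  rw [diskInt_apply, ← integral_complex_ofReal]
  simp only [diskFun_mul_conj]
  push_cast
  rfl

theorem integral_norm_diskFun_sq (w p q : ℕ) (f : ℝ[X]) :
    ∫ u in Metric.closedBall (0 : ℂ) 1, ‖diskFun p q f u‖ ^ 2 * (1 - ‖u‖ ^ 2) ^ w =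
      diskInt w (X ^ (p + q) * (f * f)) := by
  rw [diskInt_apply]
  congr 1
  ext u
  have h := diskFun_mul_conj p q f f u
  rw [Complex.mul_conj'] at h
  congr 1
  exact_mod_cast h

/-- All the disk functions share the factor `u^p ū^q`, so only its squared modulus enters: the
question becomes one about orthogonal polynomials in `t = |u|²` with the extra weight `t^(p+q)`. -/
theorem isDiskOrthogonal_iff {w p q : ℕ} {f : ℕ → ℝ[X]} : IsDiskOrthogonal w p q f ↔
    (∀ a, (f a).degree = a) ∧ ∀ a b, a ≠ b → diskInt w (X ^ (p + q) * (f a * f b)) = 0 := by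
  simp only [IsDiskOrthogonal, integral_diskFun_mul, Complex.ofReal_eq_zero]

theorem diskInt_sq_nonneg (w s : ℕ) (g : ℝ[X]) : 0 ≤ diskInt w (X ^ s * (g * g)) := by
  rw [diskInt_apply]
  refine setIntegral_nonneg Metric.isClosed_closedBall.measurableSet fun u hu => ?_
  have : ‖u‖ ≤ 1 := by simpa using hu
  have h1 : 0 ≤ 1 - ‖u‖ ^ 2 := by nlinarith [norm_nonneg u]
  simp only [eval_mul, eval_pow, eval_X]
  have := mul_self_nonneg (g.eval (‖u‖ ^ 2))
  positivity

/-- A continuous nonnegative integrand with zero integral vanishes on the open disk. The weights are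
nonzero for `0 < t < 1`, so `g` has infinitely many roots. -/
theorem eq_zero_of_diskInt_sq {w s : ℕ} {g : ℝ[X]} (h : diskInt w (X ^ s * (g * g)) = 0) :
    g = 0 := by
  rw [diskInt_apply, setIntegral_eq_zero_iff_of_nonneg_ae] at h
  rotate_left
  · refine (ae_restrict_iff' Metric.isClosed_closedBall.measurableSet).2
      (Filter.Eventually.of_forall fun u hu => ?_)
    have : ‖u‖ ≤ 1 := by simpa using hu
    have h1 : 0 ≤ 1 - ‖u‖ ^ 2 := by nlinarith [norm_nonneg u]
    simp only [eval_mul, eval_pow, eval_X, Pi.zero_apply]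
    have := mul_self_nonneg (g.eval (‖u‖ ^ 2))
    positivity
  · exact integrableOn_disk (by fun_prop)
  have h2 := ae_restrict_of_ae_restrict_of_subset
    (Metric.ball_subset_closedBall (x := (0 : ℂ)) (ε := 1)) h
  have h3 := Measure.eqOn_open_of_ae_eq h2 Metric.isOpen_ball (by fun_prop) (by fun_prop)
  refine Polynomial.eq_zero_of_infinite_isRoot g (Set.Infinite.mono ?_
    (Set.Ioo_infinite (zero_lt_one (α := ℝ))))
  intro t ht
  have ht0 : 0 < t := ht.1
  have h4 : ((Real.sqrt t : ℝ) : ℂ) ∈ Metric.ball (0 : ℂ) 1 := by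
    rw [mem_ball_zero_iff, Complex.norm_real, Real.norm_of_nonneg (Real.sqrt_nonneg t)]
    exact (Real.sqrt_lt' one_pos).2 (by simpa using ht.2)
  have h5 := h3 h4
  have h6 : ‖((Real.sqrt t : ℝ) : ℂ)‖ ^ 2 = t := by
    rw [Complex.norm_real, Real.norm_of_nonneg (Real.sqrt_nonneg t), Real.sq_sqrt ht0.le]
  simp only [h6, eval_mul, eval_pow, eval_X, Pi.zero_apply] at h5
  have h7 : (1 - t) ^ w ≠ 0 := pow_ne_zero _ (by linarith [ht.2])
  have h8 : t ^ s ≠ 0 := pow_ne_zero _ ht0.ne'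
  have h9 := ((mul_eq_zero.1 h5).resolve_right h7)
  exact mul_self_eq_zero.1 ((mul_eq_zero.1 h9).resolve_left h8)

section OrthogonalPolynomials

variable {w s : ℕ} {f : ℕ → ℝ[X]}

theorem exists_degree_sub_lt (hdeg : ∀ a, (f a).degree = a) {g : ℝ[X]} {a : ℕ}
    (hg : g.degree < (a + 1 : ℕ)) : ∃ c : ℝ, (g - c • f a).degree < a := by
  have h0 : (f a).coeff a ≠ 0 := by
    have := (f a).leadingCoeff_ne_zero.2 (fun h => by simpa [h] using hdeg a)
    rwa [leadingCoeff, natDegree_eq_of_degree_eq_some (hdeg a)] at this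
  refine ⟨g.coeff a / (f a).coeff a, (degree_lt_iff_coeff_zero _ _).2 fun m hm => ?_⟩
  rcases hm.eq_or_lt with rfl | hm
  · simp [h0]
  · have h1 : g.coeff m = 0 := (degree_lt_iff_coeff_zero _ _).1 hg m hm
    have h2 : (f a).coeff m = 0 := coeff_eq_zero_of_degree_lt (by
      rw [hdeg]; exact_mod_cast hm)
    simp [h1, h2]

/-- The `f b` with `b < a` span all polynomials of degree below `a`, by successive removal of
leading terms. -/
theorem diskInt_mul_eq_zero (hdeg : ∀ a, (f a).degree = a) {G : ℝ[X]} (a : ℕ)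
    (hG : ∀ b < a, diskInt w (X ^ s * (f b * G)) = 0) :
    ∀ g : ℝ[X], g.degree < a → diskInt w (X ^ s * (g * G)) = 0 := by
  induction a with
  | zero =>
    intro g hg
    have : g = 0 := by
      by_contra h
      rw [degree_eq_natDegree h] at hg
      exact absurd hg (by simp)
    simp [this]
  | succ a ih =>
    intro g hg
    obtain ⟨c, hc⟩ := exists_degree_sub_lt hdeg hg
    have h1 := ih (fun b hb => hG b (by omega)) _ hc
    have h2 : X ^ s * (g * G) = X ^ s * ((g - c • f a) * G) + c • (X ^ s * (f a * G)) := by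
      simp only [smul_eq_C_mul]; ring
    rw [h2, map_add, map_smul, h1, hG a (by omega), smul_zero, add_zero]

/-- Disk polynomials are determined up to scalars by orthogonality. -/
theorem exists_eq_smul_of_diskInt (hdeg : ∀ a, (f a).degree = a)
    (horth : ∀ a b, a ≠ b → diskInt w (X ^ s * (f a * f b)) = 0) {g : ℝ[X]} {a : ℕ}
    (hg : g.degree < (a + 1 : ℕ)) (hg' : ∀ b < a, diskInt w (X ^ s * (f b * g)) = 0) :
    ∃ c : ℝ, g = c • f a := by
  -- After cancelling the top coefficient, the difference has degree below `a` and is orthogonal to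
  -- all such polynomials, in particular to itself.
  obtain ⟨c, hc⟩ := exists_degree_sub_lt hdeg hg
  refine ⟨c, sub_eq_zero.1 (eq_zero_of_diskInt_sq (w := w) (s := s) ?_)⟩
  refine diskInt_mul_eq_zero hdeg a (fun b hb => ?_) _ hc
  have h2 : X ^ s * (f b * (g - c • f a)) = X ^ s * (f b * g) - c • (X ^ s * (f b * f a)) := by
    simp only [smul_eq_C_mul]; ring
  rw [h2, map_sub, map_smul, hg' b hb, horth b a (by omega), smul_zero, sub_zero]

end OrthogonalPolynomials

/-! ### Products of disk functions and harmonic polynomials -/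

/-- The function `x ↦ u^p ū^q f(|u|²) h(x')`, where `u` and `x'` are the coordinates of `x`. -/
def diskTensor {d n : ℕ} (e : E d) (v : Fin n → E d) (p q : ℕ) (f : ℝ[X]) (h : Poly n) :
    Om d → ℂ :=
  fun x => diskFun p q f (inner ℂ e (x : E d)) * evalAt (coord v (x : E d)) h

section Tensor

variable {d n : ℕ} {e : E d} {v : Fin n → E d} {p q i j : ℕ}

theorem continuous_coord (v : Fin n → E d) : Continuous (coord v) := by
  unfold coord; fun_prop

/-- For `f = t^m` the integrand is the restriction of a polynomial whose Gaussian expectation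
factors. The resulting quotient of factorials is a beta moment with weight exponent `N + (n - 1)`:
the bidegree of `H` supplies the `N`, since `H` is evaluated at the unnormalized `x'`. -/
theorem integral_radial_mul (hF : IsFrame e v) (hn : 0 < n) {N : ℕ} {H : Poly n}
    (hH : H ∈ homPoly n N N) (f : ℝ[X]) :
    ∫ x : Om d, ((f.eval (‖(inner ℂ e (x : E d) : ℂ)‖ ^ 2) : ℝ) : ℂ) *
      evalAt (coord v (x : E d)) H ∂sphereMeasure d =
    ((n / Real.pi * diskInt (N + (n - 1)) f : ℝ) : ℂ) * sphInt n H := by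
  have hint : ∀ f : ℝ[X], Integrable (fun x : Om d =>
      ((f.eval (‖(inner ℂ e (x : E d) : ℂ)‖ ^ 2) : ℝ) : ℂ) *
      evalAt (coord v (x : E d)) H) (sphereMeasure d) := by
    intro f
    refine integrable_sphere (Continuous.mul ?_ ?_)
    · exact Complex.continuous_ofReal.comp (by fun_prop)
    · exact (continuous_evalAt H).comp ((continuous_coord v).comp continuous_subtype_val)
  induction f using Polynomial.induction_on' with
  | add f g hf hg =>
    have : ∀ x : Om d, (((f + g).eval (‖(inner ℂ e (x : E d) : ℂ)‖ ^ 2) : ℝ) : ℂ) *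
      evalAt (coord v (x : E d)) H = ((f.eval (‖(inner ℂ e (x : E d) : ℂ)‖ ^ 2) : ℝ) : ℂ) *
      evalAt (coord v (x : E d)) H + ((g.eval (‖(inner ℂ e (x : E d) : ℂ)‖ ^ 2) : ℝ) : ℂ) *
      evalAt (coord v (x : E d)) H := by
      intro x; rw [eval_add]; push_cast; ring
    simp only [this]
    rw [integral_add (hint f) (hint g), hf, hg, map_add]
    push_cast
    ring
  | monomial m c =>
    have h1 : ∀ x : Om d, (((monomial m c).eval (‖(inner ℂ e (x : E d) : ℂ)‖ ^ 2) : ℝ) : ℂ) *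
        evalAt (coord v (x : E d)) H =
        (c : ℂ) * toFun d (lin e ^ m * linc e ^ m * pull v H) x := by
      intro x
      simp only [toFun_apply, map_mul, map_pow, evalAt_lin, evalAt_linc, evalAt_pull, eval_monomial]
      rw [← mul_pow, ← inner_conj_symm (x : E d) e, Complex.mul_conj']
      push_cast
      ring
    simp only [h1]
    rw [integral_const_mul, ← sphInt_apply]
    have hmem : lin e ^ m * linc e ^ m * pull v H ∈ homPoly d (m + N) (m + N) :=
      mul_mem_homPoly (lin_pow_mul_linc_pow_mem e m m) (pull_mem_homPoly v hH)
    have hd : 0 < d := by rw [hF.dim_eq]; omega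
    rw [sphInt_eq_gauss hd hmem, sphInt_eq_gauss hn hH,
      gauss_lin_pow_mul_pull hF.norm_eq hF.inner_eq, gauss_pull hF.orthonormal _ _ _ rfl _ hH]
    have e1 : monomial m c = c • X ^ m := by rw [smul_X_eq_monomial]
    rw [e1, map_smul, diskInt_X_pow]
    obtain ⟨n, rfl⟩ : ∃ n', n = n' + 1 := ⟨n - 1, by omega⟩
    have hd' : d - 1 = n + 1 := by rw [hF.dim_eq]; omega
    have e2 : n + 1 - 1 = n := by omega
    have e3 : m + (N + n) + 1 = n + 1 + (m + N) := by omega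
    rw [hd', e2, e3, add_comm N n, Nat.factorial_succ n]
    have h3 : ∀ a : ℕ, ((a.factorial : ℕ) : ℂ) ≠ 0 := fun a =>
      Nat.cast_ne_zero.2 a.factorial_ne_zero
    have h4 := h3 n
    have h5 := h3 (n + 1 + (m + N))
    have h6 := h3 (n + N)
    have h7 : (Real.pi : ℂ) ≠ 0 := by exact_mod_cast Real.pi_ne_zero
    push_cast
    simp only [smul_eq_mul, Complex.ofReal_mul, Complex.ofReal_div, Complex.ofReal_natCast]
    field_simp

theorem ip_diskTensor (hF : IsFrame e v) (hn : 0 < n) {h h' : Poly n} (hh : h ∈ homPoly n i j)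
    (hh' : h' ∈ homPoly n i j) (f g : ℝ[X]) :
    ip (diskTensor e v p q f h) (diskTensor e v p q g h') =
      ((n / Real.pi * diskInt (i + j + (n - 1)) (X ^ (p + q) * (f * g)) : ℝ) : ℂ) *
        ip (toFun n h) (toFun n h') := by
  have hH : cj h * h' ∈ homPoly n (i + j) (i + j) := by
    have := mul_mem_homPoly (cj_mem_homPoly hh) hh'
    rwa [add_comm j i] at this
  rw [ip_toFun, ← integral_radial_mul hF hn hH, ip]
  congr 1
  ext x
  rw [mul_comm f g, ← diskFun_mul_conj]
  simp only [diskTensor, map_mul, evalAt_cj]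
  ring

end Tensor

/-! ### The inner product on functions on the sphere -/

section InnerProduct

variable {n : ℕ} {i j k l : ℕ}

instance (n : ℕ) : (sphereMeasure n).IsOpenPosMeasure := by
  rw [sphereMeasure]
  exact Measure.isOpenPosMeasure_smul _ (ENNReal.inv_ne_zero.2 (measure_ne_top _ _))

theorem ip_self_eq (f : Om n → ℂ) : ip f f = ((∫ z, ‖f z‖ ^ 2 ∂sphereMeasure n : ℝ) : ℂ) := by
  rw [ip, ← integral_complex_ofReal]
  simp only [Complex.conj_mul']
  push_cast
  rfl

theorem eq_zero_of_ip_self {f : Om n → ℂ} (hf : Continuous f) (h : ip f f = 0) : f = 0 := by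
  rw [ip_self_eq, Complex.ofReal_eq_zero, integral_eq_zero_iff_of_nonneg
    (fun z => by positivity)] at h
  · have := (Continuous.ae_eq_iff_eq (sphereMeasure n) (by fun_prop) (by fun_prop)).1 h
    ext z
    simpa using congrFun this z
  · refine Continuous.integrable_of_hasCompactSupport (by fun_prop)
      (HasCompactSupport.of_compactSpace _)

theorem ip_conj_symm (f g : Om n → ℂ) : (starRingEnd ℂ) (ip f g) = ip g f := by
  rw [ip, ip, ← integral_conj]
  simp [mul_comm]

theorem ip_smul_left (c : ℂ) (f g : Om n → ℂ) : ip (c • f) g = (starRingEnd ℂ) c * ip f g := by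
  rw [ip, ip, ← integral_const_mul]
  simp [mul_assoc]

theorem ip_smul_right (c : ℂ) (f g : Om n → ℂ) : ip f (c • g) = c * ip f g := by
  rw [ip, ip, ← integral_const_mul]
  congr 1; ext z
  simp; ring

theorem ip_add_right {f g g' : Om n → ℂ} (hf : Continuous f) (hg : Continuous g)
    (hg' : Continuous g') : ip f (g + g') = ip f g + ip f g' := by
  rw [ip, ip, ip, ← integral_add]
  · congr 1; ext z; simp; ring
  · exact integrable_sphere ((Complex.continuous_conj.comp hf).mul hg)
  · exact integrable_sphere ((Complex.continuous_conj.comp hf).mul hg')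

theorem ip_sum_right {ι : Type*} (s : Finset ι) {f : Om n → ℂ} {g : ι → Om n → ℂ}
    (hf : Continuous f) (hg : ∀ x, Continuous (g x)) :
    ip f (∑ x ∈ s, g x) = ∑ x ∈ s, ip f (g x) := by
  classical
  induction s using Finset.induction_on with
  | empty => simp [ip]
  | insert x s hx ih =>
    rw [Finset.sum_insert hx, Finset.sum_insert hx, ip_add_right hf (hg x), ih]
    simpa only [Finset.sum_fn] using continuous_finsetSum s fun y _ => hg y

/-- Harmonic polynomials are orthogonal on the sphere to all polynomials of lower degree. -/
theorem ip_harmonic_eq_zero (hn : 0 < n) {P Q : Poly n} (hP : P ∈ homPoly n i j)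
    (hQ : Q ∈ homPoly n k l) (hΔ : laplace n Q = 0) (h : i + j < k + l) :
    ip (toFun n P) (toFun n Q) = 0 := by
  rw [ip_toFun, sphInt_eq_gauss hn (mul_mem_homPoly (cj_mem_homPoly hP) hQ),
    gauss_mul_harmonic _ _ _ rfl _ (cj_mem_homPoly hP) _ _ _ hQ hΔ (by omega), mul_zero]

theorem ip_eq_zero_of_ne (hn : 0 < n) {P Q : Poly n} (hP : P ∈ homPoly n i j)
    (hQ : Q ∈ homPoly n k l) (h : j + k ≠ i + l) : ip (toFun n P) (toFun n Q) = 0 := by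
  have := mul_mem_homPoly (cj_mem_homPoly hP) hQ
  rw [ip_toFun, sphInt_eq_gauss hn this, gauss_eq_zero_of_ne this h, mul_zero]

end InnerProduct

/-! ### Harmonic polynomials of the form `P_a(u) h(x')` -/

/-- Up to signs, the coefficients of a disk polynomial. -/
def radialCoeff (p q a N n m : ℕ) : ℝ :=
  ∏ t ∈ Finset.range m, (((p + (a - t) : ℕ) : ℝ) * ((q + (a - t) : ℕ) : ℝ)) /
    (((t + 1 : ℕ) : ℝ) * ((t + N + n : ℕ) : ℝ))

/-- The disk polynomials, as polynomials in `|u|²`. -/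
def radialPoly (p q a N n : ℕ) : ℝ[X] :=
  ∑ m ∈ Finset.range (a + 1),
    ((-1) ^ m * radialCoeff p q a N n m) • (X ^ (a - m) * (1 - X) ^ m)

/-- The harmonic polynomial which restricts to `P_a(u) h(x')` on the sphere. -/
def harmPoly {d n : ℕ} (e : E d) (v : Fin n → E d) (p q a N : ℕ) (h : Poly n) : Poly d :=
  ∑ m ∈ Finset.range (a + 1), (((-1) ^ m * radialCoeff p q a N n m : ℝ) : ℂ) •
    (lin e ^ (p + (a - m)) * linc e ^ (q + (a - m)) * pull v (rho n ^ m * h))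

theorem radialCoeff_nonneg (p q a N n m : ℕ) : 0 ≤ radialCoeff p q a N n m :=
  Finset.prod_nonneg fun t _ => by positivity

theorem coeff_X_pow_mul_one_sub_pow {a m : ℕ} (h : m ≤ a) :
    (X ^ (a - m) * (1 - X) ^ m : ℝ[X]).coeff a = (-1) ^ m := by
  have h1 : (1 - X : ℝ[X]) ^ m = C ((-1) ^ m) * (X - C 1) ^ m := by
    rw [map_pow, ← mul_pow]; congr 1; simp
  have h2 : (X ^ (a - m) * (1 - X) ^ m : ℝ[X]).coeff (m + (a - m)) = (-1) ^ m := by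
    rw [mul_comm, coeff_mul_X_pow, h1, coeff_C_mul]
    have := (monic_X_sub_C (1 : ℝ)).pow m
    have hd : ((X - C (1 : ℝ)) ^ m).natDegree = m := by rw [natDegree_pow, natDegree_X_sub_C, mul_one]
    have hc := this.coeff_natDegree
    rw [hd] at hc
    rw [hc, mul_one]
  rwa [Nat.add_sub_cancel' h] at h2

theorem natDegree_X_pow_mul_one_sub_pow_le {a m : ℕ} (h : m ≤ a) :
    (X ^ (a - m) * (1 - X) ^ m : ℝ[X]).natDegree ≤ a := by
  have h1 : (1 - X : ℝ[X]).natDegree ≤ 1 := by compute_degree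
  have h2 : ((1 - X : ℝ[X]) ^ m).natDegree ≤ m := by
    simpa using natDegree_pow_le_of_le m h1
  have h3 : (X ^ (a - m) : ℝ[X]).natDegree ≤ a - m := natDegree_X_pow_le _
  exact (natDegree_mul_le_of_le h3 h2).trans (by omega)

/-- The sign of each coefficient cancels the sign of the leading coefficient of `X ^ (a - m) * (1 -
X) ^ m`. The top coefficient is therefore a sum of nonnegative numbers, the one for `m = 0` being
`1`. -/
theorem degree_radialPoly (p q a N n : ℕ) : (radialPoly p q a N n).degree = a := by
  refine le_antisymm ?_ (le_degree_of_ne_zero ?_)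
  · rw [radialPoly]
    refine (degree_sum_le _ _).trans (Finset.sup_le fun m hm => ?_)
    rw [Finset.mem_range] at hm
    exact (degree_smul_le _ _).trans (degree_le_of_natDegree_le
      (natDegree_X_pow_mul_one_sub_pow_le (by omega)))
  · have h : (radialPoly p q a N n).coeff a =
        ∑ m ∈ Finset.range (a + 1), radialCoeff p q a N n m := by
      rw [radialPoly, finsetSum_coeff]
      refine Finset.sum_congr rfl fun m hm => ?_
      rw [Finset.mem_range] at hm
      rw [coeff_smul, coeff_X_pow_mul_one_sub_pow (by omega), smul_eq_mul, mul_right_comm,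
        ← mul_pow]
      simp
    rw [h, Finset.sum_range_succ']
    have h0 : radialCoeff p q a N n 0 = 1 := by simp [radialCoeff]
    rw [h0]
    have := Finset.sum_nonneg (s := Finset.range a)
      fun m _ => radialCoeff_nonneg p q a N n (m + 1)
    positivity

section HarmPoly

variable {d n : ℕ} {e : E d} {v : Fin n → E d} {p q i j : ℕ} {h : Poly n}

theorem harmPoly_mem (a : ℕ) (hh : h ∈ homPoly n i j) :
    harmPoly e v p q a (i + j) h ∈ homPoly d (p + i + a) (q + j + a) := by
  refine Submodule.sum_mem _ fun m hm => Submodule.smul_mem _ _ ?_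
  rw [Finset.mem_range] at hm
  have := mul_mem_homPoly (lin_pow_mul_linc_pow_mem e (p + (a - m)) (q + (a - m)))
    (pull_mem_homPoly v (rho_pow_mul_mem hh m))
  rwa [show p + (a - m) + (i + m) = p + i + a by omega,
    show q + (a - m) + (j + m) = q + j + a by omega] at this

/-- The Laplacian acts on the powers of `u, ū` and on the powers of `|x'|²` separately. The
recursion of `radialCoeff` cancels neighbouring terms, and the term left over at `m = a` carries the
factor `p q = 0`. -/
theorem laplace_harmPoly (hF : IsFrame e v) (hn : 0 < n) (hpq : p = 0 ∨ q = 0) (a : ℕ)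
    (hh : h ∈ homPoly n i j) (hΔ : laplace n h = 0) :
    laplace d (harmPoly e v p q a (i + j) h) = 0 := by
  rw [harmPoly, map_sum]
  have key : ∀ m ∈ Finset.range (a + 1),
      laplace d ((((-1) ^ m * radialCoeff p q a (i + j) n m : ℝ) : ℂ) •
        (lin e ^ (p + (a - m)) * linc e ^ (q + (a - m)) * pull v (rho n ^ m * h))) =
      ((((-1) ^ m * radialCoeff p q a (i + j) n m : ℝ) : ℂ) * (m * (m + n + i + j - 1))) •
        (lin e ^ (p + (a - m)) * linc e ^ (q + (a - m)) * pull v (rho n ^ (m - 1) * h)) +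
      ((((-1) ^ m * radialCoeff p q a (i + j) n m : ℝ) : ℂ) *
        (((p + (a - m) : ℕ) : ℂ) * ((q + (a - m) : ℕ) : ℂ))) •
        (lin e ^ (p + (a - m) - 1) * linc e ^ (q + (a - m) - 1) * pull v (rho n ^ m * h)) := by
    intro m _
    rw [map_smul, laplace_lin_pow_mul_pull hF.norm_eq hF.orthonormal hF.inner_eq,
      laplace_rho_pow_mul hh, hΔ, mul_zero, add_zero, map_smul, mul_smul_comm, smul_add, smul_smul,
      smul_smul, add_comm]
  rw [Finset.sum_congr rfl key, Finset.sum_add_distrib, Finset.sum_range_succ',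
    Finset.sum_range_succ]
  have hz : ((p + (a - a) : ℕ) : ℂ) * ((q + (a - a) : ℕ) : ℂ) = 0 := by
    rcases hpq with h | h <;> simp [h]
  rw [hz]
  simp only [Nat.cast_zero, zero_mul, mul_zero, zero_smul, add_zero]
  rw [← Finset.sum_add_distrib]
  refine Finset.sum_eq_zero fun m hm => ?_
  rw [Finset.mem_range] at hm
  rw [Nat.add_sub_cancel, show p + (a - m) - 1 = p + (a - (m + 1)) by omega,
    show q + (a - m) - 1 = q + (a - (m + 1)) by omega, ← add_smul]
  convert zero_smul ℂ _
  have hc : radialCoeff p q a (i + j) n (m + 1) * (((m + 1 : ℕ) : ℝ) * ((m + (i + j) + n : ℕ) : ℝ))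
      = radialCoeff p q a (i + j) n m * (((p + (a - m) : ℕ) : ℝ) * ((q + (a - m) : ℕ) : ℝ)) := by
    have h1 : ((m + (i + j) + n : ℕ) : ℝ) ≠ 0 := Nat.cast_ne_zero.2 (by omega)
    have h2 : ((m + 1 : ℕ) : ℝ) ≠ 0 := Nat.cast_ne_zero.2 (by omega)
    rw [radialCoeff, Finset.prod_range_succ, ← radialCoeff]
    field_simp
  have hc' := congrArg (fun x : ℝ => (x : ℂ)) hc
  push_cast at hc' ⊢
  rw [pow_succ]
  linear_combination (-(-1) ^ m : ℂ) * hc'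

theorem toFun_harmPoly (hF : IsFrame e v) (a N : ℕ) :
    toFun d (harmPoly e v p q a N h) = diskTensor e v p q (radialPoly p q a N n) h := by
  ext x
  simp only [harmPoly, radialPoly, toFun_apply, diskTensor, diskFun, map_sum, map_smul, map_mul,
    map_pow, evalAt_lin, evalAt_linc, evalAt_pull, evalAt_rho, eval_finsetSum, eval_smul,
    eval_mul, eval_pow, eval_X, eval_sub, eval_one, Complex.ofReal_sum, smul_eq_mul,
    Finset.mul_sum, Finset.sum_mul]
  refine Finset.sum_congr rfl fun m _ => ?_
  -- On the sphere `|x'|² = 1 - |u|²`, which is where the powers of `1 - X` in `radialPoly` come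
  -- from.
  have h1 : (‖coord v (x : E d)‖ : ℂ) ^ 2 = 1 - (‖(inner ℂ e (x : E d) : ℂ)‖ : ℂ) ^ 2 := by
    exact_mod_cast congrArg (fun t : ℝ => (t : ℂ)) (hF.norm_coord_sq x)
  rw [h1, ← inner_conj_symm (x : E d) e]
  have h2 := Complex.mul_conj' (inner ℂ e (x : E d))
  push_cast
  rw [← h2]
  ring

theorem ip_lin_pow_ne_zero {w : E n} (hn : 0 < n) (hw : ‖w‖ = 1) (N : ℕ) :
    ip (toFun n (lin w ^ N)) (toFun n (lin w ^ N)) ≠ 0 := by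
  have h1 : lin w ^ N ∈ homPoly n N 0 := by
    simpa using lin_pow_mul_linc_pow_mem w N 0
  have h2 := gauss_lin_pow_mul_pull (v := (Fin.elim0 : Fin 0 → E n)) hw (fun r => r.elim0) N 1
  have h3 : gauss n (1 : Poly n) = 1 := by simpa using gauss_C (n := n) 1
  rw [map_one, mul_one, h3, mul_one, mul_comm] at h2
  rw [ip_toFun, sphInt_eq_gauss hn (mul_mem_homPoly (cj_mem_homPoly h1) h1), cj_pow, cj_lin, h2]
  have h4 : ∀ a : ℕ, ((a.factorial : ℕ) : ℂ) ≠ 0 := fun a => Nat.cast_ne_zero.2 a.factorial_ne_zero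
  exact mul_ne_zero (div_ne_zero (h4 _) (h4 _)) (h4 _)

/-- Orthogonality on the disk is read off from the sphere, where harmonic polynomials of different
total degree are orthogonal. As only `N = i + j` matters, the simplest harmonic `h`, a power of a
linear form of bidegree `(N, 0)`, serves as test function. -/
theorem isDiskOrthogonal_radialPoly (hF : IsFrame e v) (hn : 0 < n) (hpq : p = 0 ∨ q = 0) (N : ℕ) :
    IsDiskOrthogonal (N + (n - 1)) p q (fun a => radialPoly p q a N n) := by
  refine isDiskOrthogonal_iff.2 ⟨fun a => degree_radialPoly p q a N n, ?_⟩
  have key : ∀ a b, a < b → diskInt (N + (n - 1))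
      (X ^ (p + q) * (radialPoly p q a N n * radialPoly p q b N n)) = 0 := by
    intro a b hab
    let w : E n := EuclideanSpace.single (⟨0, hn⟩ : Fin n) 1
    have hw : ‖w‖ = 1 := by simp [w]
    have h1 : lin w ^ N ∈ homPoly n N 0 := by
      simpa using lin_pow_mul_linc_pow_mem w N 0
    have hΔ : laplace n (lin w ^ N) = 0 := by
      simpa using laplace_lin_pow w N 0
    have h2 := ip_diskTensor (p := p) (q := q) hF hn h1 h1 (radialPoly p q a N n)
      (radialPoly p q b N n)
    have hd : 0 < d := by rw [hF.dim_eq]; omega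
    have h3 := harmPoly_mem (e := e) (v := v) (p := p) (q := q) a h1
    have h4 := harmPoly_mem (e := e) (v := v) (p := p) (q := q) b h1
    have h5 := ip_harmonic_eq_zero hd h3 h4 (laplace_harmPoly hF hn hpq b h1 hΔ) (by omega)
    rw [toFun_harmPoly hF, toFun_harmPoly hF] at h5
    rw [add_zero] at h5 h2
    rw [h5, eq_comm, mul_eq_zero, or_iff_left (ip_lin_pow_ne_zero hn hw N),
      Complex.ofReal_eq_zero, mul_eq_zero] at h2
    refine h2.resolve_left (div_ne_zero (Nat.cast_ne_zero.2 (by omega)) Real.pi_ne_zero)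
  intro a b hab
  rcases lt_or_gt_of_ne hab with h | h
  · exact key a b h
  · rw [mul_comm (radialPoly p q a N n)]; exact key b a h

/-- For a system of disk polynomials, `P_a(u) h(x')` is harmonic if `h` is. -/
theorem exists_harmonic_toFun_eq_diskTensor (hF : IsFrame e v) (hn : 0 < n) (hpq : p = 0 ∨ q = 0)
    {f : ℕ → ℝ[X]} (hf : IsDiskOrthogonal (i + j + (n - 1)) p q f) (a : ℕ) : ∃ r : ℂ,
    ∀ h ∈ homPoly n i j, laplace n h = 0 →
      r • harmPoly e v p q a (i + j) h ∈ homPoly d (p + i + a) (q + j + a) ∧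
      laplace d (r • harmPoly e v p q a (i + j) h) = 0 ∧
      toFun d (r • harmPoly e v p q a (i + j) h) = diskTensor e v p q (f a) h := by
  have hr := isDiskOrthogonal_iff.1 (isDiskOrthogonal_radialPoly hF hn hpq (i + j))
  obtain ⟨hf1, hf2⟩ := isDiskOrthogonal_iff.1 hf
  -- Both systems are orthogonal for the same weight, so `f a` is a multiple of the explicit radial
  -- polynomial.
  obtain ⟨c, hc⟩ := exists_eq_smul_of_diskInt hr.1 hr.2 (g := f a) (a := a)
    (by rw [hf1]; exact_mod_cast Nat.lt_succ_self a) (fun b hb =>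
      diskInt_mul_eq_zero hf1 a (fun b hb => hf2 b a hb.ne) _ (by
        rw [degree_radialPoly]; exact_mod_cast hb))
  refine ⟨c, fun h hh hΔ => ⟨Submodule.smul_mem _ _ (harmPoly_mem a hh), ?_, ?_⟩⟩
  · rw [map_smul, laplace_harmPoly hF hn hpq a hh hΔ, smul_zero]
  · rw [map_smul, toFun_harmPoly hF, hc]
    ext x
    simp [diskTensor, diskFun]
    ring

end HarmPoly

/-! ### Expansion along a frame -/

/-- `P` has an expansion `∑ u^α ū^β R α β (x')` with `R α β` of bidegree `(k - α, l - β)`. -/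
def HasExpansion {d n : ℕ} (e : E d) (v : Fin n → E d) (k l : ℕ) (P : Poly d)
    (R : ℕ → ℕ → Poly n) : Prop :=
  (∀ α ≤ k, ∀ β ≤ l, R α β ∈ homPoly n (k - α) (l - β)) ∧
  (∀ α β, k < α ∨ l < β → R α β = 0) ∧
  ∀ (c : ℂ) (w : E n), evalAt (c • e + emb v w) P =
    ∑ α ∈ Finset.range (k + 1), ∑ β ∈ Finset.range (l + 1),
      c ^ α * (starRingEnd ℂ) c ^ β * evalAt w (R α β)

section Expansion

variable {d n : ℕ} {e : E d} {v : Fin n → E d} {k l : ℕ}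

theorem emb_apply (w : E n) (r : Fin d) : emb v w r = ∑ s, v s r * w s := by
  simp [emb, mul_comm]

/-- At `c e + ∑ w_s v_s` the `r`-th coordinate is `c e_r` plus a linear form in `w`: the first part
shifts the index `α`, the second raises the degree of the coefficient. -/
theorem HasExpansion.Z_mul {P : Poly d} {R : ℕ → ℕ → Poly n} (h : HasExpansion e v k l P R)
    (r : Fin d) : HasExpansion e v (k + 1) l (Z r * P) (fun α β =>
      (if α = 0 then 0 else MvPolynomial.C (e r) * R (α - 1) β) +
        (∑ s, MvPolynomial.C (v s r) * Z s) * R α β) := by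
  obtain ⟨h1, h2, h3⟩ := h
  have hlin : ∑ s, MvPolynomial.C (v s r) * Z s ∈ homPoly n 1 0 :=
    Submodule.sum_mem _ fun s _ => C_mul_mem_homPoly (Z_mem_homPoly s) _
  refine ⟨?_, ?_, ?_⟩
  · intro α hα β hβ
    refine Submodule.add_mem _ ?_ ?_
    · split_ifs with h0
      · exact Submodule.zero_mem _
      · have := C_mul_mem_homPoly (h1 (α - 1) (by omega) β hβ) (e r)
        rwa [show k - (α - 1) = k + 1 - α by omega] at this
    · by_cases h0 : α ≤ k
      · have := mul_mem_homPoly hlin (h1 α h0 β hβ)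
        rwa [show 1 + (k - α) = k + 1 - α by omega, zero_add] at this
      · rw [h2 α β (by omega), mul_zero]
        exact Submodule.zero_mem _
  · intro α β hαβ
    dsimp only
    rw [h2 α β (by omega), mul_zero, add_zero]
    split_ifs with h0
    · rfl
    · rw [h2 (α - 1) β (by omega), mul_zero]
  · intro c w
    have e1 : ∑ α ∈ Finset.range (k + 1 + 1), ∑ β ∈ Finset.range (l + 1),
        c ^ α * (starRingEnd ℂ) c ^ β *
          evalAt w (if α = 0 then 0 else MvPolynomial.C (e r) * R (α - 1) β) =
        c * e r * ∑ α ∈ Finset.range (k + 1), ∑ β ∈ Finset.range (l + 1),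
      c ^ α * (starRingEnd ℂ) c ^ β * evalAt w (R α β) := by
      rw [Finset.sum_range_succ']
      simp only [Finset.mul_sum, if_true, map_zero, mul_zero, Finset.sum_const_zero, add_zero]
      refine Finset.sum_congr rfl fun α _ => Finset.sum_congr rfl fun β _ => ?_
      simp
      ring
    have e2 : ∑ α ∈ Finset.range (k + 1 + 1), ∑ β ∈ Finset.range (l + 1),
        c ^ α * (starRingEnd ℂ) c ^ β *
          evalAt w ((∑ s, MvPolynomial.C (v s r) * Z s) * R α β) =
        emb v w r * ∑ α ∈ Finset.range (k + 1), ∑ β ∈ Finset.range (l + 1),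
      c ^ α * (starRingEnd ℂ) c ^ β * evalAt w (R α β) := by
      rw [Finset.sum_range_succ]
      simp only [h2 (k + 1) _ (Or.inl (Nat.lt_succ_self k)), mul_zero, map_zero,
        Finset.sum_const_zero, add_zero, Finset.mul_sum]
      refine Finset.sum_congr rfl fun α _ => Finset.sum_congr rfl fun β _ => ?_
      simp only [map_mul, map_sum, evalAt_C, evalAt_Z, emb_apply]
      ring
    rw [map_mul, evalAt_Z, h3]
    simp only [map_add, mul_add, Finset.sum_add_distrib]
    rw [e1, e2]
    simp only [PiLp.add_apply, PiLp.smul_apply, smul_eq_mul]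
    ring

theorem HasExpansion.Zc_mul {P : Poly d} {R : ℕ → ℕ → Poly n} (h : HasExpansion e v k l P R)
    (r : Fin d) : HasExpansion e v k (l + 1) (Zc r * P) (fun α β =>
      (if β = 0 then 0 else MvPolynomial.C ((starRingEnd ℂ) (e r)) * R α (β - 1)) +
        (∑ s, MvPolynomial.C ((starRingEnd ℂ) (v s r)) * Zc s) * R α β) := by
  obtain ⟨h1, h2, h3⟩ := h
  have hlin : ∑ s, MvPolynomial.C ((starRingEnd ℂ) (v s r)) * Zc s ∈ homPoly n 0 1 :=
    Submodule.sum_mem _ fun s _ => C_mul_mem_homPoly (Zc_mem_homPoly s) _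
  refine ⟨?_, ?_, ?_⟩
  · intro α hα β hβ
    refine Submodule.add_mem _ ?_ ?_
    · split_ifs with h0
      · exact Submodule.zero_mem _
      · have := C_mul_mem_homPoly (h1 α hα (β - 1) (by omega)) ((starRingEnd ℂ) (e r))
        rwa [show l - (β - 1) = l + 1 - β by omega] at this
    · by_cases h0 : β ≤ l
      · have := mul_mem_homPoly hlin (h1 α hα β h0)
        rwa [show 1 + (l - β) = l + 1 - β by omega, zero_add] at this
      · rw [h2 α β (by omega), mul_zero]
        exact Submodule.zero_mem _
  · intro α β hαβ
    dsimp only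
    rw [h2 α β (by omega), mul_zero, add_zero]
    split_ifs with h0
    · rfl
    · rw [h2 α (β - 1) (by omega), mul_zero]
  · intro c w
    have e1 : ∑ α ∈ Finset.range (k + 1), ∑ β ∈ Finset.range (l + 1 + 1),
        c ^ α * (starRingEnd ℂ) c ^ β *
          evalAt w (if β = 0 then 0 else MvPolynomial.C ((starRingEnd ℂ) (e r)) * R α (β - 1)) =
        (starRingEnd ℂ) (c * e r) * ∑ α ∈ Finset.range (k + 1), ∑ β ∈ Finset.range (l + 1),
      c ^ α * (starRingEnd ℂ) c ^ β * evalAt w (R α β) := by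
      rw [Finset.mul_sum]
      refine Finset.sum_congr rfl fun α _ => ?_
      rw [Finset.sum_range_succ']
      simp only [Finset.mul_sum, if_true, map_zero, mul_zero, add_zero]
      refine Finset.sum_congr rfl fun β _ => ?_
      simp
      ring
    have e2 : ∑ α ∈ Finset.range (k + 1), ∑ β ∈ Finset.range (l + 1 + 1),
        c ^ α * (starRingEnd ℂ) c ^ β *
          evalAt w ((∑ s, MvPolynomial.C ((starRingEnd ℂ) (v s r)) * Zc s) * R α β) =
        (starRingEnd ℂ) (emb v w r) * ∑ α ∈ Finset.range (k + 1), ∑ β ∈ Finset.range (l + 1),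
      c ^ α * (starRingEnd ℂ) c ^ β * evalAt w (R α β) := by
      rw [Finset.mul_sum]
      refine Finset.sum_congr rfl fun α _ => ?_
      rw [Finset.sum_range_succ]
      simp only [h2 _ (l + 1) (Or.inr (Nat.lt_succ_self l)), mul_zero, map_zero, add_zero,
        Finset.mul_sum]
      refine Finset.sum_congr rfl fun β _ => ?_
      simp only [map_mul, map_sum, evalAt_C, evalAt_Zc, emb_apply]
      ring
    rw [map_mul, evalAt_Zc, h3]
    simp only [map_add, mul_add, Finset.sum_add_distrib]
    rw [e1, e2]
    simp only [PiLp.add_apply, PiLp.smul_apply, smul_eq_mul, map_add]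
    ring

theorem exists_hasExpansion (e : E d) (v : Fin n → E d) {P : Poly d} (hP : P ∈ homPoly d k l) :
    ∃ R, HasExpansion e v k l P R := by
  let S : ℕ → ℕ → Submodule ℂ (Poly d) := fun k l =>
    { carrier := {P | ∃ R, HasExpansion e v k l P R}
      zero_mem' := ⟨fun _ _ => 0, fun _ _ _ _ => Submodule.zero_mem _, fun _ _ _ => rfl, by simp⟩
      add_mem' := by
        rintro P Q ⟨R, h1, h2, h3⟩ ⟨R', h1', h2', h3'⟩
        refine ⟨fun α β => R α β + R' α β, fun α hα β hβ => Submodule.add_mem _ (h1 α hα β hβ)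
          (h1' α hα β hβ), fun α β h => by simp [h2 α β h, h2' α β h], fun c w => ?_⟩
        rw [map_add, h3, h3']
        simp only [map_add, mul_add, Finset.sum_add_distrib]
      smul_mem' := by
        rintro a P ⟨R, h1, h2, h3⟩
        refine ⟨fun α β => a • R α β, fun α hα β hβ => Submodule.smul_mem _ _ (h1 α hα β hβ),
          fun α β h => by simp [h2 α β h], fun c w => ?_⟩
        rw [map_smul, h3]
        simp only [map_smul, smul_eq_mul, Finset.mul_sum]
        exact Finset.sum_congr rfl fun α _ => Finset.sum_congr rfl fun β _ => by ring }
  refine homPoly_le S ?_ ?_ ?_ k l hP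
  · refine ⟨fun α β => if α = 0 ∧ β = 0 then 1 else 0, ?_, ?_, ?_⟩
    · intro α hα β hβ
      obtain rfl : α = 0 := by omega
      obtain rfl : β = 0 := by omega
      simpa using one_mem_homPoly
    · intro α β h
      exact if_neg (by omega)
    · simp
  · rintro k l P r ⟨R, h⟩
    exact ⟨_, h.Z_mul r⟩
  · rintro k l P r ⟨R, h⟩
    exact ⟨_, h.Zc_mul r⟩

/-- The functions `c` and `c̄` are algebraically independent: this is `eq_zero_of_evalAt` in one
complex variable. -/
theorem coeff_eq_zero_of_forall {K L : ℕ} {t : ℕ → ℕ → ℂ}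
    (h : ∀ c : ℂ, ∑ α ∈ Finset.range K, ∑ β ∈ Finset.range L,
      c ^ α * (starRingEnd ℂ) c ^ β * t α β = 0) {α β : ℕ} (hα : α < K) (hβ : β < L) :
    t α β = 0 := by
  let P : Poly 1 := ∑ α ∈ Finset.range K, ∑ β ∈ Finset.range L,
    MvPolynomial.monomial (Finsupp.single (Sum.inl 0) α + Finsupp.single (Sum.inr 0) β) (t α β)
  have hP : P = 0 := by
    refine eq_zero_of_evalAt fun z => ?_
    rw [← h (z 0)]
    simp only [P, map_sum]
    refine Finset.sum_congr rfl fun α _ => Finset.sum_congr rfl fun β _ => ?_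
    rw [← mul_one (t α β), ← smul_eq_mul, ← MvPolynomial.smul_monomial, map_smul, evalAt_monomial]
    simp [mul_comm]
  have h1 := congrArg (MvPolynomial.coeff
    (Finsupp.single (Sum.inl 0) α + Finsupp.single (Sum.inr 0) β)) hP
  have hinj : ∀ α' β' : ℕ, ((Finsupp.single (Sum.inl 0) α' + Finsupp.single (Sum.inr 0) β' :
      Fin 1 ⊕ Fin 1 →₀ ℕ) = Finsupp.single (Sum.inl 0) α + Finsupp.single (Sum.inr 0) β) ↔
      (α' = α ∧ β' = β) := by
    intro α' β'
    constructor
    · intro h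
      have h1 := DFunLike.congr_fun h (Sum.inl 0)
      have h2 := DFunLike.congr_fun h (Sum.inr 0)
      simp at h1 h2
      exact ⟨h1, h2⟩
    · rintro ⟨rfl, rfl⟩; rfl
  simp only [P, MvPolynomial.coeff_sum, MvPolynomial.coeff_monomial, hinj, ite_and,
    MvPolynomial.coeff_zero] at h1
  simpa [hα, hβ] using h1

end Expansion

/-! ### Rigidity of harmonic polynomials of the form `C(u) h(x')` -/

section Rigidity

variable {d n : ℕ} {e : E d} {v : Fin n → E d} {p q i j a : ℕ} {h : Poly n}

theorem continuous_diskTensor (f : ℝ[X]) (h : Poly n) : Continuous (diskTensor e v p q f h) := by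
  unfold diskTensor diskFun
  refine Continuous.mul ?_ ((continuous_evalAt h).comp
    ((continuous_coord v).comp continuous_subtype_val))
  have h1 : Continuous fun x : Om d => (inner ℂ e (x : E d) : ℂ) := by fun_prop
  refine ((h1.pow p).mul ((Complex.continuous_conj.comp h1).pow q)).mul
    (Complex.continuous_ofReal.comp ?_)
  fun_prop

theorem diskTensor_add (f g : ℝ[X]) (h : Poly n) :
    diskTensor e v p q (f + g) h = diskTensor e v p q f h + diskTensor e v p q g h := by
  ext x; simp [diskTensor, diskFun]; ring

theorem diskTensor_smul (c : ℝ) (f : ℝ[X]) (h : Poly n) :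
    diskTensor e v p q (c • f) h = (c : ℂ) • diskTensor e v p q f h := by
  ext x; simp [diskTensor, diskFun]; ring

theorem diskTensor_mem_span {f : ℕ → ℝ[X]} (hdeg : ∀ a, (f a).degree = a) (h : Poly n) (N : ℕ) :
    ∀ g : ℝ[X], g.degree < N → diskTensor e v p q g h ∈
      Submodule.span ℂ (Set.range fun b : Fin N => diskTensor e v p q (f b) h) := by
  induction N with
  | zero =>
    intro g hg
    have : g = 0 := by
      by_contra h
      rw [degree_eq_natDegree h] at hg
      exact absurd hg (by simp)
    have h0 : diskTensor e v p q (0 : ℝ[X]) h = 0 := by ext x; simp [diskTensor, diskFun]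
    rw [this, h0]
    exact Submodule.zero_mem _
  | succ N ih =>
    intro g hg
    obtain ⟨c, hc⟩ := exists_degree_sub_lt hdeg hg
    have h1 : g = (g - c • f N) + c • f N := by ring
    rw [h1, diskTensor_add, diskTensor_smul]
    refine Submodule.add_mem _ (Submodule.span_mono ?_ (ih _ hc)) (Submodule.smul_mem _ _
      (Submodule.subset_span ⟨Fin.last N, by simp⟩))
    rintro _ ⟨b, rfl⟩
    exact ⟨b.castSucc, by simp⟩

theorem ip_toFun_self_ne_zero {h : Poly n} (w₀ : Om n) (hw₀ : evalAt (w₀ : E n) h ≠ 0) :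
    ip (toFun n h) (toFun n h) ≠ 0 := fun h0 =>
  hw₀ (by rw [← toFun_apply, eq_zero_of_ip_self (continuous_toFun h) h0]; rfl)

theorem diskInt_self_ne_zero {w s : ℕ} {g : ℝ[X]} (hg : g ≠ 0) :
    diskInt w (X ^ s * (g * g)) ≠ 0 := fun h => hg (eq_zero_of_diskInt_sq h)

theorem ne_zero_of_degree_eq {f : ℕ → ℝ[X]} (hdeg : ∀ a, (f a).degree = a) (b : ℕ) : f b ≠ 0 :=
  fun h => by simpa [h] using hdeg b

/-- A combination of the functions `P_b(u) h(x')`, `b ≤ a`, which is harmonic of the same bidegree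
as `P_a(u) h(x')`, is a multiple of it. -/
theorem eq_smul_of_mem_span (hF : IsFrame e v) (hn : 0 < n) (hpq : p = 0 ∨ q = 0)
    (hh : h ∈ homPoly n i j) (hΔ : laplace n h = 0) (w₀ : Om n)
    (hw₀ : evalAt (w₀ : E n) h ≠ 0) {Q : Poly d} (hQ : Q ∈ homPoly d (p + i + a) (q + j + a))
    (hQΔ : laplace d Q = 0) {f : ℕ → ℝ[X]} (hf : IsDiskOrthogonal (i + j + (n - 1)) p q f)
    (hspan : toFun d Q ∈
      Submodule.span ℂ (Set.range fun b : Fin (a + 1) => diskTensor e v p q (f b) h)) :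
    ∃ c : ℂ, toFun d Q = c • diskTensor e v p q (f a) h := by
  have hd : 0 < d := by rw [hF.dim_eq]; omega
  have hf' := isDiskOrthogonal_iff.1 hf
  obtain ⟨c, hc⟩ := (Submodule.mem_span_range_iff_exists_fun ℂ).1 hspan
  -- Pairing with `P_b(u) h(x')` for `b < a` isolates the coefficient `c b`. The pairing is zero
  -- because `Q` is harmonic of larger total degree.
  have h0 : ∀ b : Fin a, c b.castSucc = 0 := by
    intro b
    obtain ⟨r, hr⟩ := exists_harmonic_toFun_eq_diskTensor hF hn hpq hf (b : ℕ)
    obtain ⟨h1, -, h3⟩ := hr h hh hΔ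
    have h4 := ip_harmonic_eq_zero hd h1 hQ hQΔ (by have := b.2; omega)
    rw [h3, ← hc, ip_sum_right _ (continuous_diskTensor _ _)
      (fun b => (continuous_diskTensor _ _).const_smul _),
      Finset.sum_eq_single b.castSucc] at h4
    · rw [ip_smul_right, Fin.val_castSucc, ip_diskTensor hF hn hh hh] at h4
      refine (mul_eq_zero.1 h4).resolve_right (mul_ne_zero ?_ (ip_toFun_self_ne_zero w₀ hw₀))
      exact_mod_cast mul_ne_zero (div_ne_zero (Nat.cast_ne_zero.2 hn.ne') Real.pi_ne_zero)
        (diskInt_self_ne_zero (ne_zero_of_degree_eq hf'.1 _))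
    · intro b' _ hb'
      rw [ip_smul_right, ip_diskTensor hF hn hh hh, hf'.2 (b : ℕ) b' (fun hbb => hb' (Fin.ext hbb.symm))]
      simp
    · simp
  refine ⟨c (Fin.last a), ?_⟩
  rw [← hc, Fin.sum_univ_castSucc]
  simp [h0]

/-- The rigidity statement: nothing is assumed about `C`. Polynomiality of `Q` forces each
coefficient of `u^α ū^β` to be a multiple of some `|x'|^(2m) h`, and then `eq_smul_of_mem_span`
selects the single disk polynomial of the right degree. -/
theorem toFun_eq_smul_diskTensor (hF : IsFrame e v) (hn : 0 < n) (hpq : p = 0 ∨ q = 0)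
    (hh : h ∈ homPoly n i j) (hΔ : laplace n h = 0) (w₀ : Om n)
    (hw₀ : evalAt (w₀ : E n) h ≠ 0) {Q : Poly d} (hQ : Q ∈ homPoly d (p + i + a) (q + j + a))
    (hQΔ : laplace d Q = 0) (C : ℂ → ℂ)
    (hC : ∀ u : ℂ, ‖u‖ < 1 → ∀ w : Om n,
      evalAt (u • e + emb v ((Real.sqrt (1 - ‖u‖ ^ 2) : ℂ) • (w : E n))) Q =
        C u * evalAt (w : E n) h)
    {f : ℕ → ℝ[X]} (hf : IsDiskOrthogonal (i + j + (n - 1)) p q f) :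
    ∃ c : ℂ, toFun d Q = c • diskTensor e v p q (f a) h := by
  refine eq_smul_of_mem_span hF hn hpq hh hΔ w₀ hw₀ hQ hQΔ hf ?_
  obtain ⟨R, hR1, hR2, hR3⟩ := exists_hasExpansion e v hQ
  -- Cross-multiplication eliminates `C`. Scaling by `√(1 + |c|²)` and homogeneity remove the square
  -- root and give an identity polynomial in `c` and `c̄`, whose coefficients can be compared.
  have hA : ∀ (c : ℂ) (w : Om n), evalAt (c • e + emb v (w : E n)) Q * evalAt (w₀ : E n) h =
      evalAt (c • e + emb v (w₀ : E n)) Q * evalAt (w : E n) h := by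
    intro c w
    set t : ℝ := Real.sqrt (1 + ‖c‖ ^ 2) with ht
    have ht0 : 0 < t := Real.sqrt_pos.2 (by positivity)
    have ht2 : t ^ 2 = 1 + ‖c‖ ^ 2 := Real.sq_sqrt (by positivity)
    have hu : ‖((t⁻¹ : ℝ) : ℂ) * c‖ ^ 2 = 1 - (t⁻¹) ^ 2 := by
      rw [norm_mul, Complex.norm_real, Real.norm_of_nonneg (inv_nonneg.2 ht0.le), mul_pow, inv_pow]
      field_simp
      linarith
    have hs : Real.sqrt (1 - ‖((t⁻¹ : ℝ) : ℂ) * c‖ ^ 2) = t⁻¹ := by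
      rw [hu, sub_sub_cancel, Real.sqrt_sq (inv_nonneg.2 ht0.le)]
    have hu1 : ‖((t⁻¹ : ℝ) : ℂ) * c‖ < 1 := by
      have : 0 < (t⁻¹) ^ 2 := by positivity
      nlinarith [norm_nonneg (((t⁻¹ : ℝ) : ℂ) * c)]
    have hx : ∀ w : Om n, (((t⁻¹ : ℝ) : ℂ) * c) • e +
        emb v ((Real.sqrt (1 - ‖((t⁻¹ : ℝ) : ℂ) * c‖ ^ 2) : ℂ) • (w : E n)) =
        ((t⁻¹ : ℝ) : ℂ) • (c • e + emb v (w : E n)) := by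
      intro w
      rw [hs, smul_add, smul_smul]
      simp [emb, Finset.smul_sum, smul_smul]
    have h1 := hC _ hu1 w
    have h2 := hC _ hu1 w₀
    rw [hx, evalAt_smul hQ] at h1 h2
    have h3 : ((t⁻¹ : ℝ) : ℂ) ^ (p + i + a) * (starRingEnd ℂ) ((t⁻¹ : ℝ) : ℂ) ^ (q + j + a) ≠ 0 := by
      rw [Complex.conj_ofReal]
      have : ((t⁻¹ : ℝ) : ℂ) ≠ 0 := by exact_mod_cast (inv_pos.2 ht0).ne'
      positivity
    refine mul_left_cancel₀ h3 ?_
    linear_combination evalAt (w₀ : E n) h * h1 - evalAt (w : E n) h * h2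
  have hB : ∀ α ≤ p + i + a, ∀ β ≤ q + j + a, ∀ w : Om n,
      evalAt (w : E n) (R α β) * evalAt (w₀ : E n) h =
        evalAt (w₀ : E n) (R α β) * evalAt (w : E n) h := by
    intro α hα β hβ w
    rw [← sub_eq_zero]
    refine coeff_eq_zero_of_forall (K := p + i + a + 1) (L := q + j + a + 1)
      (t := fun α β => evalAt (w : E n) (R α β) * evalAt (w₀ : E n) h -
        evalAt (w₀ : E n) (R α β) * evalAt (w : E n) h) (fun c => ?_) (by omega) (by omega)
    have := hA c w
    rw [hR3, hR3, ← sub_eq_zero] at this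
    rw [← this]
    simp only [mul_sub, Finset.sum_sub_distrib, Finset.sum_mul]
    congr 1
    · exact Finset.sum_congr rfl fun α _ => Finset.sum_congr rfl fun β _ => by ring
    · exact Finset.sum_congr rfl fun α _ => Finset.sum_congr rfl fun β _ => by ring
  have hR : ∀ α ≤ p + i + a, ∀ β ≤ q + j + a,
      toFun n (R α β) = (evalAt (w₀ : E n) (R α β) / evalAt (w₀ : E n) h) • toFun n h := by
    intro α hα β hβ
    ext w
    simp only [toFun_apply, Pi.smul_apply, smul_eq_mul]
    rw [div_mul_eq_mul_div, eq_div_iff hw₀]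
    exact hB α hα β hβ w
  have hfun : toFun d Q = ∑ α ∈ Finset.range (p + i + a + 1), ∑ β ∈ Finset.range (q + j + a + 1),
      fun x : Om d => inner ℂ e (x : E d) ^ α * (starRingEnd ℂ) (inner ℂ e (x : E d)) ^ β *
        evalAt (coord v (x : E d)) (R α β) := by
    ext x
    have := hR3 (inner ℂ e (x : E d)) (coord v (x : E d))
    rw [← hF.eq_add] at this
    rw [toFun_apply, this]
    simp only [Finset.sum_apply]
  rw [hfun]
  refine Submodule.sum_mem _ fun α hα => Submodule.sum_mem _ fun β hβ => ?_
  rw [Finset.mem_range] at hα hβ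
  obtain ⟨c, hRc⟩ : ∃ c : ℂ, toFun n (R α β) = c • toFun n h :=
    ⟨_, hR α (by omega) β (by omega)⟩
  have hRmem := hR1 α (by omega) β (by omega)
  -- The coefficient has bidegree `(i + m, j + m)` for some natural `m` exactly in this case.
  by_cases hgood : i ≤ p + i + a - α ∧ j ≤ q + j + a - β ∧
      p + i + a - α + j = q + j + a - β + i
  · obtain ⟨m, hm⟩ : ∃ m, p + i + a - α = i + m := ⟨p + i + a - α - i, by omega⟩
    have hm' : q + j + a - β = j + m := by omega
    have hma : m ≤ a := by omega
    have hα' : α = p + (a - m) := by omega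
    have hβ' : β = q + (a - m) := by omega
    have hzero : ∀ w : E n, evalAt w (R α β - c • (rho n ^ m * h)) = 0 := by
      refine evalAt_eq_zero_of_sphere hn (k := i + m) (l := j + m)
        (Submodule.sub_mem _ (hm ▸ hm' ▸ hRmem) (Submodule.smul_mem _ _ (rho_pow_mul_mem hh m))) ?_
      ext w
      have := congrFun hRc w
      simp only [toFun_apply, Pi.smul_apply, smul_eq_mul] at this
      simp [toFun_apply, this, evalAt_rho, norm_eq_of_mem_sphere w]
    have hterm : (fun x : Om d => inner ℂ e (x : E d) ^ α *
        (starRingEnd ℂ) (inner ℂ e (x : E d)) ^ β * evalAt (coord v (x : E d)) (R α β)) =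
        c • diskTensor e v p q (X ^ (a - m) * (1 - X) ^ m) h := by
      ext x
      have h1 := hzero (coord v (x : E d))
      rw [map_sub, sub_eq_zero, map_smul, map_mul, map_pow, evalAt_rho] at h1
      have h2 : (‖coord v (x : E d)‖ : ℂ) ^ 2 = 1 - (‖(inner ℂ e (x : E d) : ℂ)‖ : ℂ) ^ 2 := by
        exact_mod_cast congrArg (fun t : ℝ => (t : ℂ)) (hF.norm_coord_sq x)
      rw [h1, h2, hα', hβ']
      simp only [diskTensor, diskFun, Pi.smul_apply, smul_eq_mul, eval_mul, eval_pow, eval_X,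
        eval_sub, eval_one]
      push_cast
      rw [← Complex.mul_conj' (inner ℂ e (x : E d))]
      ring
    rw [hterm]
    refine Submodule.smul_mem _ _ (diskTensor_mem_span (isDiskOrthogonal_iff.1 hf).1 h _ _ ?_)
    refine lt_of_le_of_lt (degree_le_of_natDegree_le
      (natDegree_X_pow_mul_one_sub_pow_le hma)) ?_
    exact_mod_cast Nat.lt_succ_self a
  -- In every other bidegree the coefficient is orthogonal to `h`, having lower degree or a
  -- different difference of degrees; being also a multiple of `h` on the sphere, it vanishes.
  · have hc0 : c = 0 := by
      have h1 : ip (toFun n (R α β)) (toFun n h) = 0 := by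
        by_cases hb : q + j + a - β + i = p + i + a - α + j
        · exact ip_harmonic_eq_zero hn hRmem hh hΔ (by omega)
        · exact ip_eq_zero_of_ne hn hRmem hh hb
      rw [hRc, ip_smul_left] at h1
      have := (mul_eq_zero.1 h1).resolve_right (ip_toFun_self_ne_zero w₀ hw₀)
      simpa using this
    have hz : ∀ w : E n, evalAt w (R α β) = 0 :=
      evalAt_eq_zero_of_sphere hn hRmem (by rw [hRc, hc0, zero_smul])
    simp only [hz, mul_zero]
    exact Submodule.zero_mem _

end Rigidity

/-! ### Spaces of harmonic functions -/

section Harm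

variable {n : ℕ} {i j : ℕ}

theorem mem_harm {f : Om n → ℂ} : f ∈ harm n i j ↔
    ∃ P ∈ homPoly n i j, laplace n P = 0 ∧ toFun n P = f := by
  simp [harm, Submodule.mem_map, and_assoc]

theorem continuous_of_mem_harm {f : Om n → ℂ} (hf : f ∈ harm n i j) : Continuous f := by
  obtain ⟨P, -, -, rfl⟩ := mem_harm.1 hf
  exact continuous_toFun P

instance : FiniteDimensional ℂ (homPoly n i j) := by
  have h : homPoly n i j ≤ MvPolynomial.weightedHomogeneousSubmodule ℂ
      (fun _ : Fin n ⊕ Fin n => 1) (i + j) := by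
    refine homPoly_le (fun i j => MvPolynomial.weightedHomogeneousSubmodule ℂ
      (fun _ : Fin n ⊕ Fin n => 1) (i + j)) ?_ ?_ ?_ i j
    · exact MvPolynomial.isWeightedHomogeneous_one ℂ _
    · intro k l P r h
      have := (MvPolynomial.isWeightedHomogeneous_X ℂ (fun _ : Fin n ⊕ Fin n => 1)
        (Sum.inl r)).mul h
      rwa [show 1 + (k + l) = k + 1 + l by omega] at this
    · intro k l P r h
      have := (MvPolynomial.isWeightedHomogeneous_X ℂ (fun _ : Fin n ⊕ Fin n => 1)
        (Sum.inr r)).mul h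
      rwa [show 1 + (k + l) = k + (l + 1) by omega] at this
  have hfg := MvPolynomial.weightedHomogeneousSubmodule_fg (R := ℂ)
    (fun _ : Fin n ⊕ Fin n => 1) (fun _ => one_ne_zero) (i + j)
  have : FiniteDimensional ℂ (MvPolynomial.weightedHomogeneousSubmodule ℂ
      (fun _ : Fin n ⊕ Fin n => 1) (i + j)) := Module.Finite.iff_fg.2 hfg
  exact Submodule.finiteDimensional_of_le h

instance : FiniteDimensional ℂ (harm n i j) := by
  have : FiniteDimensional ℂ (homPoly n i j ⊓ LinearMap.ker (laplace n) : Submodule ℂ (Poly n)) :=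
    Submodule.finiteDimensional_of_le inf_le_left
  exact Module.Finite.map _ _

/-- The inner product on spaces of harmonic functions. -/
abbrev harmCore (n i j : ℕ) : InnerProductSpace.Core ℂ (harm n i j) where
  inner f g := ip (f : Om n → ℂ) g
  conj_inner_symm f g := ip_conj_symm _ _
  re_inner_nonneg f := by
    rw [ip_self_eq]
    exact integral_nonneg fun z => by positivity
  add_left f g h := by
    rw [← ip_conj_symm, Submodule.coe_add, ip_add_right (continuous_of_mem_harm h.2)
      (continuous_of_mem_harm f.2) (continuous_of_mem_harm g.2), map_add, ip_conj_symm,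
      ip_conj_symm]
  smul_left f g c := by
    rw [Submodule.coe_smul, ip_smul_left]
  definite f h := Subtype.ext (eq_zero_of_ip_self (continuous_of_mem_harm f.2) h)

theorem exists_orthonormal_harm (n i j : ℕ) : ∃ (N : ℕ) (b : Fin N → Om n → ℂ),
    (∀ s, b s ∈ harm n i j) ∧ (∀ r s, ip (b r) (b s) = if r = s then 1 else 0) ∧
    ∀ f ∈ harm n i j, f = ∑ s, ip (b s) f • b s := by
  let _ : NormedAddCommGroup (harm n i j) := (harmCore n i j).toNormedAddCommGroup
  let _ : InnerProductSpace ℂ (harm n i j) := InnerProductSpace.ofCore (harmCore n i j).toCore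
  let b := stdOrthonormalBasis ℂ (harm n i j)
  refine ⟨_, fun s => b s, fun s => (b s).2, fun r s => ?_, fun f hf => ?_⟩
  · exact orthonormal_iff_ite.1 b.orthonormal r s
  · have h := b.sum_repr' ⟨f, hf⟩
    have h' := congrArg (fun g : harm n i j => (g : Om n → ℂ)) h
    simp only [Submodule.coe_sum, Submodule.coe_smul] at h'
    exact h'.symm

/-- The coefficient vectors of a unitary map. -/
theorem coord_symm (g : U n) (x : E n) :
    coord (fun r => g.symm (EuclideanSpace.single r 1)) x = g x := by
  ext r
  have := g.inner_map_map (g.symm (EuclideanSpace.single r 1)) x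
  rw [g.apply_symm_apply] at this
  simp only [coord]
  rw [← this]
  rw [EuclideanSpace.inner_single_left]
  simp

theorem orthonormal_symm (g : U n) :
    Orthonormal ℂ fun r => g.symm (EuclideanSpace.single r (1 : ℂ)) := by
  rw [orthonormal_iff_ite]
  intro r s
  rw [g.symm.inner_map_map]
  simpa using orthonormal_iff_ite.1 (EuclideanSpace.basisFun (Fin n) ℂ).orthonormal r s

theorem toFun_pull_symm (g : U n) (P : Poly n) (z : Om n) :
    toFun n (pull (fun r => g.symm (EuclideanSpace.single r 1)) P) z = toFun n P (rot g z) := by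
  rw [toFun_apply, evalAt_pull, coord_symm, toFun_apply]; rfl

theorem comp_rot_mem_harm (g : U n) {f : Om n → ℂ} (hf : f ∈ harm n i j) :
    (fun z => f (rot g z)) ∈ harm n i j := by
  obtain ⟨P, hP, hΔ, rfl⟩ := mem_harm.1 hf
  refine mem_harm.2 ⟨_, pull_mem_homPoly (fun r => g.symm (EuclideanSpace.single r 1)) hP, ?_,
    funext fun z => toFun_pull_symm g P z⟩
  rw [laplace_pull (orthonormal_symm g), hΔ, map_zero]

/-- Unitary invariance is inherited from the Gaussian functional: composition with `g` is the
substitution `pull` along an orthonormal system. -/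
theorem ip_comp_rot (hn : 0 < n) (g : U n) {f f' : Om n → ℂ} (hf : f ∈ harm n i j)
    (hf' : f' ∈ harm n i j) : ip (fun z => f (rot g z)) (fun z => f' (rot g z)) = ip f f' := by
  obtain ⟨P, hP, -, rfl⟩ := mem_harm.1 hf
  obtain ⟨P', hP', -, rfl⟩ := mem_harm.1 hf'
  have h1 := mul_mem_homPoly (cj_mem_homPoly hP) hP'
  rw [ip_toFun, sphInt_eq_gauss hn h1, ← gauss_pull (orthonormal_symm g) _ _ _ rfl _ h1,
    ← sphInt_eq_gauss hn (pull_mem_homPoly _ h1), sphInt_apply, ip]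
  congr 1
  ext z
  rw [toFun_pull_symm]
  simp only [toFun_apply, map_mul, evalAt_cj]

end Harm

/-! ### Unitary maps -/

section Unitary

variable {d n : ℕ} {e : E d} {v : Fin n → E d}

theorem emb_add (x y : E n) : emb v (x + y) = emb v x + emb v y := by
  simp [emb, add_smul, Finset.sum_add_distrib]

theorem emb_smul (c : ℂ) (x : E n) : emb v (c • x) = c • emb v x := by
  simp [emb, Finset.smul_sum, smul_smul]

theorem IsFrame.inner_emb (hF : IsFrame e v) (x y : E n) :
    inner ℂ (emb v x) (emb v y) = (inner ℂ x y : ℂ) := by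
  rw [inner_eq_sum x y]
  simp [emb, orthonormal_iff_ite.1 hF.orthonormal, mul_comm]

theorem IsFrame.inner_emb_right (hF : IsFrame e v) (x : E n) : inner ℂ e (emb v x) = (0 : ℂ) := by
  simp [emb, hF.inner_eq]

/-- A unitary map of the complement of `e` extends to a unitary map fixing `e`. -/
theorem IsFrame.exists_extension (hF : IsFrame e v) (k : U n) :
    ∃ g : U d, g e = e ∧ ∀ w, g (emb v w) = emb v (k w) := by
  have hF' : IsFrame e (fun r => emb v (k (EuclideanSpace.single r 1))) := by
    refine ⟨hF.norm_eq, ?_, fun r => hF.inner_emb_right _, hF.dim_eq⟩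
    rw [orthonormal_iff_ite]
    intro r s
    rw [hF.inner_emb, k.inner_map_map]
    simpa using orthonormal_iff_ite.1 (EuclideanSpace.basisFun (Fin n) ℂ).orthonormal r s
  obtain ⟨b, h0, h1⟩ := hF.exists_basis
  obtain ⟨b', h0', h1'⟩ := hF'.exists_basis
  refine ⟨b.equiv b' (Equiv.refl _), ?_, fun w => ?_⟩
  · conv_lhs => rw [← h0]
    rw [OrthonormalBasis.equiv_apply_basis]
    exact h0'
  · have hv : ∀ r, b.equiv b' (Equiv.refl _) (v r) = emb v (k (EuclideanSpace.single r 1)) := by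
      intro r
      rw [← h1, OrthonormalBasis.equiv_apply_basis]
      exact h1' r
    let L : E n →ₗ[ℂ] E d := { toFun := emb v, map_add' := emb_add, map_smul' := emb_smul }
    have hw : k w = ∑ r, w r • k (EuclideanSpace.single r 1) := by
      conv_lhs => rw [← (EuclideanSpace.basisFun (Fin n) ℂ).sum_repr w]
      simp
    have h2 : emb v (k w) = ∑ r, w r • emb v (k (EuclideanSpace.single r 1)) := by
      change L (k w) = ∑ r, w r • L (k (EuclideanSpace.single r 1))
      rw [hw, map_sum]
      simp only [map_smul]
    rw [h2, emb, map_sum]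
    simp only [map_smul, hv]

theorem exists_unitary_apply_eq (hn : 0 < n) (x y : Om n) : ∃ k : U n, k (x : E n) = y := by
  have h : ∀ x : Om n, ∃ b : OrthonormalBasis (Fin n) ℂ (E n), b ⟨0, hn⟩ = x := by
    intro x
    obtain ⟨b, hb⟩ := Orthonormal.exists_orthonormalBasis_extension_of_card_eq (𝕜 := ℂ)
      (ι := Fin n) (v := fun _ => (x : E n)) (s := {⟨0, hn⟩}) (by simp)
      ⟨fun _ => norm_eq_of_mem_sphere x, fun a b hab => absurd (Subsingleton.elim a b) hab⟩
    exact ⟨b, hb _ rfl⟩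
  obtain ⟨b, hb⟩ := h x
  obtain ⟨b', hb'⟩ := h y
  refine ⟨b.equiv b' (Equiv.refl _), ?_⟩
  rw [← hb, OrthonormalBasis.equiv_apply_basis]
  exact hb'

theorem exists_isFrame (x : Om (n + 1)) : ∃ v : Fin n → E (n + 1), IsFrame (x : E (n + 1)) v := by
  obtain ⟨b, hb⟩ := Orthonormal.exists_orthonormalBasis_extension_of_card_eq (𝕜 := ℂ)
      (ι := Fin (n + 1)) (v := fun _ => (x : E (n + 1))) (s := {0}) (by simp)
      ⟨fun _ => norm_eq_of_mem_sphere x, fun a b hab => absurd (Subsingleton.elim a b) hab⟩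
  refine ⟨fun r => b r.succ, norm_eq_of_mem_sphere x,
    b.orthonormal.comp _ (Fin.succ_injective n), fun r => ?_, rfl⟩
  rw [← hb 0 rfl]
  exact b.orthonormal.2 (Fin.succ_ne_zero r).symm

/-- The point of the sphere with coordinates `u` and `√(1 - |u|²) w`. -/
def IsFrame.point (hF : IsFrame e v) (u : ℂ) (hu : ‖u‖ < 1) (w : Om n) : Om d :=
  ⟨u • e + emb v ((Real.sqrt (1 - ‖u‖ ^ 2) : ℂ) • (w : E n)), by
    have h1 : 0 ≤ 1 - ‖u‖ ^ 2 := by nlinarith [norm_nonneg u]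
    have h := hF.norm_sq_eq (u • e + emb v ((Real.sqrt (1 - ‖u‖ ^ 2) : ℂ) • (w : E n)))
    rw [hF.inner_add_emb, hF.coord_add_emb, norm_smul, norm_eq_of_mem_sphere w, mul_one,
      Complex.norm_real, Real.norm_of_nonneg (Real.sqrt_nonneg _), Real.sq_sqrt h1,
      add_sub_cancel] at h
    rw [mem_sphere_zero_iff_norm]
    exact (pow_eq_one_iff_of_nonneg (norm_nonneg _) two_ne_zero).1 h⟩

theorem IsFrame.rot_point (hF : IsFrame e v) {g : U d} {k : U n} (hg : g e = e)
    (hgk : ∀ w, g (emb v w) = emb v (k w)) (u : ℂ) (hu : ‖u‖ < 1) (w : Om n) :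
    rot g (hF.point u hu w) = hF.point u hu (rot k w) := by
  apply Subtype.ext
  simp only [rot, IsFrame.point, map_add, map_smul, hg, hgk]

theorem exists_diskFun_ne_zero {p q : ℕ} {f : ℝ[X]} (hf : f ≠ 0) :
    ∃ u : ℂ, ‖u‖ < 1 ∧ diskFun p q f u ≠ 0 := by
  by_contra! h
  refine hf (Polynomial.eq_zero_of_infinite_isRoot f (Set.Infinite.mono ?_
    (Set.Ioo_infinite (zero_lt_one (α := ℝ)))))
  intro t ht
  have h1 : ‖((Real.sqrt t : ℝ) : ℂ)‖ = Real.sqrt t := by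
    rw [Complex.norm_real, Real.norm_of_nonneg (Real.sqrt_nonneg t)]
  have h2 := h ((Real.sqrt t : ℝ) : ℂ) (by
    rw [h1]; exact (Real.sqrt_lt' one_pos).2 (by simpa using ht.2))
  have h3 : ((Real.sqrt t : ℝ) : ℂ) ≠ 0 := by exact_mod_cast (Real.sqrt_pos.2 ht.1).ne'
  rw [diskFun, h1, Real.sq_sqrt ht.1.le, Complex.conj_ofReal] at h2
  simpa [h3, (Real.sqrt_pos.2 ht.1).ne'] using h2

end Unitary

/-! ### Zonal functionals -/

section ZonalFunctional

variable {n i j : ℕ}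

/-- Functions invariant under the stabilizer of a point are multiples of one function, with
nonzero value at the point. -/
theorem exists_zonal_function (w : Om (n + 1)) (hn : 0 < n) : ∃ F ∈ harm (n + 1) i j,
    F w = 1 ∧ ∀ f ∈ harm (n + 1) i j,
      (∀ k : U (n + 1), k (w : E (n + 1)) = w → ∀ z, f (rot k z) = f z) → ∃ c : ℂ, f = c • F := by
  obtain ⟨v, hF⟩ := exists_isFrame w
  -- Split off `w` itself as the distinguished vector. The zonal function is then the case `h = 1`
  -- of the functions `P_m(u) h(x')`, with angular exponents `i - m` and `j - m`.
  set m := min i j with hm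
  have hpq : i - m = 0 ∨ j - m = 0 := by omega
  have hdisk := isDiskOrthogonal_radialPoly hF hn hpq 0
  have h1 : (1 : Poly n) ∈ homPoly n 0 0 := one_mem_homPoly
  have hΔ1 : laplace n (1 : Poly n) = 0 := by rw [laplace_apply]; simp
  refine ⟨toFun (n + 1) (harmPoly (w : E (n + 1)) v (i - m) (j - m) m 0 1), mem_harm.2 ⟨_, ?_,
    laplace_harmPoly (i := 0) (j := 0) hF hn hpq m h1 hΔ1, rfl⟩, ?_, ?_⟩
  · have := harmPoly_mem (e := (w : E (n + 1))) (v := v) (p := i - m) (q := j - m) m h1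
    rwa [show i - m + 0 + m = i by omega, show j - m + 0 + m = j by omega] at this
  · rw [toFun_harmPoly hF]
    have h2 : (radialPoly (i - m) (j - m) m 0 n).eval 1 = 1 := by
      rw [radialPoly, eval_finsetSum, Finset.sum_eq_single 0]
      · simp [radialCoeff]
      · intro b _ hb
        simp [hb]
      · simp
    simp [diskTensor, diskFun, hF.norm_eq, h2]
  · intro f hf hinv
    obtain ⟨Q, hQ, hQΔ, rfl⟩ := mem_harm.1 hf
    have hy : (EuclideanSpace.single (⟨0, hn⟩ : Fin n) (1 : ℂ)) ∈ Metric.sphere (0 : E n) 1 := by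
      simp
    let y₀ : Om n := ⟨_, hy⟩
    have hQ' : Q ∈ homPoly (n + 1) (i - m + 0 + m) (j - m + 0 + m) := by
      rwa [show i - m + 0 + m = i by omega, show j - m + 0 + m = j by omega]
    obtain ⟨c, hc⟩ := toFun_eq_smul_diskTensor (i := 0) (j := 0) (h := 1) hF hn hpq h1 hΔ1 y₀
      (by simp) hQ' hQΔ
      -- The stabilizer is transitive on the unit sphere of the complement, so an invariant function
      -- depends on `u` alone and rigidity applies with `h = 1`.
      (fun u => evalAt (u • (w : E (n + 1)) +
        emb v ((Real.sqrt (1 - ‖u‖ ^ 2) : ℂ) • (y₀ : E n))) Q) (by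
        intro u hu y
        obtain ⟨k, hk⟩ := exists_unitary_apply_eq hn y₀ y
        obtain ⟨g, hg, hgk⟩ := hF.exists_extension k
        have h2 := hinv g hg (hF.point u hu y₀)
        have hk' : rot k y₀ = y := Subtype.ext hk
        rw [hF.rot_point hg hgk, hk'] at h2
        rw [map_one, mul_one]
        exact h2)
      (by simpa using hdisk)
    refine ⟨c, ?_⟩
    rw [hc, toFun_harmPoly hF]

/-- A linear functional on `Harm_n(i, j)` invariant under the stabilizer of a point is a multiple
of the evaluation at this point. -/
theorem exists_eq_smul_eval (hn : 2 ≤ n) (w : Om n) (Λ : harm n i j →ₗ[ℂ] ℂ)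
    (hΛ : ∀ k : U n, k (w : E n) = w → ∀ f f' : harm n i j,
      (∀ z, (f' : Om n → ℂ) z = (f : Om n → ℂ) (rot k z)) → Λ f' = Λ f) :
    ∃ c : ℂ, ∀ f : harm n i j, Λ f = c * (f : Om n → ℂ) w := by
  obtain ⟨n, rfl⟩ : ∃ m, n = m + 1 := ⟨n - 1, by omega⟩
  obtain ⟨F, hF, hFw, hFu⟩ := exists_zonal_function (i := i) (j := j) w (by omega)
  have key : ∀ Λ : harm (n + 1) i j →ₗ[ℂ] ℂ,
      (∀ k : U (n + 1), k (w : E (n + 1)) = w → ∀ f f' : harm (n + 1) i j,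
        (∀ z, (f' : Om (n + 1) → ℂ) z = (f : Om (n + 1) → ℂ) (rot k z)) → Λ f' = Λ f) →
      ∃ c : ℂ, ∀ f : harm (n + 1) i j, Λ f = c * ip F f := by
    intro Λ hΛ
    obtain ⟨N, b, hb, hon, hexp⟩ := exists_orthonormal_harm (n + 1) i j
    -- The Riesz representative of `Λ`; it inherits invariance because the inner product is
    -- unitarily invariant, and so it is a multiple of `F`.
    let G : Om (n + 1) → ℂ := ∑ s, (starRingEnd ℂ) (Λ ⟨b s, hb s⟩) • b s
    have hG : G ∈ harm (n + 1) i j :=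
      Submodule.sum_mem _ fun s _ => Submodule.smul_mem _ _ (hb s)
    have hrep : ∀ f : harm (n + 1) i j, ip G f = Λ f := by
      intro f
      have h1 : f = ∑ s, ip (b s) f • (⟨b s, hb s⟩ : harm (n + 1) i j) := by
        apply Subtype.ext
        rw [Submodule.coe_sum]
        exact hexp f f.2
      conv_rhs => rw [h1]
      rw [map_sum, ← ip_conj_symm, ip_sum_right _ (continuous_of_mem_harm f.2)
        (fun s => (continuous_of_mem_harm (hb s)).const_smul _), map_sum]
      refine Finset.sum_congr rfl fun s _ => ?_
      rw [ip_smul_right, map_smul, map_mul, Complex.conj_conj, ip_conj_symm, smul_eq_mul, mul_comm]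
    obtain ⟨c, hc⟩ := hFu G hG (by
      intro k hk
      have hGk := comp_rot_mem_harm k hG
      have hk' : k.symm (w : E (n + 1)) = w := by
        rw [LinearIsometryEquiv.symm_apply_eq]; exact hk.symm
      have hD : (fun z => G (rot k z)) - G ∈ harm (n + 1) i j := Submodule.sub_mem _ hGk hG
      have horth : ∀ f : harm (n + 1) i j, ip (fun z => G (rot k z)) f = ip G f := by
        intro f
        let f' : harm (n + 1) i j := ⟨_, comp_rot_mem_harm k.symm f.2⟩
        have h1 : (fun z => (f' : Om (n + 1) → ℂ) (rot k z)) = f := by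
          ext z
          have h2 : rot k.symm (rot k z) = z := Subtype.ext (by simp [rot])
          change (f : Om (n + 1) → ℂ) (rot k.symm (rot k z)) = _
          rw [h2]
        rw [← h1, ip_comp_rot (by omega) k hG f'.2, hrep, h1, hrep]
        exact hΛ k.symm hk' f f' fun z => rfl
      have h0 := eq_zero_of_ip_self (continuous_of_mem_harm hD) (by
        have h1 := ip_add_right (continuous_of_mem_harm hD) (continuous_of_mem_harm hGk)
          ((continuous_of_mem_harm hG).const_smul (-1 : ℂ))
        rw [neg_one_smul, ← sub_eq_add_neg, ← neg_one_smul ℂ G, ip_smul_right,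
          ← ip_conj_symm (fun z => G (rot k z)), ← ip_conj_symm G, horth ⟨_, hD⟩] at h1
        rw [h1]
        ring)
      intro z
      exact sub_eq_zero.1 (congrFun h0 z))
    refine ⟨(starRingEnd ℂ) c, fun f => ?_⟩
    rw [← hrep, hc, ip_smul_left]
  obtain ⟨c, hc⟩ := key Λ hΛ
  -- Evaluation at `w` is itself an invariant functional, with nonzero factor `c'` because `F w =
  -- 1`.
  obtain ⟨c', hc'⟩ := key
    { toFun := fun f => (f : Om (n + 1) → ℂ) w
      map_add' := fun f g => rfl
      map_smul' := fun a f => rfl } (by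
    intro k hk f f' h
    have hk' : rot k w = w := Subtype.ext hk
    change (f' : Om (n + 1) → ℂ) w = (f : Om (n + 1) → ℂ) w
    rw [h w, hk'])
  have h1 : c' ≠ 0 := by
    rintro rfl
    have := hc' ⟨F, hF⟩
    simp [hFw] at this
  refine ⟨c / c', fun f => ?_⟩
  have h2 : (f : Om (n + 1) → ℂ) w = c' * ip F f := hc' f
  rw [hc, h2]
  field_simp

end ZonalFunctional

/-! ### The reproducing kernel of `Harm_n(k, l)` -/

section Kernel

theorem harmDim_eq (m k l : ℕ) : (harmDim (m + 2) k l : ℂ) =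
    (m + 1 + k + l) * ((m + k).factorial * (m + l).factorial) /
      ((m + 1).factorial * m.factorial * (k.factorial * l.factorial)) := by
  have h1 : ∀ k : ℕ, ((m + 1 + k).choose (m + 1) : ℂ) =
      (m + 1 + k) * (m + k).factorial / ((m + 1).factorial * k.factorial) := by
    intro k
    rw [Nat.cast_add_choose, show m + 1 + k = m + k + 1 by omega, Nat.factorial_succ (m + k)]
    push_cast
    ring
  have h2 : ∀ k : ℕ, ((m + k).choose (m + 1) : ℂ) =
      k * (m + k).factorial / ((m + 1).factorial * k.factorial) := by
    rintro (_ | k)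
    · simp
    · rw [show m + (k + 1) = m + 1 + k by omega, Nat.cast_add_choose, Nat.factorial_succ k]
      have : (k : ℂ) + 1 ≠ 0 := by exact_mod_cast Nat.succ_ne_zero k
      have := fun a : ℕ => (Nat.cast_ne_zero (R := ℂ)).2 a.factorial_ne_zero
      push_cast
      field_simp
  have e1 : ∀ k, m + 2 + k - 1 = m + 1 + k := fun k => by omega
  have e2 : ∀ k, m + 2 + k - 2 = m + k := fun k => by omega
  rw [harmDim, e1, e1, e2, e2, show m + 2 - 1 = m + 1 by omega]
  push_cast
  rw [h1, h1, h2, h2, Nat.factorial_succ m]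
  have := fun a : ℕ => (Nat.cast_ne_zero (R := ℂ)).2 a.factorial_ne_zero
  have : (m : ℂ) + 1 ≠ 0 := by exact_mod_cast Nat.succ_ne_zero m
  push_cast
  field_simp
  ring

/-- The normalization of `jacobi` is the one that makes the kernel reproducing: it cancels the
factor produced by the leading term in `gauss_linc_pow_mul_harmonic` and `sphInt_eq_gauss`. -/
theorem jacobiConst_mul_jacobiCoeff {n : ℕ} (hn : 2 ≤ n) (k l : ℕ) :
    jacobiConst n k l * jacobiCoeff n k l 0 *
      (((n - 1).factorial : ℂ) / ((n - 1 + (k + l)).factorial : ℂ) *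
        (k.factorial * l.factorial)) = 1 := by
  obtain ⟨m, rfl⟩ : ∃ m, n = m + 2 := ⟨n - 2, by omega⟩
  rw [jacobiConst, jacobiCoeff, harmDim_eq]
  have e1 : ∀ k, m + 2 + k - 2 = m + k := fun k => by omega
  rw [e1, e1, show m + 2 + k + l - 0 - 2 = m + k + l by omega, show m + 2 - 2 = m by omega,
    show m + 2 - 1 = m + 1 by omega, show m + 1 + (k + l) = m + k + l + 1 by omega,
    Nat.factorial_succ (m + k + l), Nat.sub_zero, Nat.sub_zero]
  have h0 := fun a : ℕ => (Nat.cast_ne_zero (R := ℂ)).2 a.factorial_ne_zero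
  have h1 := h0 (m + k)
  have h2 := h0 (m + l)
  have h3 := h0 (m + k + l)
  have h4 := h0 (m + 1)
  have h5 := h0 m
  have h6 := h0 k
  have h7 := h0 l
  have : (m : ℂ) + 1 + k + l ≠ 0 := by exact_mod_cast Nat.ne_of_gt (by omega : 0 < m + 1 + k + l)
  have : (m : ℂ) + k + l + 1 ≠ 0 := by exact_mod_cast Nat.ne_of_gt (by omega : 0 < m + k + l + 1)
  push_cast
  rw [Nat.factorial_zero]
  push_cast
  field_simp
  ring

variable {n k l : ℕ}

/-- The reproducing property of the zonal polynomials. -/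
theorem ip_zonalPoly (hn : 2 ≤ n) (w : E n) {h : Poly n} (hh : h ∈ homPoly n k l)
    (hΔ : laplace n h = 0) : ip (toFun n (zonalPoly n k l w)) (toFun n h) = evalAt w h := by
  let m : ℕ → Poly n := fun r => lin w ^ (k - r) * linc w ^ (l - r)
  have h1 : toFun n (zonalPoly n k l w) = jacobiConst n k l •
      ∑ r ∈ Finset.range (min k l + 1),
        (jacobiCoeff n k l r * ((‖w‖ : ℂ) ^ 2) ^ r) • toFun n (m r) := by
    rw [zonalPoly, map_smul, map_sum]
    congr 1
    refine Finset.sum_congr rfl fun r _ => ?_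
    rw [map_smul]
    congr 1
    ext z
    rw [toFun_apply, toFun_apply, map_mul, map_pow, evalAt_rho, norm_eq_of_mem_sphere z]
    simp [m]
  -- Since `rho n` is `1` on the sphere, the terms with `r > 0` have lower total degree and are
  -- orthogonal to the harmonic `h`.
  have h0 : ∀ r ∈ Finset.range (min k l + 1), r ≠ 0 →
      (jacobiCoeff n k l r * ((‖w‖ : ℂ) ^ 2) ^ r) * ip (toFun n h) (toFun n (m r)) = 0 := by
    intro r hr hr0
    rw [Finset.mem_range] at hr
    rw [← ip_conj_symm, ip_harmonic_eq_zero (by omega) (lin_pow_mul_linc_pow_mem w _ _) hh hΔ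
      (by omega), map_zero, mul_zero]
  have h2 : ip (toFun n (m 0)) (toFun n h) =
      ((n - 1).factorial : ℂ) / ((n - 1 + (k + l)).factorial : ℂ) *
        (k.factorial * l.factorial) * evalAt w h := by
    have hm := mul_mem_homPoly (cj_mem_homPoly (lin_pow_mul_linc_pow_mem w k l)) hh
    have e : cj (lin w ^ k * linc w ^ l) = linc w ^ k * lin w ^ l := by
      rw [cj_mul, cj_pow, cj_pow, cj_lin, cj_linc]
    simp only [m, Nat.sub_zero]
    rw [ip_toFun, sphInt_eq_gauss (by omega) hm, e, gauss_linc_pow_mul_harmonic w k l h hh hΔ,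
      add_comm l k]
    ring
  rw [h1, ip_smul_left, conj_jacobiConst, ← ip_conj_symm,
    ip_sum_right _ (continuous_toFun h) (fun r => (continuous_toFun (m r)).const_smul _)]
  simp only [ip_smul_right]
  rw [Finset.sum_eq_single 0 h0 (by simp), map_mul, ip_conj_symm, h2, pow_zero, mul_one,
    conj_jacobiCoeff]
  linear_combination evalAt w h * jacobiConst_mul_jacobiCoeff hn k l

/-- The sum formula for the reproducing kernel. -/
theorem sum_evalAt_mul_conj (hn : 2 ≤ n) {N : ℕ} {h : Fin N → Poly n}
    (hh : ∀ s, h s ∈ homPoly n k l) (hΔ : ∀ s, laplace n (h s) = 0)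
    (hexp : ∀ f ∈ harm n k l, f = ∑ s, ip (toFun n (h s)) f • toFun n (h s)) (x y : E n) :
    ∑ s, evalAt x (h s) * (starRingEnd ℂ) (evalAt y (h s)) = evalAt x (zonalPoly n k l y) := by
  -- Expand the kernel itself in the orthonormal basis; by the reproducing property its coefficients
  -- are the conjugate values at `y`.
  have h1 := hexp _ (mem_harm.2 ⟨_, zonalPoly_mem k l y, laplace_zonalPoly k l y hn, rfl⟩)
  have h2 : toFun n (zonalPoly n k l y - ∑ s, (starRingEnd ℂ) (evalAt y (h s)) • h s) = 0 := by
    rw [map_sub, map_sum, sub_eq_zero]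
    conv_lhs => rw [h1]
    refine Finset.sum_congr rfl fun s _ => ?_
    rw [← ip_conj_symm, ip_zonalPoly hn y (hh s) (hΔ s), map_smul]
  have h3 := evalAt_eq_zero_of_sphere (by omega) (Submodule.sub_mem _ (zonalPoly_mem k l y)
    (Submodule.sum_mem _ fun s _ => Submodule.smul_mem _ _ (hh s))) h2 x
  rw [map_sub, map_sum, sub_eq_zero] at h3
  rw [h3]
  simp [mul_comm]

/-- The prefactor is `(‖x‖ ‖y‖) ^ (k + l)`, which clears the denominators of the Jacobi polynomial
and leaves its homogenization. -/
theorem zonalFactor_eq {d : ℕ} (hd : d = n + 1) {u v t : ℂ} {x y : E n} (hu : 1 - ‖u‖ ^ 2 = ‖x‖ ^ 2)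
    (hv : 1 - ‖v‖ ^ 2 = ‖y‖ ^ 2) (ht : t - (starRingEnd ℂ) u * v = inner ℂ x y) :
    zonalFactor d k l u v t = evalAt x (zonalPoly n k l y) := by
  have hpow : ∀ x : E n, (‖x‖ ^ 2) ^ (((k + l : ℕ) : ℝ) / 2) = ‖x‖ ^ (k + l) := by
    intro x
    rw [← Real.rpow_natCast ‖x‖ 2, ← Real.rpow_mul (norm_nonneg x), ← Real.rpow_natCast]
    congr 1
    push_cast
    ring
  have hsq : Real.sqrt (‖x‖ ^ 2 * ‖y‖ ^ 2) = ‖x‖ * ‖y‖ := by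
    rw [← mul_pow, Real.sqrt_sq (by positivity)]
  rw [zonalFactor, hu, hv, ht, hpow, hpow, hsq, show d - 1 = n by omega, jacobi_eq,
    evalAt_zonalPoly, map_mul, conj_jacobiConst, map_sum]
  simp only [map_mul, map_pow, conj_jacobiCoeff, map_div₀, Complex.conj_ofReal,
    inner_conj_symm]
  rw [← Complex.ofReal_mul, ← mul_pow, ← mul_assoc, mul_comm _ (jacobiConst n k l), mul_assoc,
    Finset.mul_sum]
  congr 1
  refine Finset.sum_congr rfl fun r hr => ?_
  rw [Finset.mem_range] at hr
  obtain ⟨a, rfl⟩ : ∃ a, k = a + r := ⟨k - r, by omega⟩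
  obtain ⟨b, rfl⟩ : ∃ b, l = b + r := ⟨l - r, by omega⟩
  rw [Nat.add_sub_cancel, Nat.add_sub_cancel, mul_comm (‖y‖ : ℂ)]
  -- If a norm is zero, the quotient takes the default value `0`; corresponding terms are then zero
  -- on both sides unless `k = l = 0`, in agreement with the stated convention.
  rcases eq_or_ne (‖x‖ * ‖y‖) 0 with h0 | h0
  · have hxy : inner ℂ x y = (0 : ℂ) := norm_le_zero_iff.1 (by
      rw [← h0]; exact norm_inner_le_norm x y)
    have hyx : inner ℂ y x = (0 : ℂ) := by rw [← inner_conj_symm, hxy, map_zero]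
    rw [h0, hxy, hyx]
    have h0' : (‖x‖ : ℂ) * ‖y‖ = 0 := by exact_mod_cast h0
    rw [h0']
    rcases r with _ | r
    · rcases a with _ | a
      · rcases b with _ | b
        · simp
        · simp
      · simp
    · simp
  · have key : ∀ T C P Q : ℂ, T ≠ 0 → T ^ (a + r + (b + r)) * (C * (P / T) ^ a * (Q / T) ^ b) =
        C * T ^ (2 * r) * (P ^ a * Q ^ b) := by
      intro T C P Q hT
      rw [div_pow, div_pow, show a + r + (b + r) = a + b + 2 * r by omega, pow_add, pow_add]
      have := pow_ne_zero a hT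
      have := pow_ne_zero b hT
      field_simp
    rw [← Complex.ofReal_mul, Complex.ofReal_pow]
    exact key _ _ _ _ (Complex.ofReal_ne_zero.2 h0)

end Kernel

/-! ### Equivariant maps -/

section Equivariant

/-- The images of the standard basis vectors. -/
def frame {d n : ℕ} (ψ : E n →ₗᵢ[ℂ] E d) : Fin n → E d := fun r => ψ (EuclideanSpace.single r 1)

variable {d : ℕ} {e : Om d} {ψ : E (d - 1) →ₗᵢ[ℂ] E d} {p q i j : ℕ}

theorem isFrame_frame (hd : 1 ≤ d) (hψ : ∀ w, inner ℂ (e : E d) (ψ w) = 0) :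
    IsFrame (e : E d) (frame ψ) :=
  ⟨norm_eq_of_mem_sphere e, by
    rw [orthonormal_iff_ite]
    intro r s
    rw [frame, frame, ψ.inner_map_map]
    simpa using orthonormal_iff_ite.1 (EuclideanSpace.basisFun (Fin (d - 1)) ℂ).orthonormal r s,
    fun r => hψ _, by omega⟩

theorem emb_frame (w : E (d - 1)) : emb (frame ψ) w = ψ w := by
  conv_rhs => rw [← (EuclideanSpace.basisFun (Fin (d - 1)) ℂ).sum_repr w]
  simp [emb, frame, map_sum]

theorem evalAt_eq_of_toFun_eq {n : ℕ} (hn : 0 < n) {P Q : Poly n} (hP : P ∈ homPoly n i j)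
    (hQ : Q ∈ homPoly n i j) (h : toFun n P = toFun n Q) (x : E n) : evalAt x P = evalAt x Q := by
  have := evalAt_eq_zero_of_sphere hn (Submodule.sub_mem _ hP hQ) (by rw [map_sub, h, sub_self]) x
  rwa [map_sub, sub_eq_zero] at this

/-- A linear section of the restriction map. It lets a function on the unit sphere be evaluated at
the unnormalized `x'`. -/
theorem exists_lift (n i j : ℕ) : ∃ L : harm n i j →ₗ[ℂ] Poly n, ∀ F : harm n i j,
    L F ∈ homPoly n i j ∧ laplace n (L F) = 0 ∧ toFun n (L F) = F := by
  obtain ⟨L, hL⟩ := LinearMap.exists_rightInverse_of_surjective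
    ((toFun n).submoduleMap (homPoly n i j ⊓ LinearMap.ker (laplace n)))
    (LinearMap.range_eq_top.2 (LinearMap.submoduleMap_surjective _ _))
  refine ⟨(Submodule.subtype _) ∘ₗ L, fun F => ?_⟩
  have h1 := (L F).2
  rw [Submodule.mem_inf, LinearMap.mem_ker] at h1
  refine ⟨h1.1, h1.2, ?_⟩
  exact congrArg Subtype.val (LinearMap.congr_fun hL F)

/-- The equivariant map `h ↦ P_a(u) h(x')`. -/
theorem exists_tensorMap (hd : 3 ≤ d) (hψ : ∀ w, inner ℂ (e : E d) (ψ w) = 0)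
    (hpq : p = 0 ∨ q = 0) {f : ℕ → ℝ[X]} (hf : IsDiskOrthogonal (i + j + (d - 1 - 1)) p q f)
    (a : ℕ) : ∃ T : harm (d - 1) i j →ₗ[ℂ] (Om d → ℂ), StabEquivariant e ψ T ∧
      LinearMap.range T ≤ harm d (p + i + a) (q + j + a) ∧
      ∀ (h : Poly (d - 1)) (F : harm (d - 1) i j), h ∈ homPoly (d - 1) i j →
        toFun (d - 1) h = F → T F = diskTensor (e : E d) (frame ψ) p q (f a) h := by
  have hF := isFrame_frame (by omega) hψ
  obtain ⟨L, hL⟩ := exists_lift (d - 1) i j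
  refine ⟨{ toFun := fun F => diskTensor (e : E d) (frame ψ) p q (f a) (L F)
            map_add' := fun F G => ?_
            map_smul' := fun c F => ?_ }, ?_, ?_, ?_⟩
  · ext x; simp [diskTensor]; ring
  · ext x; simp [diskTensor]; ring
  · intro g k hg hk F F' hFF' z
    have h1 : inner ℂ (e : E d) (rot g z : E d) = (inner ℂ (e : E d) (z : E d) : ℂ) := by
      conv_lhs => rw [← hg]
      exact g.inner_map_map _ _
    have h2 : coord (frame ψ) (rot g z : E d) = k (coord (frame ψ) (z : E d)) := by
      have h3 : (rot g z : E d) = (inner ℂ (e : E d) (z : E d) : ℂ) • (e : E d) +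
          emb (frame ψ) (k (coord (frame ψ) (z : E d))) := by
        change g (z : E d) = _
        conv_lhs => rw [hF.eq_add (z : E d)]
        rw [map_add, map_smul, hg, emb_frame, emb_frame, hk]
      rw [h3, hF.coord_add_emb]
    have h4 : evalAt (coord (frame ψ) (z : E d)) (L F') =
        evalAt (k (coord (frame ψ) (z : E d))) (L F) := by
      have h5 : toFun (d - 1) (L F') =
          toFun (d - 1) (pull (fun r => k.symm (EuclideanSpace.single r 1)) (L F)) := by
        ext w
        rw [toFun_pull_symm, (hL F').2.2, (hL F).2.2, hFF']
      have h6 := evalAt_eq_of_toFun_eq (by omega) (hL F').1 (pull_mem_homPoly _ (hL F).1) h5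
        (coord (frame ψ) (z : E d))
      rw [h6, evalAt_pull, coord_symm]
    simp only [LinearMap.coe_mk, AddHom.coe_mk, diskTensor, h1, h2, h4]
  · rintro _ ⟨F, rfl⟩
    obtain ⟨r, hr⟩ := exists_harmonic_toFun_eq_diskTensor hF (by omega) hpq hf a
    have := hr _ (hL F).1 (hL F).2.1
    exact mem_harm.2 ⟨_, this⟩
  · intro h F hh hhF
    ext x
    simp only [LinearMap.coe_mk, AddHom.coe_mk, diskTensor]
    rw [evalAt_eq_of_toFun_eq (by omega) (hL F).1 hh ((hL F).2.2.trans hhF.symm)]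

/-- Equivariant maps to the harmonic functions of a given bidegree are unique up to a factor. -/
theorem StabEquivariant.exists_eq_smul (hd : 3 ≤ d) (hψ : ∀ w, inner ℂ (e : E d) (ψ w) = 0)
    (hpq : p = 0 ∨ q = 0) {f : ℕ → ℝ[X]} (hf : IsDiskOrthogonal (i + j + (d - 1 - 1)) p q f)
    {a : ℕ} {T : harm (d - 1) i j →ₗ[ℂ] (Om d → ℂ)} (hT : StabEquivariant e ψ T)
    (hr : LinearMap.range T ≤ harm d (p + i + a) (q + j + a)) : ∃ c : ℂ,
      ∀ (h : Poly (d - 1)) (F : harm (d - 1) i j), h ∈ homPoly (d - 1) i j →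
        laplace (d - 1) h = 0 → toFun (d - 1) h = F →
          T F = c • diskTensor (e : E d) (frame ψ) p q (f a) h := by
  have hF := isFrame_frame (by omega) hψ
  have hy : (EuclideanSpace.single (⟨0, by omega⟩ : Fin (d - 1)) (1 : ℂ)) ∈
      Metric.sphere (0 : E (d - 1)) 1 := by simp
  let w₀ : Om (d - 1) := ⟨_, hy⟩
  -- For fixed `u`, the value of `T F` in the direction `w₀` is a functional of `F` invariant under
  -- the stabilizer of `w₀`, hence a multiple of `F w₀`. Transitivity carries the same factor to
  -- every direction.
  have hC : ∀ u : ℂ, ∃ c : ℂ, ∀ (hu : ‖u‖ < 1) (F : harm (d - 1) i j) (w : Om (d - 1)),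
      T F (hF.point u hu w) = c * (F : Om (d - 1) → ℂ) w := by
    intro u
    by_cases hu : ‖u‖ < 1
    · obtain ⟨c, hc⟩ := exists_eq_smul_eval (by omega) w₀
        ((LinearMap.proj (hF.point u hu w₀)).comp T) (by
          intro k hk F F' hFF'
          obtain ⟨g, hg, hgk⟩ := hF.exists_extension k
          have h1 := hT g k hg (fun w => by rw [← emb_frame, hgk, emb_frame]) F F' hFF'
            (hF.point u hu w₀)
          rw [hF.rot_point hg hgk, show rot k w₀ = w₀ from Subtype.ext hk] at h1
          exact h1)
      refine ⟨c, fun hu F w => ?_⟩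
      obtain ⟨k, hk⟩ := exists_unitary_apply_eq (by omega) w₀ w
      have hk' : rot k w₀ = w := Subtype.ext hk
      obtain ⟨g, hg, hgk⟩ := hF.exists_extension k
      have h1 := hT g k hg (fun w => by rw [← emb_frame, hgk, emb_frame]) F
        ⟨_, comp_rot_mem_harm k F.2⟩ (fun _ => rfl) (hF.point u hu w₀)
      rw [hF.rot_point hg hgk, hk'] at h1
      rw [← h1]
      refine (hc _).trans ?_
      change c * (F : Om (d - 1) → ℂ) (rot k w₀) = _
      rw [hk']
    · exact ⟨0, fun hu' => absurd hu' hu⟩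
  choose C hC using hC
  -- Rigidity gives a scalar for each `h` separately. Comparing at one `u₀` with `P_a(u₀) ≠ 0`
  -- expresses it through `C u₀`, independently of `h`.
  obtain ⟨u₀, hu₀, hne⟩ := exists_diskFun_ne_zero (p := p) (q := q)
    (ne_zero_of_degree_eq hf.1 a)
  have hs : (Real.sqrt (1 - ‖u₀‖ ^ 2) : ℂ) ≠ 0 := by
    exact_mod_cast (Real.sqrt_pos.2 (by nlinarith [norm_nonneg u₀])).ne'
  set s : ℂ := (Real.sqrt (1 - ‖u₀‖ ^ 2) : ℂ) with hsdef
  refine ⟨C u₀ / (diskFun p q (f a) u₀ * (s ^ i * (starRingEnd ℂ) s ^ j)), ?_⟩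
  intro h F hh hΔ hhF
  by_cases hw : ∃ w : Om (d - 1), evalAt (w : E (d - 1)) h ≠ 0
  · obtain ⟨w, hw⟩ := hw
    obtain ⟨Q, hQ, hQΔ, hQF⟩ := mem_harm.1 (hr ⟨F, rfl⟩)
    obtain ⟨c, hc⟩ := toFun_eq_smul_diskTensor hF (by omega) hpq hh hΔ w hw hQ hQΔ C (by
      intro u hu w
      have h1 := hC u hu F w
      rw [← hQF, ← hhF] at h1
      exact h1) hf
    rw [hQF] at hc
    have h1 := hC u₀ hu₀ F w
    have h2 : diskTensor (e : E d) (frame ψ) p q (f a) h (hF.point u₀ hu₀ w) =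
        diskFun p q (f a) u₀ * (s ^ i * (starRingEnd ℂ) s ^ j * evalAt (w : E (d - 1)) h) := by
      rw [diskTensor, IsFrame.point, hF.inner_add_emb, hF.coord_add_emb, evalAt_smul hh]
    rw [hc, Pi.smul_apply, smul_eq_mul, h2, ← hhF, toFun_apply] at h1
    rw [hc]
    congr 1
    have hs' : (starRingEnd ℂ) s ≠ 0 := by simpa using hs
    rw [eq_div_iff (by positivity)]
    apply mul_right_cancel₀ hw
    rw [← h1]
    ring
  · push Not at hw
    have h0 : toFun (d - 1) h = 0 := funext hw
    have hF0 : F = 0 := Subtype.ext (by rw [← hhF, h0]; rfl)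
    rw [hF0, map_zero]
    ext x
    simp [diskTensor, evalAt_eq_zero_of_sphere (by omega) hh h0]

/-- An element of the stabilizer of `e` acts on the complement of `e` by a unitary map. -/
theorem exists_restriction (hd : 1 ≤ d) (hψ : ∀ w, inner ℂ (e : E d) (ψ w) = 0) {g : U d}
    (hg : g (e : E d) = e) : ∃ k : U (d - 1), ∀ w, g (ψ w) = ψ (k w) := by
  have hF := isFrame_frame hd hψ
  have h0 : ∀ w, g (ψ w) = emb (frame ψ) (coord (frame ψ) (g (ψ w))) := by
    intro w
    have h1 : inner ℂ (e : E d) (g (ψ w)) = (0 : ℂ) := by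
      rw [← hg, g.inner_map_map, hψ]
    conv_lhs => rw [hF.eq_add (g (ψ w)), h1, zero_smul, zero_add]
  let K : E (d - 1) →ₗᵢ[ℂ] E (d - 1) :=
    { toFun := fun w => coord (frame ψ) (g (ψ w))
      map_add' := fun x y => by ext r; simp [coord]
      map_smul' := fun c x => by ext r; simp [coord]
      norm_map' := fun w => by
        have h2 := congrArg norm (h0 w)
        rw [emb_frame, g.norm_map, ψ.norm_map, ψ.norm_map] at h2
        exact h2.symm }
  refine ⟨K.toLinearIsometryEquiv rfl, fun w => ?_⟩
  rw [h0, emb_frame]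
  rfl

/-- Every equivariant map into this bidegree is a multiple of `T`, so the isotypic part is a single
copy. -/
theorem component_eq_range (hd : 3 ≤ d) (hψ : ∀ w, inner ℂ (e : E d) (ψ w) = 0)
    (hpq : p = 0 ∨ q = 0) {f : ℕ → ℝ[X]} (hf : IsDiskOrthogonal (i + j + (d - 1 - 1)) p q f)
    {a : ℕ} {T : harm (d - 1) i j →ₗ[ℂ] (Om d → ℂ)} (hT : StabEquivariant e ψ T)
    (hr : LinearMap.range T ≤ harm d (p + i + a) (q + j + a))
    (hTh : ∀ (h : Poly (d - 1)) (F : harm (d - 1) i j), h ∈ homPoly (d - 1) i j →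
        toFun (d - 1) h = F → T F = diskTensor (e : E d) (frame ψ) p q (f a) h) :
    component e ψ (p + i + a) (q + j + a) i j = LinearMap.range T := by
  refine le_antisymm (iSup₂_le ?_) (le_iSup₂_of_le T ⟨hT, hr⟩ le_rfl)
  rintro T' ⟨hT', hr'⟩ _ ⟨F, rfl⟩
  obtain ⟨c, hc⟩ := hT'.exists_eq_smul hd hψ hpq hf hr'
  obtain ⟨h, hh, hΔ, hhF⟩ := mem_harm.1 F.2
  rw [hc h F hh hΔ hhF, ← hTh h F hh hhF]
  exact ⟨c • F, map_smul _ _ _⟩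

end Equivariant

/-! ### The zonal matrix -/

section ZonalMatrix

variable {d : ℕ} {e : Om d} {ψ : E (d - 1) →ₗᵢ[ℂ] E d} {k l p q i j : ℕ}

theorem exists_equiv_ranges {V W : Type*} [AddCommGroup V] [Module ℂ V] [AddCommGroup W]
    [Module ℂ W] {S S' : Submodule ℂ W} {T T' : V →ₗ[ℂ] W} (hT : Function.Injective T)
    (hT' : Function.Injective T') (hS : S = LinearMap.range T) (hS' : S' = LinearMap.range T')
    {c : ℂ} (hc : c ≠ 0) :
    ∃ Φ : S ≃ₗ[ℂ] S', ∀ (F : V) (f : S), (f : W) = T F → (Φ f : W) = c • T' F := by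
  subst hS hS'
  refine ⟨((LinearEquiv.ofInjective T hT).symm.trans (LinearEquiv.smulOfNeZero ℂ V c hc)).trans
    (LinearEquiv.ofInjective T' hT'), fun F f hf => ?_⟩
  have h1 : f = LinearEquiv.ofInjective T hT F := Subtype.ext hf
  rw [h1]
  simp

/-- The squared norm of `P_a`, with the normalization of the sphere. -/
def radialNorm (d w p q : ℕ) (f : ℝ[X]) : ℝ :=
  ((d - 1 : ℕ) : ℝ) / Real.pi * diskInt w (X ^ (p + q) * (f * f))

theorem radialNorm_pos (hd : 3 ≤ d) {w : ℕ} {f : ℝ[X]} (hf : f ≠ 0) : 0 < radialNorm d w p q f := by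
  have h1 : (0 : ℝ) < ((d - 1 : ℕ) : ℝ) := by exact_mod_cast (by omega : 0 < d - 1)
  exact mul_pos (div_pos h1 Real.pi_pos)
    (lt_of_le_of_ne (diskInt_sq_nonneg _ _ _) (diskInt_self_ne_zero hf).symm)

/-- A family of equivariant maps from `Harm_{d-1}(i, j)` onto the spaces `S_a`. -/
structure IsTensorFamily (e : Om d) (ψ : E (d - 1) →ₗᵢ[ℂ] E d) (p q : ℕ) (f : ℕ → ℝ[X])
    (T : ℕ → harm (d - 1) i j →ₗ[ℂ] (Om d → ℂ)) : Prop where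
  equivariant : ∀ a, StabEquivariant e ψ (T a)
  range_le : ∀ a, LinearMap.range (T a) ≤ harm d (p + i + a) (q + j + a)
  apply_eq : ∀ a (h : Poly (d - 1)) (F : harm (d - 1) i j), h ∈ homPoly (d - 1) i j →
    toFun (d - 1) h = F → T a F = diskTensor (e : E d) (frame ψ) p q (f a) h

theorem exists_isTensorFamily (hd : 3 ≤ d) (hψ : ∀ w, inner ℂ (e : E d) (ψ w) = 0)
    (hpq : p = 0 ∨ q = 0) {f : ℕ → ℝ[X]} (hf : IsDiskOrthogonal (i + j + (d - 1 - 1)) p q f) :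
    ∃ T : ℕ → harm (d - 1) i j →ₗ[ℂ] (Om d → ℂ), IsTensorFamily e ψ p q f T := by
  choose T h1 h2 h3 using exists_tensorMap hd hψ hpq hf
  exact ⟨T, h1, h2, h3⟩

section Family

variable {f : ℕ → ℝ[X]} {T : ℕ → harm (d - 1) i j →ₗ[ℂ] (Om d → ℂ)}

theorem IsTensorFamily.ip_eq (h : IsTensorFamily e ψ p q f T) (hd : 3 ≤ d)
    (hψ : ∀ w, inner ℂ (e : E d) (ψ w) = 0) (a : ℕ) (F G : harm (d - 1) i j) :
    ip (T a F) (T a G) =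
      ((radialNorm d (i + j + (d - 1 - 1)) p q (f a) : ℝ) : ℂ) * ip (F : Om (d - 1) → ℂ) G := by
  obtain ⟨P, hP, -, hPF⟩ := mem_harm.1 F.2
  obtain ⟨Q, hQ, -, hQG⟩ := mem_harm.1 G.2
  rw [h.apply_eq a P F hP hPF, h.apply_eq a Q G hQ hQG,
    ip_diskTensor (isFrame_frame (by omega) hψ) (by omega) hP hQ, hPF, hQG, radialNorm]

/-- `T a` multiplies inner products by a positive constant. -/
theorem IsTensorFamily.injective (h : IsTensorFamily e ψ p q f T) (hd : 3 ≤ d)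
    (hψ : ∀ w, inner ℂ (e : E d) (ψ w) = 0) (hdeg : ∀ a, (f a).degree = a) (a : ℕ) :
    Function.Injective (T a) := by
  rw [← LinearMap.ker_eq_bot, LinearMap.ker_eq_bot']
  intro F hF
  have h1 := h.ip_eq hd hψ a F F
  have h2 : ip (0 : Om d → ℂ) 0 = 0 := by simp [ip]
  rw [hF, h2] at h1
  have h3 : ((radialNorm d (i + j + (d - 1 - 1)) p q (f a) : ℝ) : ℂ) ≠ 0 := by
    exact_mod_cast (radialNorm_pos hd (ne_zero_of_degree_eq hdeg a)).ne'
  exact Subtype.ext (eq_zero_of_ip_self (continuous_of_mem_harm F.2)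
    ((mul_eq_zero.1 h1.symm).resolve_left h3))

theorem IsTensorFamily.copy_eq (h : IsTensorFamily e ψ p q f T) (hd : 3 ≤ d)
    (hψ : ∀ w, inner ℂ (e : E d) (ψ w) = 0)
    (hf : IsDiskOrthogonal (i + j + (d - 1 - 1)) p q f) (hik : i ≤ k) (hjl : j ≤ l)
    (hp : p = k - i - mult k l i j) (hq : q = l - j - mult k l i j) (a : ℕ) :
    copy e ψ k l i j a = LinearMap.range (T a) := by
  have hm : mult k l i j = min (k - i) (l - j) := rfl
  rw [copy, show k - mult k l i j + a = p + i + a by omega,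
    show l - mult k l i j + a = q + j + a by omega]
  exact component_eq_range hd hψ (by omega) hf (h.equivariant a) (h.range_le a) (h.apply_eq a)

/-- The isomorphism is `c` times `T a` after the inverse of `T 0`, and both maps are equivariant.
The factor `c` is needed to match normalized bases. -/
theorem IsTensorFamily.exists_equiv (h : IsTensorFamily e ψ p q f T) (hd : 3 ≤ d)
    (hψ : ∀ w, inner ℂ (e : E d) (ψ w) = 0) (hdeg : ∀ a, (f a).degree = a) {a : ℕ}
    {S S' : Submodule ℂ (Om d → ℂ)} (hS : S = LinearMap.range (T 0))
    (hS' : S' = LinearMap.range (T a)) {c : ℂ} (hc : c ≠ 0) :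
    ∃ Φ : S ≃ₗ[ℂ] S',
      (∀ g : U d, g e = e → ∀ f f' : S,
        (∀ z, (f' : Om d → ℂ) z = (f : Om d → ℂ) (rot g z)) →
          ∀ z, (Φ f' : Om d → ℂ) z = (Φ f : Om d → ℂ) (rot g z)) ∧
      ∀ (F : harm (d - 1) i j) (f : S), (f : Om d → ℂ) = T 0 F → (Φ f : Om d → ℂ) = c • T a F := by
  obtain ⟨Φ, hΦ⟩ := exists_equiv_ranges (h.injective hd hψ hdeg 0) (h.injective hd hψ hdeg a)
    hS hS' hc
  refine ⟨Φ, fun g hg s s' hs z => ?_, hΦ⟩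
  obtain ⟨F, hF⟩ : ∃ F, T 0 F = s := hS.le s.2
  obtain ⟨κ, hκ⟩ := exists_restriction (by omega) hψ hg
  let F' : harm (d - 1) i j := ⟨_, comp_rot_mem_harm κ F.2⟩
  have h1 : (s' : Om d → ℂ) = T 0 F' := by
    ext z
    rw [hs, ← hF]
    exact (h.equivariant 0 g κ hg hκ F F' (fun _ => rfl) z).symm
  rw [hΦ F' s' h1, hΦ F s hF.symm, Pi.smul_apply, Pi.smul_apply,
    h.equivariant a g κ hg hκ F F' (fun _ => rfl) z]

end Family

theorem exists_isZonalBasis (hd : 3 ≤ d) (hik : i ≤ k) (hjl : j ≤ l)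
    (hψ : ∀ w, inner ℂ (e : E d) (ψ w) = 0) (hp : p = k - i - mult k l i j)
    (hq : q = l - j - mult k l i j) {f : ℕ → ℝ[X]}
    (hf : IsDiskOrthogonal (i + j + (d - 1 - 1)) p q f) :
    ∃ (h : ℕ) (b : Fin (mult k l i j + 1) → Fin h → Om d → ℂ), IsZonalBasis e ψ k l i j b := by
  have hm : mult k l i j = min (k - i) (l - j) := rfl
  obtain ⟨T, hT⟩ := exists_isTensorFamily (i := i) (j := j) hd hψ (by omega : p = 0 ∨ q = 0) hf
  obtain ⟨N, b, hb, hon, hexp⟩ := exists_orthonormal_harm (d - 1) i j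
  have hpos := fun a => radialNorm_pos (p := p) (q := q) (w := i + j + (d - 1 - 1)) hd
    (ne_zero_of_degree_eq hf.1 a)
  -- The inverse of the factor by which `T a` stretches norms.
  let c : ℕ → ℂ := fun a =>
    (((Real.sqrt (radialNorm d (i + j + (d - 1 - 1)) p q (f a)))⁻¹ : ℝ) : ℂ)
  have hc : ∀ a, c a ≠ 0 := fun a => by
    exact Complex.ofReal_ne_zero.2 (inv_pos.2 (Real.sqrt_pos.2 (hpos a))).ne'
  let B : Fin N → harm (d - 1) i j := fun s => ⟨b s, hb s⟩
  have hspan : Submodule.span ℂ (Set.range B) = ⊤ := by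
    rw [eq_top_iff]
    rintro F -
    have h1 : F = ∑ s, ip (b s) F • B s := Subtype.ext (by
      rw [Submodule.coe_sum]
      exact hexp F F.2)
    rw [h1]
    exact Submodule.sum_mem _ fun s _ => Submodule.smul_mem _ _ (Submodule.subset_span ⟨s, rfl⟩)
  have hcopy := fun a => hT.copy_eq hd hψ hf hik hjl hp hq a
  refine ⟨N, fun a s => c a • T a (B s), fun a r s => ?_, fun a => ?_, fun a => ?_⟩
  · rw [ip_smul_left, ip_smul_right, hT.ip_eq hd hψ, hon]
    have h1 := Real.mul_self_sqrt (hpos a).le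
    have h2 := (Real.sqrt_pos.2 (hpos a)).ne'
    have h3 : (starRingEnd ℂ) (c a) * (c a *
        ((radialNorm d (i + j + (d - 1 - 1)) p q (f a) : ℝ) : ℂ)) = 1 := by
      simp only [c, Complex.conj_ofReal]
      rw [← Complex.ofReal_mul, ← Complex.ofReal_mul, ← Complex.ofReal_one]
      congr 1
      nth_rewrite 3 [← h1]
      field_simp
    rw [← mul_assoc, ← mul_assoc, mul_assoc _ (c a), h3, one_mul]
  · have h1 : (Set.range fun s => c a • T a (B s)) = (c a • T a) '' Set.range B := by
      rw [← Set.range_comp]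
      rfl
    rw [h1, Submodule.span_image, hspan, hcopy, Submodule.map_top, LinearMap.range_smul _ _ (hc a)]
  · obtain ⟨Φ, h1, h2⟩ := hT.exists_equiv hd hψ hf.1 (hcopy 0) (hcopy a)
      (div_ne_zero (hc a) (hc 0))
    refine ⟨Φ, h1, fun s s' hs => ?_⟩
    have h3 := h2 (c 0 • B s) s' (by rw [hs, map_smul]; rfl)
    rw [h3, map_smul, smul_smul, div_mul_cancel₀ _ (hc 0)]

theorem eq_sum_of_mem_span {n N : ℕ} {b : Fin N → Om n → ℂ} (hb : ∀ s, Continuous (b s))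
    (hon : ∀ r s, ip (b r) (b s) = if r = s then 1 else 0) {F : Om n → ℂ}
    (hF : F ∈ Submodule.span ℂ (Set.range b)) : F = ∑ s, ip (b s) F • b s := by
  obtain ⟨c, rfl⟩ := (Submodule.mem_span_range_iff_exists_fun ℂ).1 hF
  refine Finset.sum_congr rfl fun s _ => ?_
  rw [ip_sum_right _ (hb s) (fun r => (hb r).const_smul _)]
  simp [ip_smul_right, hon]

/-- The zonal function is a nonzero element. A basis vector must exist for the norm condition on
`λ_a` to be read off from it. -/
theorem nonempty_of_orthonormal {n N : ℕ} (hn : 2 ≤ n) {b : Fin N → Om n → ℂ}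
    (hexp : ∀ F ∈ harm n i j, F = ∑ s, ip (b s) F • b s) : Nonempty (Fin N) := by
  by_contra h
  rw [not_nonempty_iff] at h
  obtain ⟨m, rfl⟩ : ∃ m, n = m + 1 := ⟨n - 1, by omega⟩
  have hy : (EuclideanSpace.single (0 : Fin (m + 1)) (1 : ℂ)) ∈
      Metric.sphere (0 : E (m + 1)) 1 := by simp
  obtain ⟨F, hF, hFw, -⟩ := exists_zonal_function (i := i) (j := j) ⟨_, hy⟩ (by omega : 0 < m)
  rw [hexp F hF] at hFw
  simp at hFw

/-- The zonal matrix of an admissible system in terms of disk polynomials. -/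
theorem IsZonalBasis.exists_zonalMatrix_eq (hd : 3 ≤ d) (hik : i ≤ k) (hjl : j ≤ l)
    (hψ : ∀ w, inner ℂ (e : E d) (ψ w) = 0) (hp : p = k - i - mult k l i j)
    (hq : q = l - j - mult k l i j) {f : ℕ → ℝ[X]}
    (hf : IsDiskOrthogonal (i + j + (d - 1 - 1)) p q f) {h : ℕ}
    {b : Fin (mult k l i j + 1) → Fin h → Om d → ℂ} (hb : IsZonalBasis e ψ k l i j b) :
    ∃ lam : Fin (mult k l i j + 1) → ℂ,
      (∀ a, ‖lam a‖ ^ 2 * radialNorm d (i + j + (d - 1 - 1)) p q (f a) = 1) ∧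
      ∀ x y : Om d, zonalMatrix b x y =
        entryMatrix d i j (fun a u => lam a * diskFun p q (f a) u)
          (inner ℂ (e : E d) (x : E d)) (inner ℂ (e : E d) (y : E d))
          (inner ℂ (x : E d) (y : E d)) := by
  have hm : mult k l i j = min (k - i) (l - j) := rfl
  have hpq : p = 0 ∨ q = 0 := by omega
  have hFr := isFrame_frame (by omega) hψ
  obtain ⟨T, hT⟩ := exists_isTensorFamily (i := i) (j := j) hd hψ hpq hf
  have hcopy := fun a => hT.copy_eq hd hψ hf hik hjl hp hq a
  have hinj := fun a => hT.injective hd hψ hf.1 a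
  obtain ⟨hon, hspan, hiso⟩ := hb
  have hpos := fun a => radialNorm_pos (p := p) (q := q) (w := i + j + (d - 1 - 1)) hd
    (ne_zero_of_degree_eq hf.1 a)
  set N : ℕ → ℝ := fun a => radialNorm d (i + j + (d - 1 - 1)) p q (f a) with hN
  have hmem : ∀ s, b 0 s ∈ copy e ψ k l i j 0 := fun s => by
    have h1 := hspan 0
    rw [Fin.val_zero] at h1
    rw [← h1]
    exact Submodule.subset_span ⟨s, rfl⟩
  have hG : ∀ s, ∃ G : harm (d - 1) i j, T 0 G = b 0 s := fun s => by
    have h1 := hmem s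
    rwa [hcopy 0] at h1
  choose G hG using hG
  -- The given isomorphism after `T 0` is equivariant into the bidegree of `S_a`, hence a multiple
  -- of `T a`. So all bases arise from the same functions `G s`, with a scalar depending only on
  -- `a`.
  have hc : ∀ a : Fin (mult k l i j + 1), ∃ c : ℂ, ∀ s, b a s = c • T a (G s) := by
    intro a
    obtain ⟨Φ, hΦ, hΦb⟩ := hiso a
    let T₀ : harm (d - 1) i j →ₗ[ℂ] copy e ψ k l i j 0 :=
      (T 0).codRestrict _ fun F => by rw [hcopy 0]; exact ⟨F, rfl⟩
    let T' : harm (d - 1) i j →ₗ[ℂ] (Om d → ℂ) :=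
      (copy e ψ k l i j a).subtype ∘ₗ Φ.toLinearMap ∘ₗ T₀
    have hT' : StabEquivariant e ψ T' := fun g κ hg hκ F F' hFF' z =>
      hΦ g hg (T₀ F) (T₀ F') (fun z => hT.equivariant 0 g κ hg hκ F F' hFF' z) z
    have hr' : LinearMap.range T' ≤ harm d (p + i + a) (q + j + a) := by
      rintro _ ⟨F, rfl⟩
      refine hT.range_le a ?_
      rw [← hcopy a]
      exact (Φ (T₀ F)).2
    obtain ⟨c, hc⟩ := hT'.exists_eq_smul hd hψ hpq hf hr'
    refine ⟨c, fun s => ?_⟩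
    obtain ⟨P, hP, hPΔ, hPG⟩ := mem_harm.1 (G s).2
    rw [← hΦb s (T₀ (G s)) (hG s), hT.apply_eq a P (G s) hP hPG]
    exact hc P (G s) hP hPΔ hPG
  choose c hc using hc
  -- `T 0` stretches norms by `√(N 0)`, so the rescaled functions `r • G s` form an orthonormal
  -- basis of `Harm_{d-1}(i, j)`.
  set r : ℂ := ((Real.sqrt (N 0) : ℝ) : ℂ) with hr
  have hr0 : r ≠ 0 := Complex.ofReal_ne_zero.2 (Real.sqrt_pos.2 (hpos 0)).ne'
  have hrr : (starRingEnd ℂ) r * r = ((N 0 : ℝ) : ℂ) := by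
    rw [hr, Complex.conj_ofReal, ← Complex.ofReal_mul, Real.mul_self_sqrt (hpos 0).le]
  let B : Fin h → Om (d - 1) → ℂ := fun s => r • (G s : Om (d - 1) → ℂ)
  have hBmem : ∀ s, B s ∈ harm (d - 1) i j := fun s => Submodule.smul_mem _ _ (G s).2
  have hBon : ∀ s t, ip (B s) (B t) = if s = t then 1 else 0 := by
    intro s t
    rw [← hon 0 s t, ← hG, ← hG, hT.ip_eq hd hψ, ip_smul_left, ip_smul_right, ← mul_assoc, hrr]
  have hBexp : ∀ F ∈ harm (d - 1) i j, F = ∑ s, ip (B s) F • B s := by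
    intro F hF
    refine eq_sum_of_mem_span (fun s => continuous_of_mem_harm (hBmem s)) hBon ?_
    have h1 : T 0 ⟨F, hF⟩ ∈ Submodule.span ℂ (Set.range (b 0)) := by
      rw [hspan 0, Fin.val_zero, hcopy 0]
      exact ⟨_, rfl⟩
    obtain ⟨x, hx⟩ := (Submodule.mem_span_range_iff_exists_fun ℂ).1 h1
    have h2 : ∑ s, x s • G s = ⟨F, hF⟩ := hinj 0 (by
      rw [map_sum, ← hx]
      simp only [map_smul, hG])
    have h3 := congrArg Subtype.val h2
    rw [Submodule.coe_sum] at h3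
    change _ = F at h3
    rw [← h3]
    refine Submodule.sum_mem _ fun s _ => ?_
    have h4 : ((x s • G s : harm (d - 1) i j) : Om (d - 1) → ℂ) = (x s / r) • B s := by
      rw [smul_smul, div_mul_cancel₀ _ hr0]; rfl
    rw [h4]
    exact Submodule.smul_mem _ _ (Submodule.subset_span ⟨s, rfl⟩)
  have hP : ∀ s, ∃ P ∈ homPoly (d - 1) i j, laplace (d - 1) P = 0 ∧ toFun (d - 1) P = B s :=
    fun s => mem_harm.1 (hBmem s)
  choose P hP hPΔ hPB using hP
  have hbP : ∀ a s, b a s = (c a / r) • diskTensor (e : E d) (frame ψ) p q (f a) (P s) := by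
    intro a s
    have h1 := hT.apply_eq a (P s) (r • G s) (hP s) (hPB s)
    rw [hc, ← h1, map_smul, smul_smul, div_mul_cancel₀ _ hr0]
  refine ⟨fun a => c a / r, fun a => ?_, fun x y => ?_⟩
  · obtain ⟨s⟩ := nonempty_of_orthonormal (by omega) hBexp
    have h1 := hon a s s
    rw [if_pos rfl, hbP, ip_smul_left, ip_smul_right,
      ip_diskTensor hFr (by omega) (hP s) (hP s), hPB, hBon, if_pos rfl, mul_one, ← mul_assoc,
      Complex.conj_mul'] at h1
    exact_mod_cast h1
  · have hn : ∀ x : Om d, 1 - ‖(inner ℂ (e : E d) (x : E d) : ℂ)‖ ^ 2 =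
        ‖coord (frame ψ) (x : E d)‖ ^ 2 := fun x => (hFr.norm_coord_sq x).symm
    have ht : inner ℂ (x : E d) (y : E d) - (starRingEnd ℂ) (inner ℂ (e : E d) (x : E d)) *
        inner ℂ (e : E d) (y : E d) =
          (inner ℂ (coord (frame ψ) (x : E d)) (coord (frame ψ) (y : E d)) : ℂ) := by
      rw [hFr.inner_eq_add (x : E d) (y : E d), add_sub_cancel_left]
    ext a a'
    -- The sum over `s` does not see `a` and `a'`: it is the reproducing kernel at the components
    -- orthogonal to `e`.
    have h1 := sum_evalAt_mul_conj (by omega) hP hPΔ (by simpa only [hPB] using hBexp)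
      (coord (frame ψ) (x : E d)) (coord (frame ψ) (y : E d))
    rw [entryMatrix, Matrix.of_apply, zonalFactor_eq (by omega) (hn x) (hn y) ht, ← h1, zonalMatrix,
      Matrix.mul_apply, Finset.mul_sum]
    refine Finset.sum_congr rfl fun s _ => ?_
    simp only [Matrix.of_apply, Matrix.conjTranspose_apply, hbP, Pi.smul_apply, smul_eq_mul,
      diskTensor, RCLike.star_def, map_mul]
    ring

/-! ### Passing from disk polynomials to monomials -/

/-- `entryMatrix` is a scalar times the product of a column in `u` and the adjoint of a column in
`v`, so a linear change of the columns acts by `B` on the left and its adjoint on the right. -/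
theorem mul_entryMatrix_mul {M : ℕ} (B : Matrix (Fin (M + 1)) (Fin (M + 1)) ℂ)
    {F G : Fin (M + 1) → ℂ → ℂ} (h : ∀ a u, F a u = ∑ b, B a b * G b u) (u v t : ℂ) :
    B * entryMatrix d i j G u v t * B.conjTranspose = entryMatrix d i j F u v t := by
  have h1 : ∀ F : Fin (M + 1) → ℂ → ℂ, entryMatrix d i j F u v t =
      zonalFactor d i j u v t • Matrix.vecMulVec (fun a => F a u) (star fun a => F a v) := by
    intro F
    ext a b
    simp [entryMatrix, Matrix.vecMulVec_apply, mul_comm]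
  have h2 : ∀ u, (fun a => F a u) = B.mulVec fun a => G a u := fun u => funext fun a => h a u
  rw [h1, h1, h2, h2, Matrix.star_mulVec, Matrix.mul_smul, Matrix.smul_mul,
    Matrix.mul_vecMulVec, Matrix.vecMulVec_mul]

/-- The coefficient matrix of the polynomials `λ_a f_a` is lower triangular with nonzero diagonal,
because `f_a` has degree exactly `a`; `V` is its inverse. -/
theorem exists_mul_entryMatrix_mul {f : ℕ → ℝ[X]} (hdeg : ∀ a, (f a).degree = a) {M : ℕ}
    (lam : Fin (M + 1) → ℂ) (hlam : ∀ a, lam a ≠ 0) :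
    ∃ V : Matrix (Fin (M + 1)) (Fin (M + 1)) ℂ, IsUnit V ∧ ∀ u v t : ℂ,
      V * entryMatrix d i j (fun a u => lam a * diskFun p q (f a) u) u v t * V.conjTranspose =
        entryMatrix d i j
          (fun a u => u ^ p * (starRingEnd ℂ u) ^ q * ((‖u‖ ^ 2 : ℝ) : ℂ) ^ (a : ℕ)) u v t := by
  have hnat : ∀ a, (f a).natDegree = a := fun a => natDegree_eq_of_degree_eq_some (hdeg a)
  let B : Matrix (Fin (M + 1)) (Fin (M + 1)) ℂ :=
    Matrix.of fun a b => lam a * (((f a).coeff b : ℝ) : ℂ)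
  have hdet : IsUnit B.det := by
    rw [Matrix.det_of_isLowerTriangular B (by
      intro a b hab
      have hab' : (a : ℕ) < b := hab
      simp only [B, Matrix.of_apply]
      rw [coeff_eq_zero_of_natDegree_lt (by rwa [hnat]), Complex.ofReal_zero, mul_zero]),
      isUnit_iff_ne_zero, Finset.prod_ne_zero_iff]
    intro a _
    have h1 : (f a).coeff (a : ℕ) ≠ 0 := by
      have h2 := leadingCoeff_ne_zero.2 (ne_zero_of_degree_eq hdeg a)
      rwa [leadingCoeff, hnat] at h2
    exact mul_ne_zero (hlam a) (Complex.ofReal_ne_zero.2 h1)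
  have hexp : ∀ (a : Fin (M + 1)) (u : ℂ), lam a * diskFun p q (f a) u = ∑ b : Fin (M + 1),
      B a b * (u ^ p * (starRingEnd ℂ u) ^ q * ((‖u‖ ^ 2 : ℝ) : ℂ) ^ (b : ℕ)) := by
    intro a u
    have h1 := eval_eq_sum_range' (p := f a) (n := M + 1) (by rw [hnat]; exact a.2) (‖u‖ ^ 2)
    rw [diskFun, h1, ← Fin.sum_univ_eq_sum_range (fun b => (f a).coeff b * (‖u‖ ^ 2) ^ b),
      Complex.ofReal_sum, Finset.mul_sum, Finset.mul_sum]
    refine Finset.sum_congr rfl fun b _ => ?_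
    simp only [B, Matrix.of_apply]
    push_cast
    ring
  refine ⟨B⁻¹, (Matrix.isUnit_iff_isUnit_det _).2 (Matrix.isUnit_nonsing_inv_det _ hdet),
    fun u v t => ?_⟩
  rw [← mul_entryMatrix_mul B hexp, ← mul_assoc, ← mul_assoc, Matrix.nonsing_inv_mul _ hdet,
    one_mul, mul_assoc, ← Matrix.conjTranspose_mul, Matrix.nonsing_inv_mul _ hdet,
    Matrix.conjTranspose_one, mul_one]

end ZonalMatrix

end ComplexZonal

end

/-! ### The theorem -/

theorem mainTheorem2 (d k l i j : ℕ) (hd : 3 ≤ d) (hik : i ≤ k) (hjl : j ≤ l)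
    (e : ComplexZonal.Om d)
    (ψ : EuclideanSpace ℂ (Fin (d - 1)) →ₗᵢ[ℂ] EuclideanSpace ℂ (Fin d))
    (hψ : ∀ w, inner ℂ (e : EuclideanSpace ℂ (Fin d)) (ψ w) = 0)
    (p q : ℕ) (hp : p = k - i - ComplexZonal.mult k l i j)
    (hq : q = l - j - ComplexZonal.mult k l i j) :
    (∃ (h : ℕ) (b : Fin (ComplexZonal.mult k l i j + 1) → Fin h → ComplexZonal.Om d → ℂ),
      ComplexZonal.IsZonalBasis e ψ k l i j b) ∧
    (∃ f : ℕ → Polynomial ℝ, ComplexZonal.IsDiskOrthogonal (i + j + (d - 2)) p q f) ∧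
    ∀ (h : ℕ) (b : Fin (ComplexZonal.mult k l i j + 1) → Fin h → ComplexZonal.Om d → ℂ),
      ComplexZonal.IsZonalBasis e ψ k l i j b →
    ∀ f : ℕ → Polynomial ℝ, ComplexZonal.IsDiskOrthogonal (i + j + (d - 2)) p q f →
      ∃ lam : Fin (ComplexZonal.mult k l i j + 1) → ℂ,
        (∀ a, ‖lam a‖ ^ 2 * (((d : ℝ) - 1) / Real.pi *
          ∫ u in Metric.closedBall (0 : ℂ) 1,
            ‖ComplexZonal.diskFun p q (f a) u‖ ^ 2 * (1 - ‖u‖ ^ 2) ^ (i + j + (d - 2))) = 1) ∧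
        (∀ x y : ComplexZonal.Om d,
          ComplexZonal.zonalMatrix b x y =
            ComplexZonal.entryMatrix d i j
              (fun a u => lam a * ComplexZonal.diskFun p q (f a) u)
              (inner ℂ (e : EuclideanSpace ℂ (Fin d)) (x : EuclideanSpace ℂ (Fin d)))
              (inner ℂ (e : EuclideanSpace ℂ (Fin d)) (y : EuclideanSpace ℂ (Fin d)))
              (inner ℂ (x : EuclideanSpace ℂ (Fin d)) (y : EuclideanSpace ℂ (Fin d)))) ∧
        ∃ V : Matrix (Fin (ComplexZonal.mult k l i j + 1))
            (Fin (ComplexZonal.mult k l i j + 1)) ℂ,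
          IsUnit V ∧
          ∀ u v t : ℂ, ‖u‖ ≤ 1 → ‖v‖ ≤ 1 →
            V * ComplexZonal.entryMatrix d i j
                (fun a u => lam a * ComplexZonal.diskFun p q (f a) u) u v t * V.conjTranspose =
              ComplexZonal.entryMatrix d i j
                (fun a u => u ^ p * (starRingEnd ℂ u) ^ q * ((‖u‖ ^ 2 : ℝ) : ℂ) ^ (a : ℕ)) u v t := by
  have hd' : d - 2 = d - 1 - 1 := by omega
  -- `M` is the minimum of `k - i` and `l - j`, so one of the two differences is used up.
  have hpq : p = 0 ∨ q = 0 := by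
    rw [hp, hq, ComplexZonal.mult]
    omega
  have hex := ComplexZonal.isDiskOrthogonal_radialPoly
    (ComplexZonal.isFrame_frame (by omega) hψ) (by omega) hpq (i + j)
  rw [hd']
  refine ⟨ComplexZonal.exists_isZonalBasis hd hik hjl hψ hp hq hex, ⟨_, hex⟩, ?_⟩
  intro h b hb f hf
  obtain ⟨lam, hlam, hZ⟩ := hb.exists_zonalMatrix_eq hd hik hjl hψ hp hq hf
  obtain ⟨V, hV, hVE⟩ := ComplexZonal.exists_mul_entryMatrix_mul (d := d) (i := i) (j := j)
    (p := p) (q := q) hf.1 lam fun a ha => by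
      have h1 := hlam a
      simp [ha] at h1
  refine ⟨lam, fun a => ?_, hZ, V, hV, fun u v t _ _ => hVE u v t⟩
  rw [ComplexZonal.integral_norm_diskFun_sq]
  have h1 := hlam a
  rwa [ComplexZonal.radialNorm, Nat.cast_sub (by omega), Nat.cast_one] at h1
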